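/- Let $H$ and $Y$ be complex Hilbert spaces, let $A : D(A)\subset H\to H$ be a nonnegative self-adjoint operator with compact resolvent, and let $B\in\mathcal L(Y;H)$, with adjoint $B^*\in\mathcal L(H;Y)$. Let $\mathcal H = D(A^{1/2})\times H$ be equipped with the norm $\|(u_0,u_1)\|_{\mathcal H}^2=\|(A+\mathrm{Id})^{1/2}u_0\|_H^2+\|u_1\|_H^2$ (where $\|(A+\mathrm{Id})^{1/2}u_0\|_H^2=\|u_0\|_H^2+\|A^{1/2}u_0\|_H^2$) and the seminorm $|(u_0,u_1)|_{\mathcal H}^2=\|A^{1/2}u_0\|_H^2+\|u_1\|_H^2$. Let $\mathcal A$ be the operator on $\mathcal H$ with domain $D(\mathcal A)=D(A)\times D(A^{1/2})$ given by $\mathcal A(u_0,u_1)=(u_1,-Au_0-BB^*u_1)$, and for $z\in\mathbb C$ let $P(z)=A+z^2\,\mathrm{Id}+zBB^*$ with domain $D(A)$. The damped wave equation $$\partial_t^2u+Au+BB^*\partial_tu=0,\qquad (u,\partial_tu)|_{t=0}=(u_0,u_1)$$ is understood as $\partial_tU=\mathcal AU$, $U(0)=(u_0,u_1)$, for $U=(u,\partial_tu)$,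 and its energy is $E(u,t)=\frac12\big(\|A^{1/2}u(t)\|_H^2+\|\partial_tu(t)\|_H^2\big)$. It is said to be stable at rate $f(t)$ if there is $C>0$ such that, for all $(u_0,u_1)\in D(\mathcal A)$, the solution satisfies $E(u,t)^{1/2}\le C f(t)\,|\mathcal A(u_0,u_1)|_{\mathcal H}$ for all $t>0$. Suppose that $B^*\varphi\neq0$ for every eigenvector $\varphi$ of $A$. Then, for every $\alpha>0$, the following five assertions are equivalent (a bound on the norm of an inverse includes the assertion that the inverse exists as a bounded operator): 1. the damped wave equation is stable at rate $t^{-\alpha}$; 2. there exist $C>0$ and $s_0>0$ such that for all $s\in\mathbb R$ with $|s|\ge s_0$, $\ \|(is\,\mathrm{Id}-\mathcal A)^{-1}\|_{\mathcal L(\mathcal H)}\le C|s|^{1/\alpha}$; 3. there exist $C>0$ and $s_0>0$ such that for all $z\in\mathbb C$ with $|\operatorname{Im}z|\ge s_0$ and $|\operatorname{Re}z|\le \dfrac{1}{C|\operatorname{Im}z|^{1/\alpha}}$, $\ \|(z\,\mathrm{Id}-\mathcal A)^{-1}\|_{\mathcal L(\mathcal H)}\le C|\operatorname{Im}z|^{1/\alpha}$;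 4. there exist $C>0$ and $s_0>0$ such that for all $s\in\mathbb R$ with $|s|\ge s_0$, $\ \|P(is)^{-1}\|_{\mathcal L(H)}\le C|s|^{1/\alpha-1}$; 5. there exist $C>0$ and $s_0>0$ such that for all $s\in\mathbb R$ with $|s|\ge s_0$ and all $u\in D(A)$, $\ \|u\|_H^2\le C\big(|s|^{2/\alpha-2}\|P(is)u\|_H^2+|s|^{1/\alpha}\|B^*u\|_Y^2\big)$. -/

import Mathlib

noncomputable section

namespace DampedWave

variable {H Y : Type*} [NormedAddCommGroup H] [InnerProductSpace ℂ H]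
  [NormedAddCommGroup Y] [InnerProductSpace ℂ Y]

/-! ### Unbounded operators on a Hilbert space -/

/-- The unbounded operator `z • id - T`, with the same domain as `T`. -/
def resolventOp {E : Type*} [AddCommGroup E] [Module ℂ E] (T : E →ₗ.[ℂ] E) (z : ℂ) :
    E →ₗ.[ℂ] E :=
  (z • (LinearMap.id : E →ₗ[ℂ] E)) +ᵥ (-T)

/-- `R` is the (everywhere defined, bounded) inverse of the unbounded operator `T`:
`R` maps into the domain of `T`, `T R = id` and `R T = id` on the domain of `T`. -/
def IsBoundedInverse {E : Type*} [NormedAddCommGroup E] [NormedSpace ℂ E]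
    (T : E →ₗ.[ℂ] E) (R : E →L[ℂ] E) : Prop :=
  (∀ y : E, ∃ h : R y ∈ T.domain, T ⟨R y, h⟩ = y) ∧ ∀ x : T.domain, R (T x) = x

/-- `T` has a bounded inverse, and the operator norm of this inverse is at most `M`. -/
def InverseNormLE {E : Type*} [NormedAddCommGroup E] [NormedSpace ℂ E]
    (T : E →ₗ.[ℂ] E) (M : ℝ) : Prop :=
  ∃ R : E →L[ℂ] E, IsBoundedInverse T R ∧ ‖R‖ ≤ M

/-- For some `z`, the resolvent of `T` at `z` exists and is a compact operator. -/
def HasCompactResolvent (T : H →ₗ.[ℂ] H) : Prop :=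
  ∃ (z : ℂ) (R : H →L[ℂ] H), IsBoundedInverse (resolventOp T z) R ∧ IsCompactOperator R

/-- `T` is nonnegative: `Re (T u, u) ≥ 0` for all `u` in the domain. -/
def IsNonneg (T : H →ₗ.[ℂ] H) : Prop :=
  ∀ u : T.domain, 0 ≤ (inner ℂ (T u) (u : H)).re

/-- `S` is a nonnegative self-adjoint operator with `S ∘ S = A`, as unbounded operators
(equality of domains included). -/
def IsSqrt [CompleteSpace H] (S A : H →ₗ.[ℂ] H) : Prop :=
  IsSelfAdjoint S ∧ IsNonneg S ∧
    ∀ x z : H, (x, z) ∈ A.graph ↔ ∃ y : H, (x, y) ∈ S.graph ∧ (y, z) ∈ S.graph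

open scoped Classical in
/-- The square root `A^{1/2}`: the unique nonnegative self-adjoint operator whose square is `A`.
It exists for every nonnegative self-adjoint `A`. -/
def sqrtOp [CompleteSpace H] (A : H →ₗ.[ℂ] H) : H →ₗ.[ℂ] H :=
  if h : ∃ S, IsSqrt S A then h.choose else ⊥

/-! ### The energy space -/

/-- The domain of an unbounded operator `S`, to be equipped with the graph norm
`‖u‖² + ‖S u‖²`. -/
def GraphDomain (S : H →ₗ.[ℂ] H) : Type _ := S.domain

namespace GraphDomain

variable (S : H →ₗ.[ℂ] H)

instance : AddCommGroup (GraphDomain S) := inferInstanceAs (AddCommGroup S.domain)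

instance : Module ℂ (GraphDomain S) := inferInstanceAs (Module ℂ S.domain)

/-- The identification of `GraphDomain S` with the subspace `S.domain` of `H`. -/
def toDomain : GraphDomain S ≃ₗ[ℂ] S.domain := LinearEquiv.refl ℂ S.domain

/-- The graph inner product `(u, v) + (S u, S v)`. -/
abbrev core : InnerProductSpace.Core ℂ (GraphDomain S) where
  inner u v := inner ℂ (toDomain S u : H) (toDomain S v : H) +
    inner ℂ (S (toDomain S u)) (S (toDomain S v))
  conj_inner_symm u v := by
    simp only [map_add, inner_conj_symm]
  re_inner_nonneg u := by
    rw [map_add]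
    exact add_nonneg inner_self_nonneg inner_self_nonneg
  add_left u v w := by
    simp only [map_add, Submodule.coe_add, LinearPMap.map_add, inner_add_left]
    ring
  smul_left u v r := by
    simp only [map_smul, Submodule.coe_smul, LinearPMap.map_smul, inner_smul_left]
    ring
  definite u hu := by
    have h := congrArg RCLike.re hu
    rw [map_add, map_zero] at h
    have h1 : 0 ≤ RCLike.re (inner ℂ (toDomain S u : H) (toDomain S u : H)) := inner_self_nonneg
    have h2 : 0 ≤ RCLike.re (inner ℂ (S (toDomain S u)) (S (toDomain S u))) := inner_self_nonneg
    have h3 : (toDomain S u : H) = 0 := re_inner_self_nonpos.mp (by linarith)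
    exact (toDomain S).injective (by rw [map_zero]; exact Subtype.ext h3)

instance : NormedAddCommGroup (GraphDomain S) := (core S).toNormedAddCommGroup

instance : InnerProductSpace ℂ (GraphDomain S) := InnerProductSpace.ofCore (core S).toCore

end GraphDomain

variable [CompleteSpace H] [CompleteSpace Y]

/-- The Hilbert space `D(A^{1/2}) × H` with the norm
`‖(u₀, u₁)‖² = ‖u₀‖² + ‖A^{1/2} u₀‖² + ‖u₁‖²`; here `‖u₀‖² + ‖A^{1/2} u₀‖²` is
`‖(A + id)^{1/2} u₀‖²`. -/
abbrev EnergySpace (A : H →ₗ.[ℂ] H) : Type _ := WithLp 2 (GraphDomain (sqrtOp A) × H)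

/-- The position component `u₀`, as an element of the domain of `A^{1/2}`. -/
def position (A : H →ₗ.[ℂ] H) : EnergySpace A →ₗ[ℂ] (sqrtOp A).domain :=
  (GraphDomain.toDomain (sqrtOp A)).toLinearMap ∘ₗ LinearMap.fst ℂ _ _ ∘ₗ
    (WithLp.linearEquiv 2 ℂ (GraphDomain (sqrtOp A) × H)).toLinearMap

/-- The velocity component `u₁`. -/
def velocity (A : H →ₗ.[ℂ] H) : EnergySpace A →ₗ[ℂ] H :=
  LinearMap.snd ℂ _ _ ∘ₗ
    (WithLp.linearEquiv 2 ℂ (GraphDomain (sqrtOp A) × H)).toLinearMap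

/-- The square of the seminorm: `|(u₀, u₁)|² = ‖A^{1/2} u₀‖² + ‖u₁‖²`. -/
def seminormSq (A : H →ₗ.[ℂ] H) (U : EnergySpace A) : ℝ :=
  ‖sqrtOp A (position A U)‖ ^ 2 + ‖velocity A U‖ ^ 2

/-- The energy `E = (‖A^{1/2} u‖² + ‖∂ₜ u‖²) / 2`. -/
def energy (A : H →ₗ.[ℂ] H) (U : EnergySpace A) : ℝ :=
  (1 / 2) * (‖sqrtOp A (position A U)‖ ^ 2 + ‖velocity A U‖ ^ 2)

/-! ### The damped wave operator -/

/-- The domain `D(A) × D(A^{1/2})` of the damped wave operator. -/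
def waveDomain (A : H →ₗ.[ℂ] H) : Submodule ℂ (EnergySpace A) :=
  A.domain.comap ((sqrtOp A).domain.subtype ∘ₗ position A) ⊓
    (sqrtOp A).domain.comap (velocity A)

/-- The damped wave operator `(u₀, u₁) ↦ (u₁, - A u₀ - B B* u₁)` on the energy space, with
domain `D(A) × D(A^{1/2})`. -/
def waveOp (A : H →ₗ.[ℂ] H) (B : Y →L[ℂ] H) : EnergySpace A →ₗ.[ℂ] EnergySpace A where
  domain := waveDomain A
  toFun :=
    { toFun := fun U => WithLp.toLp 2
        ((GraphDomain.toDomain (sqrtOp A)).symm ⟨velocity A U, U.2.2⟩,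
          - A ⟨position A U, U.2.1⟩ - B (B.adjoint (velocity A U)))
      map_add' := by
        intro U V
        have e1 : (⟨velocity A ↑(U + V), (U + V).2.2⟩ : (sqrtOp A).domain) =
            ⟨velocity A U, U.2.2⟩ + ⟨velocity A V, V.2.2⟩ :=
          Subtype.ext (by simp)
        have e2 : (⟨position A ↑(U + V), (U + V).2.1⟩ : A.domain) =
            ⟨position A U, U.2.1⟩ + ⟨position A V, V.2.1⟩ :=
          Subtype.ext (by simp)
        rw [e1, e2, ← WithLp.toLp_add, Prod.mk_add_mk]
        refine congrArg (WithLp.toLp 2) (Prod.ext ?_ ?_)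
        · exact map_add _ _ _
        · simp only [LinearPMap.map_add, Submodule.coe_add, map_add]
          abel
      map_smul' := by
        intro c U
        have e1 : (⟨velocity A ↑(c • U), (c • U).2.2⟩ : (sqrtOp A).domain) =
            c • ⟨velocity A U, U.2.2⟩ :=
          Subtype.ext (by simp)
        have e2 : (⟨position A ↑(c • U), (c • U).2.1⟩ : A.domain) =
            c • ⟨position A U, U.2.1⟩ :=
          Subtype.ext (by simp)
        rw [e1, e2, RingHom.id_apply, ← WithLp.toLp_smul, Prod.smul_mk]
        refine congrArg (WithLp.toLp 2) (Prod.ext ?_ ?_)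
        · exact map_smul _ _ _
        · simp only [LinearPMap.map_smul, Submodule.coe_smul, map_smul, smul_sub, smul_neg] }

/-- The operator `P(z) = A + z² + z B B*` on `H`, with domain `D(A)`. -/
def waveSymbol (A : H →ₗ.[ℂ] H) (B : Y →L[ℂ] H) (z : ℂ) : H →ₗ.[ℂ] H :=
  ((z ^ 2 • ContinuousLinearMap.id ℂ H + z • (B ∘L B.adjoint) : H →L[ℂ] H) : H →ₗ[ℂ] H) +ᵥ A

/-- `U = (u, ∂ₜ u)` is a (strong) solution on `[0, ∞)` of the damped wave equation
`∂ₜ² u + A u + B B* ∂ₜ u = 0`, in first order form `∂ₜ U = 𝒜 U`. -/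
def IsSolution (A : H →ₗ.[ℂ] H) (B : Y →L[ℂ] H) (U : ℝ → EnergySpace A) : Prop :=
  ∀ t : ℝ, 0 ≤ t → ∃ h : U t ∈ (waveOp A B).domain,
    HasDerivWithinAt U (waveOp A B ⟨U t, h⟩) (Set.Ici 0) t

/-- The damped wave equation is stable at rate `f(t)`: for some `C > 0` and all initial data
`U₀ ∈ D(𝒜)`, the solution with `U(0) = U₀` satisfies `E(t)^{1/2} ≤ C f(t) |𝒜 U₀|` for `t > 0`. -/
def IsStableAtRate (A : H →ₗ.[ℂ] H) (B : Y →L[ℂ] H) (f : ℝ → ℝ) : Prop :=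
  ∃ C : ℝ, 0 < C ∧ ∀ (U₀ : (waveOp A B).domain) (U : ℝ → EnergySpace A),
    IsSolution A B U → U 0 = U₀ → ∀ t : ℝ, 0 < t →
      √(energy A (U t)) ≤ C * f t * √(seminormSq A (waveOp A B U₀))

end DampedWave

end

/-! All five assertions are linked through one estimate, `SeminormResolventBound`: for large |s|,
the energy seminorm of U is at most C|s|^(1/α) times that of (is - 𝒜)U. The seminorm is the natural
quantity: 𝒜 is dissipative for it (`re_inner_waveOp`), and it ignores ker A × 0, where 𝒜 vanishes.
It is the norm of Φ U for a bounded map Φ into a Hilbert space (`energyMap`), so the semigroup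
theory is done for an operator G on a Banach space with G dissipative with respect to Φ.

From resolvent bounds to decay (`IsDissipative.exists_decay`): cut an orbit off by t(T - t). Its
Fourier transform solves the resolvent equation with a source carrying T - 2t, so by Plancherel a
uniform resolvent bound for an operator L commuting with G gives decay of L U at rate 1/T. The
growth |s|^(1/α) is made uniform by L = (rR)^N with R = (r - G)⁻¹: this damps frequencies above r,
and 1 - L costs only N/r on the domain of G. Taking r proportional to t^α turns this into a
contraction between times t/2 and t, and iteration gives t^(-α).

From decay to resolvent bounds (`HilleYosida.exists_resolvent_bound`): e^(-ist)U(t) drifts from U(0)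
by at most t|(is - G)U(0)|, while decay makes U(t) small compared with GU(0). At t comparable to
|s|^(1/α) the two combine into the bound. Stability speaks only of given solutions, so orbits must
be produced, by Yosida approximation, for data in D(G³), which suffice by regularization.

Bounded frequencies are handled by compactness (`exists_seminorm_le_of_abs_le`): a failing sequence
would converge to a nonzero stationary wave, excluded since B* vanishes on no eigenvector. The same
hypothesis and the Fredholm alternative make P(is) onto for s ≠ 0 (`surjective_waveSymbol`), so only
lower bounds remain to be compared. Those for P(is) and is - 𝒜 are exchanged by the test vector (u,
isu) in one direction and by duality with P(-is) in the other (`seminorm_le_of_waveSymbol`). The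
observability inequality is equivalent because the imaginary part of (P(is)u, u) is -s‖B*u‖². -/

open MeasureTheory FourierTransform

/-! ### Plancherel's theorem for vector-valued functions. -/

/-- The `L²` Fourier transform of an integrable and square integrable function is given by the
Fourier integral. -/
theorem fourier_toLp_ae_eq {F : Type*} [NormedAddCommGroup F] [InnerProductSpace ℂ F]
    [CompleteSpace F] {f : ℝ → F} (hf : Integrable f) (hf2 : MemLp f 2) :
    (𝓕 (hf2.toLp f) : Lp (α := ℝ) F 2) =ᵐ[volume] 𝓕 f := by
  have hcont : Continuous (𝓕 f) :=
    VectorFourier.fourierIntegral_continuous Real.continuous_fourierChar (by fun_prop) hf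
  -- Both sides are tested against smooth compactly supported functions, which are Schwartz. On the
  -- L² side the transform moves to the test function through tempered distributions, on the other
  -- side by Fubini.
  refine ae_eq_of_integral_contDiff_smul_eq
    ((Lp.memLp (𝓕 (hf2.toLp f))).locallyIntegrable (by norm_num)) hcont.locallyIntegrable ?_
  intro g hg hgc
  have hg' : ContDiff ℝ ((⊤ : ℕ∞) : WithTop ℕ∞) (fun x => (g x : ℂ)) := Complex.ofRealCLM.contDiff.comp hg
  have hgc' : HasCompactSupport (fun x => (g x : ℂ)) := hgc.comp_left (g := fun x : ℝ => (x : ℂ)) (by simp)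
  let φ : SchwartzMap ℝ ℂ := hgc'.toSchwartzMap hg'
  have hφ : ∀ x, φ x = (g x : ℂ) := fun x => rfl
  have h1 := Lp.fourier_toTemperedDistribution_eq (hf2.toLp f)
  have h2 := congrArg (fun T => T φ) h1
  simp only [TemperedDistribution.fourier_apply, Lp.toTemperedDistribution_apply] at h2
  have h3 : ∫ x, g x • (𝓕 (hf2.toLp f) : Lp (α := ℝ) F 2 volume) x
      = ∫ x, φ x • (𝓕 (hf2.toLp f) : Lp (α := ℝ) F 2 volume) x := by
    simp only [hφ, Complex.coe_smul]
  have h4 : ∫ x, g x • 𝓕 f x = ∫ x, φ x • 𝓕 f x := by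
    simp only [hφ, Complex.coe_smul]
  rw [h3, h4, ← h2]
  have h5 : ∫ x, (𝓕 φ : SchwartzMap ℝ ℂ) x • hf2.toLp f x
      = ∫ x, (𝓕 φ : SchwartzMap ℝ ℂ) x • f x := by
    refine integral_congr_ae ?_
    filter_upwards [hf2.coeFn_toLp] with x hx
    rw [hx]
  rw [h5, SchwartzMap.fourier_coe]
  exact VectorFourier.integral_fourierIntegral_smul_eq_flip (L := innerₗ ℝ)
    Real.continuous_fourierChar continuous_inner φ.integrable hf |>.trans (by
      simp [flip_innerₗ]; rfl)

/-- **Plancherel's theorem** for functions that are integrable and square integrable. -/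
theorem lintegral_enorm_fourier_sq {F : Type*} [NormedAddCommGroup F] [InnerProductSpace ℂ F]
    [CompleteSpace F] {f : ℝ → F} (hf : Integrable f) (hf2 : MemLp f 2) :
    ∫⁻ x, ‖𝓕 f x‖ₑ ^ 2 = ∫⁻ x, ‖f x‖ₑ ^ 2 := by
  have key : eLpNorm (𝓕 f) 2 volume = eLpNorm f 2 volume := by
    rw [← eLpNorm_congr_ae (fourier_toLp_ae_eq hf hf2), ← Lp.enorm_def,
      ← eLpNorm_congr_ae hf2.coeFn_toLp, ← Lp.enorm_def, ← ofReal_norm, ← ofReal_norm, Lp.norm_fourier_eq]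
  have h2 : ∀ k : ℝ → F, ∫⁻ x, ‖k x‖ₑ ^ 2 = (eLpNorm k 2 volume) ^ 2 := by
    intro k
    have := eLpNorm_nnreal_pow_eq_lintegral (f := k) (μ := volume) (p := 2) (by norm_num)
    simpa using this.symm
  rw [h2, h2, key]

namespace DampedWave

/-! ### Orbits of an operator that is dissipative for a seminorm. -/

section Abstract

variable {E X : Type*} [NormedAddCommGroup E] [NormedSpace ℂ E]
  [NormedAddCommGroup X] [InnerProductSpace ℂ X]

theorem isBoundedInverse_resolventOp_iff {T : E →ₗ.[ℂ] E} {z : ℂ} {R : E →L[ℂ] E} :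
    IsBoundedInverse (resolventOp T z) R ↔
      (∀ y : E, ∃ h : R y ∈ T.domain, z • R y - T ⟨R y, h⟩ = y) ∧
        ∀ x : T.domain, R (z • (x : E) - T x) = x := by
  simp only [sub_eq_add_neg]
  exact Iff.rfl

/-- `U` is a strong solution of `U' = G U` on `[0, ∞)`. -/
def IsOrbit (G : E →ₗ.[ℂ] E) (U : ℝ → E) : Prop :=
  ∀ t : ℝ, 0 ≤ t → ∃ h : U t ∈ G.domain, HasDerivWithinAt U (G ⟨U t, h⟩) (Set.Ici 0) t

/-- `G` is dissipative for the seminorm `‖Φ ·‖`. -/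
def IsDissipative (G : E →ₗ.[ℂ] E) (Φ : E →L[ℂ] X) : Prop :=
  ∀ V : G.domain, (inner ℂ (Φ (G V)) (Φ V)).re ≤ 0

/-- The bounded operator `L` commutes with the unbounded operator `G`. -/
def CommutesWith (L : E →L[ℂ] E) (G : E →ₗ.[ℂ] E) : Prop :=
  ∀ V : G.domain, ∃ h : L V ∈ G.domain, G ⟨L V, h⟩ = L (G V)

variable {G : E →ₗ.[ℂ] E} {Φ : E →L[ℂ] X} {U : ℝ → E}

theorem IsOrbit.continuousOn (hU : IsOrbit G U) : ContinuousOn U (Set.Ici 0) := fun t ht =>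
  (hU t ht).choose_spec.continuousWithinAt

theorem IsOrbit.map {L : E →L[ℂ] E} (hL : CommutesWith L G) (hU : IsOrbit G U) :
    IsOrbit G (fun t => L (U t)) := by
  intro t ht
  obtain ⟨h, hd⟩ := hU t ht
  obtain ⟨h', he⟩ := hL ⟨U t, h⟩
  refine ⟨h', ?_⟩
  rw [he]
  exact (L.restrictScalars ℝ).hasFDerivAt.comp_hasDerivWithinAt t hd

theorem IsOrbit.sub {V : ℝ → E} (hU : IsOrbit G U) (hV : IsOrbit G V) :
    IsOrbit G (fun t => U t - V t) := by
  intro t ht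
  obtain ⟨h, hd⟩ := hU t ht
  obtain ⟨h', hd'⟩ := hV t ht
  refine ⟨G.domain.sub_mem h h', ?_⟩
  have : G ⟨U t - V t, G.domain.sub_mem h h'⟩ = G ⟨U t, h⟩ - G ⟨V t, h'⟩ :=
    G.map_sub ⟨U t, h⟩ ⟨V t, h'⟩
  rw [this]
  exact hd.sub hd'

theorem IsOrbit.smul (c : ℂ) (hU : IsOrbit G U) : IsOrbit G (fun t => c • U t) := by
  intro t ht
  obtain ⟨h, hd⟩ := hU t ht
  refine ⟨G.domain.smul_mem c h, ?_⟩
  have : G ⟨c • U t, G.domain.smul_mem c h⟩ = c • G ⟨U t, h⟩ := G.map_smul c ⟨U t, h⟩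
  rw [this]
  exact hd.const_smul c

theorem IsOrbit.shift {a : ℝ} (ha : 0 ≤ a) (hU : IsOrbit G U) :
    IsOrbit G (fun t => U (t + a)) := by
  intro t ht
  obtain ⟨h, hd⟩ := hU (t + a) (by positivity)
  refine ⟨h, ?_⟩
  have h1 : HasDerivWithinAt (fun t : ℝ => t + a) 1 (Set.Ici 0) t :=
    (hasDerivWithinAt_id t _).add_const a
  have := hd.scomp t h1 (fun x hx => by simp only [Set.mem_Ici] at *; linarith)
  simpa [Function.comp_def] using this

/-- The seminorm of a solution is nonincreasing. -/
theorem IsOrbit.antitoneOn (hD : IsDissipative G Φ) (hU : IsOrbit G U) :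
    AntitoneOn (fun t => ‖Φ (U t)‖) (Set.Ici 0) := by
  have hder : ∀ t, 0 ≤ t → ∃ d ≤ 0,
      HasDerivWithinAt (fun t => ‖Φ (U t)‖ ^ 2) d (Set.Ici 0) t := by
    intro t ht
    obtain ⟨h, hd⟩ := hU t ht
    have h1 : HasDerivWithinAt (fun t => Φ (U t)) (Φ (G ⟨U t, h⟩)) (Set.Ici 0) t :=
      (Φ.restrictScalars ℝ).hasFDerivAt.comp_hasDerivWithinAt t hd
    have h2 := Complex.reCLM.hasFDerivAt.comp_hasDerivWithinAt t (h1.inner ℂ h1)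
    refine ⟨_, ?_, (h2.congr (fun x _ => ?_) ?_)⟩
    · have h3 := hD ⟨U t, h⟩
      have h4 : (inner ℂ (Φ (U t)) (Φ (G ⟨U t, h⟩))).re
          = (inner ℂ (Φ (G ⟨U t, h⟩)) (Φ (U t))).re :=
        inner_re_symm (𝕜 := ℂ) _ _
      simp only [Complex.reCLM_apply, Complex.add_re]
      simp only at h3
      linarith
    · exact (inner_self_eq_norm_sq (𝕜 := ℂ) (Φ (U x))).symm
    · exact (inner_self_eq_norm_sq (𝕜 := ℂ) (Φ (U t))).symm
  have hanti : AntitoneOn (fun t => ‖Φ (U t)‖ ^ 2) (Set.Ici 0) := by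
    choose! d hd0 hd using hder
    refine antitoneOn_of_hasDerivWithinAt_nonpos (f' := d) (convex_Ici 0)
      (fun t ht => (hd t ht).continuousWithinAt) ?_ ?_
    · intro t ht
      exact (hd t (interior_subset ht)).mono interior_subset
    · intro t ht
      exact hd0 t (interior_subset ht)
  intro a ha b hb hab
  exact (sq_le_sq₀ (norm_nonneg _) (norm_nonneg _)).mp (hanti ha hb hab)

/-- Take the real part of the inner product of Φ((r - G)V) with ΦV: dissipativity lets the G term be
dropped, and Cauchy–Schwarz finishes. It plays the role of the Hille–Yosida bound, but in the
seminorm only. -/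
theorem IsDissipative.mul_norm_le (hD : IsDissipative G Φ) {r : ℝ} (V : G.domain) :
    r * ‖Φ V‖ ≤ ‖Φ ((r : ℂ) • (V : E) - G V)‖ := by
  rcases eq_or_ne (‖Φ V‖) 0 with h0 | h0
  · rw [h0, mul_zero]; exact norm_nonneg _
  have hpos : 0 < ‖Φ V‖ := lt_of_le_of_ne (norm_nonneg _) (Ne.symm h0)
  have h1 : (inner ℂ (Φ ((r : ℂ) • (V : E) - G V)) (Φ V)).re
      = r * ‖Φ V‖ ^ 2 - (inner ℂ (Φ (G V)) (Φ V)).re := by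
    rw [map_sub, map_smul, inner_sub_left, inner_smul_left, Complex.sub_re,
      inner_self_eq_norm_sq_to_K]
    simp [← Complex.ofReal_pow]
  have h2 := hD V
  have h3 : (inner ℂ (Φ ((r : ℂ) • (V : E) - G V)) (Φ V)).re
      ≤ ‖Φ ((r : ℂ) • (V : E) - G V)‖ * ‖Φ V‖ := re_inner_le_norm (𝕜 := ℂ) _ _
  have h4 : (r * ‖Φ V‖) * ‖Φ V‖ ≤ ‖Φ ((r : ℂ) • (V : E) - G V)‖ * ‖Φ V‖ := by
    nlinarith
  exact le_of_mul_le_mul_right h4 hpos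

/-- Both GR and RG equal zR - 1 on the domain of G. -/
theorem commutesWith_of_isBoundedInverse {z : ℂ} {R : E →L[ℂ] E}
    (hR : IsBoundedInverse (resolventOp G z) R) : CommutesWith R G := by
  rw [isBoundedInverse_resolventOp_iff] at hR
  intro V
  obtain ⟨h, he⟩ := hR.1 V
  refine ⟨h, ?_⟩
  have h1 := hR.2 V
  rw [map_sub, map_smul] at h1
  have h2 : G ⟨R V, h⟩ + V = z • R V := (sub_eq_iff_eq_add'.mp he).symm
  rw [sub_eq_iff_eq_add.mp h1, add_comm (V : E)] at h2
  exact add_right_cancel h2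

theorem CommutesWith.smul {L : E →L[ℂ] E} (hL : CommutesWith L G) (c : ℂ) :
    CommutesWith (c • L) G := by
  intro V
  obtain ⟨h, he⟩ := hL V
  exact ⟨G.domain.smul_mem c h, (G.map_smul c ⟨L V, h⟩).trans (by rw [he]; rfl)⟩

theorem CommutesWith.pow {L : E →L[ℂ] E} (hL : CommutesWith L G) (n : ℕ) :
    CommutesWith (L ^ n) G := by
  induction n with
  | zero => exact fun V => ⟨V.2, rfl⟩
  | succ n ih =>
    intro V
    obtain ⟨h, he⟩ := ih V
    obtain ⟨h', he'⟩ := hL ⟨_, h⟩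
    rw [pow_succ']
    exact ⟨h', he'.trans (by rw [he]; rfl)⟩

theorem IsBoundedInverse.norm_seminorm_le (hD : IsDissipative G Φ) {r : ℝ} (hr : 0 < r)
    {R : E →L[ℂ] E} (hR : IsBoundedInverse (resolventOp G r) R) (F : E) :
    ‖Φ (R F)‖ ≤ ‖Φ F‖ / r := by
  rw [isBoundedInverse_resolventOp_iff] at hR
  obtain ⟨h, he⟩ := hR.1 F
  have := hD.mul_norm_le (r := r) ⟨R F, h⟩
  rw [he] at this
  rw [le_div_iff₀ hr]; linarith

theorem CommutesWith.commute {L R : E →L[ℂ] E} {z : ℂ} (hL : CommutesWith L G)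
    (hR : IsBoundedInverse (resolventOp G z) R) : Commute L R := by
  rw [isBoundedInverse_resolventOp_iff] at hR
  ext y
  obtain ⟨h, he⟩ := hR.1 y
  obtain ⟨h', he'⟩ := hL ⟨_, h⟩
  have h1 := hR.2 ⟨_, h'⟩
  rw [he'] at h1
  have h2 : z • L (R y) - L (G ⟨R y, h⟩) = L y := by rw [← map_smul, ← map_sub, he]
  exact (h1.symm.trans (congrArg R h2))

end Abstract

/-! ### The resolvent equation for a cut-off orbit. -/

section Abstract

variable {E X : Type*} [NormedAddCommGroup E] [NormedSpace ℂ E]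
  [NormedAddCommGroup X] [InnerProductSpace ℂ X]
  {G : E →ₗ.[ℂ] E} {Φ : E →L[ℂ] X} {U : ℝ → E}

/-- The Fourier transform of a solution cut off by `t (T - t)` on `[0, T]` solves the resolvent
equation, whose right-hand side comes from the derivative `T - 2 t` of the cutoff. -/
theorem IsOrbit.resolvent_integral [CompleteSpace E] {R : E →L[ℂ] E}
    (hR : IsBoundedInverse (resolventOp G 1) R) (hU : IsOrbit G U) {T : ℝ} (hT : 0 < T) (s : ℝ) :
    ∃ h : (∫ t in 0..T, Complex.exp (-(Complex.I * s * t)) • ((t * (T - t) : ℝ) : ℂ) • U t)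
        ∈ G.domain,
      (Complex.I * s) •
        (∫ t in 0..T, Complex.exp (-(Complex.I * s * t)) • ((t * (T - t) : ℝ) : ℂ) • U t)
        - G ⟨_, h⟩
      = ∫ t in 0..T, Complex.exp (-(Complex.I * s * t)) • ((T - 2 * t : ℝ) : ℂ) • U t := by
  rw [isBoundedInverse_resolventOp_iff] at hR
  set e : ℝ → ℂ := fun t => Complex.exp (-(Complex.I * s * t)) with he
  set a := ∫ t in 0..T, e t • ((t * (T - t) : ℝ) : ℂ) • U t with ha
  set b := ∫ t in 0..T, e t • ((T - 2 * t : ℝ) : ℂ) • U t with hb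
  have hUc : ContinuousOn U (Set.uIcc 0 T) := hU.continuousOn.mono (by
    rw [Set.uIcc_of_le hT.le]; exact Set.Icc_subset_Ici_self)
  have hec : Continuous e := by fun_prop
  have hia : IntervalIntegrable (fun t => e t • ((t * (T - t) : ℝ) : ℂ) • U t) volume 0 T := by
    apply ContinuousOn.intervalIntegrable
    exact hec.continuousOn.smul (ContinuousOn.smul (by fun_prop) hUc)
  have hib : IntervalIntegrable (fun t => e t • ((T - 2 * t : ℝ) : ℂ) • U t) volume 0 T := by
    apply ContinuousOn.intervalIntegrable
    exact hec.continuousOn.smul (ContinuousOn.smul (by fun_prop) hUc)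
  have hRG : ∀ x : G.domain, R (G x) = R x - x := fun x => by
    have := hR.2 x
    rw [one_smul, map_sub] at this
    rw [sub_eq_iff_eq_add.mp this]; abel
  -- Applying R before differentiating keeps G out of the integral: RG = R - 1 is bounded, so
  -- continuity of U is all that integrability needs.
  have hder : ∀ t ∈ Set.Ioo 0 T, HasDerivWithinAt
      (fun t => e t • ((t * (T - t) : ℝ) : ℂ) • R (U t))
      (R (e t • ((T - 2 * t : ℝ) : ℂ) • U t)
        + (1 - Complex.I * s) • R (e t • ((t * (T - t) : ℝ) : ℂ) • U t)
        - e t • ((t * (T - t) : ℝ) : ℂ) • U t) (Set.Ioi t) t := by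
    intro t ht
    obtain ⟨h, hd⟩ := hU t ht.1.le
    have h1 : HasDerivWithinAt (fun t => R (U t)) (R (U t) - U t) (Set.Ioi t) t := by
      have := (R.restrictScalars ℝ).hasFDerivAt.comp_hasDerivWithinAt t hd
      have h2 : R (G ⟨U t, h⟩) = R (U t) - U t := hRG ⟨U t, h⟩
      simp only [ContinuousLinearMap.coe_restrictScalars', h2] at this
      exact this.mono (fun x hx => (ht.1.trans hx).le)
    have h2 : HasDerivAt e (-(Complex.I * s) * e t) t := by
      have h3 : HasDerivAt (fun t : ℝ => -(Complex.I * s * t)) (-(Complex.I * s)) t := by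
        convert! ((hasDerivAt_id t).ofReal_comp.const_mul (Complex.I * s)).neg using 1
        simp
      rw [mul_comm]
      exact h3.cexp
    have h4 : HasDerivAt (fun t : ℝ => ((t * (T - t) : ℝ) : ℂ)) ((T - 2 * t : ℝ) : ℂ) t := by
      have h5 : HasDerivAt (fun t : ℝ => t * (T - t)) (T - 2 * t) t := by
        have := (hasDerivAt_id t).mul ((hasDerivAt_id t).const_sub T)
        convert! this using 1
        simp; ring
      exact h5.ofReal_comp
    have h6 := h2.hasDerivWithinAt (s := Set.Ioi t) |>.smul (h4.hasDerivWithinAt.smul h1)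
    convert! h6 using 1
    simp only [map_smul, Pi.smul_apply']
    module
  have hRia : IntervalIntegrable (fun t => R (e t • ((t * (T - t) : ℝ) : ℂ) • U t)) volume 0 T := by
    apply ContinuousOn.intervalIntegrable
    exact R.continuous.comp_continuousOn
      (hec.continuousOn.smul (ContinuousOn.smul (by fun_prop) hUc))
  have hRib : IntervalIntegrable (fun t => R (e t • ((T - 2 * t : ℝ) : ℂ) • U t)) volume 0 T := by
    apply ContinuousOn.intervalIntegrable
    exact R.continuous.comp_continuousOn
      (hec.continuousOn.smul (ContinuousOn.smul (by fun_prop) hUc))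
  have hRia' : IntervalIntegrable
      (fun t => (1 - Complex.I * s) • R (e t • ((t * (T - t) : ℝ) : ℂ) • U t)) volume 0 T :=
    hRia.smul _
  have hF := intervalIntegral.integral_eq_sub_of_hasDeriv_right
    (f := fun t => e t • ((t * (T - t) : ℝ) : ℂ) • R (U t)) (a := 0) (b := T)
    (f' := fun t => R (e t • ((T - 2 * t : ℝ) : ℂ) • U t)
        + (1 - Complex.I * s) • R (e t • ((t * (T - t) : ℝ) : ℂ) • U t)
        - e t • ((t * (T - t) : ℝ) : ℂ) • U t)
    (hec.continuousOn.smul (ContinuousOn.smul (by fun_prop)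
      (R.continuous.comp_continuousOn hUc)))
    (by rw [min_eq_left hT.le, max_eq_right hT.le]; exact hder)
    ((hRib.add hRia').sub hia)
  rw [intervalIntegral.integral_sub (hRib.add hRia') hia,
    intervalIntegral.integral_add hRib hRia'] at hF
  rw [intervalIntegral.integral_smul, R.intervalIntegral_comp_comm hib,
    R.intervalIntegral_comp_comm hia, ← ha, ← hb] at hF
  simp only [sub_self, mul_zero, zero_mul, Complex.ofReal_zero, zero_smul, smul_zero] at hF
  -- The boundary terms vanish with t(T - t). The identity exhibits a in the range of R, hence in
  -- the domain of G, and inverting R gives (is - G)a = b.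
  have hRa : R (b + (1 - Complex.I * s) • a) = a := by
    rw [map_add, map_smul]; exact sub_eq_zero.mp hF
  have hh := hR.1 (b + (1 - Complex.I * s) • a)
  rw [hRa] at hh
  obtain ⟨h, hh⟩ := hh
  refine ⟨h, ?_⟩
  rw [← sub_eq_zero] at hh ⊢
  rw [← hh]
  module

end Abstract

/-! ### From a uniform resolvent bound to decay, by Plancherel. -/

section Abstract

variable {E X : Type*} [NormedAddCommGroup E] [NormedSpace ℂ E]
  [NormedAddCommGroup X] [InnerProductSpace ℂ X]
  {G : E →ₗ.[ℂ] E} {Φ : E →L[ℂ] X} {U : ℝ → E}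

/-- A continuous function on `[0, T]`, extended by zero, is integrable and square integrable. -/
theorem integrable_memLp_indicator_Ioc {F : Type*} [NormedAddCommGroup F] {T : ℝ}
    {f : ℝ → F} (hf : ContinuousOn f (Set.Icc 0 T)) :
    Integrable ((Set.Ioc 0 T).indicator f) ∧ MemLp ((Set.Ioc 0 T).indicator f) 2 := by
  obtain ⟨C, hC⟩ := isCompact_Icc.exists_bound_of_continuousOn hf
  have hm : AEStronglyMeasurable f (volume.restrict (Set.Ioc 0 T)) :=
    (hf.mono Set.Ioc_subset_Icc_self).aestronglyMeasurable measurableSet_Ioc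
  have hb : ∀ᵐ x ∂(volume.restrict (Set.Ioc 0 T)), ‖f x‖ ≤ C :=
    (ae_restrict_iff' measurableSet_Ioc).mpr
      (Filter.Eventually.of_forall fun x hx => hC x (Set.Ioc_subset_Icc_self hx))
  exact ⟨(integrable_indicator_iff measurableSet_Ioc).mpr (Integrable.of_bound hm C hb),
    (memLp_indicator_iff_restrict measurableSet_Ioc).mpr (MemLp.of_bound hm C hb)⟩

theorem fourier_indicator_Ioc {F : Type*} [NormedAddCommGroup F] [NormedSpace ℂ F] {T : ℝ}
    (hT : 0 < T) (f : ℝ → F) (w : ℝ) :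
    𝓕 ((Set.Ioc 0 T).indicator f) w
      = ∫ t in 0..T, Complex.exp (-(Complex.I * ((2 * Real.pi * w : ℝ) : ℂ) * t)) • f t := by
  rw [Real.fourier_real_eq_integral_exp_smul, intervalIntegral.integral_of_le hT.le,
    ← integral_indicator measurableSet_Ioc]
  congr 1
  ext t
  by_cases h : t ∈ Set.Ioc 0 T
  · simp only [Set.indicator_of_mem h]
    congr 2
    push_cast; ring
  · simp only [Set.indicator_of_notMem h, smul_zero]

/-- A resolvent bound on the imaginary axis for `L`, which commutes with the dissipative operator
`G`, yields a rate of decay for `L` along solutions. -/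
theorem IsOrbit.norm_le_of_resolvent_bound [CompleteSpace E] [CompleteSpace X]
    (hD : IsDissipative G Φ) {R : E →L[ℂ] E} (hR : IsBoundedInverse (resolventOp G 1) R)
    (hU : IsOrbit G U) {L : E →L[ℂ] E} (hL : CommutesWith L G) {K : ℝ} (hK0 : 0 ≤ K)
    (hK : ∀ (s : ℝ) (V : G.domain), ‖Φ (L V)‖ ≤ K * ‖Φ ((Complex.I * s) • (V : E) - G V)‖)
    {T : ℝ} (hT : 0 < T) :
    ‖Φ (L (U (T / 2)))‖ ≤ 16 * K / T * ‖Φ (U 0)‖ := by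
  have hUc : ContinuousOn U (Set.Icc 0 T) := hU.continuousOn.mono Set.Icc_subset_Ici_self
  set f : ℝ → E := fun t => ((t * (T - t) : ℝ) : ℂ) • U t with hf
  set g : ℝ → E := fun t => ((T - 2 * t : ℝ) : ℂ) • U t with hg
  have hfc : ContinuousOn f (Set.Icc 0 T) := ContinuousOn.smul (by fun_prop) hUc
  have hgc : ContinuousOn g (Set.Icc 0 T) := ContinuousOn.smul (by fun_prop) hUc
  have hexp : ∀ w : ℝ, Continuous
      fun t : ℝ => Complex.exp (-(Complex.I * ((2 * Real.pi * w : ℝ) : ℂ) * t)) := fun w => by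
    fun_prop
  obtain ⟨hf1, hf2⟩ := integrable_memLp_indicator_Ioc (T := T) (f := fun t => Φ (L (f t)))
    ((Φ ∘L L).continuous.comp_continuousOn hfc)
  obtain ⟨hg1, hg2⟩ := integrable_memLp_indicator_Ioc (T := T) (f := fun t => Φ (g t))
    (Φ.continuous.comp_continuousOn hgc)
  -- The hypothesis on L is applied at frequency s = 2πw to the transform of the cut-off orbit, the
  -- source being the transform of (T - 2t)U.
  have hpt : ∀ w : ℝ, ‖𝓕 ((Set.Ioc 0 T).indicator fun t => Φ (L (f t))) w‖
      ≤ K * ‖𝓕 ((Set.Ioc 0 T).indicator fun t => Φ (g t)) w‖ := by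
    intro w
    rw [fourier_indicator_Ioc hT, fourier_indicator_Ioc hT]
    have hif : IntervalIntegrable (fun t : ℝ => Complex.exp
        (-(Complex.I * ((2 * Real.pi * w : ℝ) : ℂ) * t)) • f t) volume 0 T := by
      apply ContinuousOn.intervalIntegrable
      rw [Set.uIcc_of_le hT.le]
      exact (hexp w).continuousOn.smul hfc
    have hig : IntervalIntegrable (fun t : ℝ => Complex.exp
        (-(Complex.I * ((2 * Real.pi * w : ℝ) : ℂ) * t)) • g t) volume 0 T := by
      apply ContinuousOn.intervalIntegrable
      rw [Set.uIcc_of_le hT.le]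
      exact (hexp w).continuousOn.smul hgc
    have h1 := (Φ ∘L L).intervalIntegral_comp_comm hif
    have h2 := Φ.intervalIntegral_comp_comm hig
    simp only [map_smul, ContinuousLinearMap.comp_apply] at h1 h2
    rw [h1, h2]
    obtain ⟨h, he⟩ := hU.resolvent_integral hR hT (2 * Real.pi * w)
    have := hK (2 * Real.pi * w) ⟨_, h⟩
    rw [he] at this
    exact this
  have hpl : ∫⁻ t, ‖(Set.Ioc 0 T).indicator (fun t => Φ (L (f t))) t‖ₑ ^ 2
      ≤ ENNReal.ofReal (K ^ 2) *
        ∫⁻ t, ‖(Set.Ioc 0 T).indicator (fun t => Φ (g t)) t‖ₑ ^ 2 := by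
    rw [← lintegral_enorm_fourier_sq hf1 hf2, ← lintegral_enorm_fourier_sq hg1 hg2,
      ← lintegral_const_mul' _ _ ENNReal.ofReal_ne_top]
    refine lintegral_mono fun w => ?_
    rw [ENNReal.ofReal_pow hK0, ← mul_pow]
    gcongr
    rw [← ofReal_norm, ← ofReal_norm, ← ENNReal.ofReal_mul hK0]
    exact ENNReal.ofReal_le_ofReal (hpt w)
  have hup : ∫⁻ t, ‖(Set.Ioc 0 T).indicator (fun t => Φ (g t)) t‖ₑ ^ 2
      ≤ ENNReal.ofReal (T ^ 3 * ‖Φ (U 0)‖ ^ 2) := by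
    have h1 : ∀ t, ‖(Set.Ioc 0 T).indicator (fun t => Φ (g t)) t‖ₑ ^ 2
        ≤ (Set.Ioc 0 T).indicator (fun _ => ENNReal.ofReal ((T * ‖Φ (U 0)‖) ^ 2)) t := by
      intro t
      by_cases ht : t ∈ Set.Ioc 0 T
      · rw [Set.indicator_of_mem ht, Set.indicator_of_mem ht, ← ofReal_norm,
          ← ENNReal.ofReal_pow (norm_nonneg _)]
        refine ENNReal.ofReal_le_ofReal (pow_le_pow_left₀ (norm_nonneg _) ?_ 2)
        rw [hg, map_smul, norm_smul, Complex.norm_real]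
        have h2 : ‖T - 2 * t‖ ≤ T := by
          rw [Real.norm_eq_abs, abs_le]; constructor <;> linarith [ht.1, ht.2]
        have h3 : ‖Φ (U t)‖ ≤ ‖Φ (U 0)‖ :=
          hU.antitoneOn hD (Set.mem_Ici.mpr le_rfl) (Set.mem_Ici.mpr ht.1.le) ht.1.le
        gcongr
      · simp [Set.indicator_of_notMem ht]
    refine (lintegral_mono h1).trans ?_
    rw [lintegral_indicator measurableSet_Ioc, setLIntegral_const, Real.volume_Ioc, sub_zero,
      ← ENNReal.ofReal_mul (by positivity)]
    exact ENNReal.ofReal_le_ofReal (by ring_nf; rfl)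
  -- Only (T/4, T/2] is kept. There t(T - t) ≥ T²/8, and Φ(L U(t)) is at least as large as at T/2
  -- because L U is again an orbit; the interval has length T/4, whence T/4 · (T²/8)² = T⁵/256.
  -- Against the upper bound K²T³ this yields the constant 16 = √256.
  have hlow : ENNReal.ofReal (T ^ 5 / 256 * ‖Φ (L (U (T / 2)))‖ ^ 2)
      ≤ ∫⁻ t, ‖(Set.Ioc 0 T).indicator (fun t => Φ (L (f t))) t‖ₑ ^ 2 := by
    have h1 : ∀ t, (Set.Ioc (T / 4) (T / 2)).indicator
        (fun _ => ENNReal.ofReal ((T ^ 2 / 8 * ‖Φ (L (U (T / 2)))‖) ^ 2)) t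
        ≤ ‖(Set.Ioc 0 T).indicator (fun t => Φ (L (f t))) t‖ₑ ^ 2 := by
      intro t
      by_cases ht : t ∈ Set.Ioc (T / 4) (T / 2)
      · have ht' : t ∈ Set.Ioc 0 T := ⟨by linarith [ht.1], by linarith [ht.2]⟩
        rw [Set.indicator_of_mem ht, Set.indicator_of_mem ht', ← ofReal_norm,
          ← ENNReal.ofReal_pow (norm_nonneg _)]
        refine ENNReal.ofReal_le_ofReal (pow_le_pow_left₀ (by positivity) ?_ 2)
        rw [hf, map_smul, map_smul, norm_smul, Complex.norm_real]
        have h2 : T ^ 2 / 8 ≤ ‖t * (T - t)‖ := by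
          refine le_trans ?_ (Real.le_norm_self _)
          nlinarith [ht.1, ht.2]
        have h3 : ‖Φ (L (U (T / 2)))‖ ≤ ‖Φ (L (U t))‖ :=
          (hU.map hL).antitoneOn hD (Set.mem_Ici.mpr ht'.1.le)
            (Set.mem_Ici.mpr (by positivity)) ht.2
        gcongr
      · simp [Set.indicator_of_notMem ht]
    refine le_trans ?_ (lintegral_mono h1)
    rw [lintegral_indicator measurableSet_Ioc, setLIntegral_const, Real.volume_Ioc,
      ← ENNReal.ofReal_mul (by positivity)]
    exact ENNReal.ofReal_le_ofReal (by ring_nf; rfl)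
  have hfin := hlow.trans (hpl.trans (mul_le_mul_right hup _))
  rw [← ENNReal.ofReal_mul (by positivity), ENNReal.ofReal_le_ofReal_iff (by positivity)] at hfin
  have h5 : ‖Φ (L (U (T / 2)))‖ ^ 2 ≤ (16 * K / T * ‖Φ (U 0)‖) ^ 2 := by
    have h6 : (16 * K / T * ‖Φ (U 0)‖) ^ 2 = 256 / T ^ 5 * (K ^ 2 * (T ^ 3 * ‖Φ (U 0)‖ ^ 2)) := by
      field_simp; ring
    have h7 : ‖Φ (L (U (T / 2)))‖ ^ 2
        = 256 / T ^ 5 * (T ^ 5 / 256 * ‖Φ (L (U (T / 2)))‖ ^ 2) := by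
      field_simp
    rw [h6, h7]
    gcongr
  exact (sq_le_sq₀ (norm_nonneg _) (by positivity)).mp h5

end Abstract

/-! ### The Borichev–Tomilov theorem. -/

section Abstract

variable {E X : Type*} [NormedAddCommGroup E] [NormedSpace ℂ E]
  [NormedAddCommGroup X] [InnerProductSpace ℂ X]
  {G : E →ₗ.[ℂ] E} {Φ : E →L[ℂ] X} {U : ℝ → E}

/-- The operator rR is a contraction for the seminorm, by dissipativity. -/
theorem seminorm_smul_pow_le (hD : IsDissipative G Φ) {r : ℝ} (hr : 0 < r) {R : E →L[ℂ] E}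
    (hR : IsBoundedInverse (resolventOp G r) R) (n : ℕ) (F : E) :
    ‖Φ ((((r : ℂ) • R) ^ n) F)‖ ≤ ‖Φ F‖ := by
  induction n with
  | zero => simp
  | succ n ih =>
    refine le_trans ?_ ih
    rw [pow_succ', mul_apply_eq_comp, smul_apply, map_smul,
      norm_smul, Complex.norm_real, Real.norm_of_nonneg hr.le]
    have := hR.norm_seminorm_le hD hr ((((r : ℂ) • R) ^ n) F)
    rwa [le_div_iff₀ hr, mul_comm] at this

/-- With J = rR one has (r - is)JW = rW - J(is - G)W on the domain of G. Thus each factor of J gains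
r/|r - is| at frequency s, up to an error of at most 1/r times the source. Large powers therefore
suppress frequencies beyond r. -/
theorem seminorm_smul_pow_resolvent_le (hD : IsDissipative G Φ) {r : ℝ} (hr : 0 < r)
    {R : E →L[ℂ] E} (hR : IsBoundedInverse (resolventOp G r) R) (s : ℝ) (V : G.domain) (n : ℕ) :
    ‖Φ ((((r : ℂ) • R) ^ n) V)‖ ≤ (r / ‖(r : ℂ) - Complex.I * s‖) ^ n * ‖Φ V‖
      + n / r * ‖Φ ((Complex.I * s) • (V : E) - G V)‖ := by
  set J : E →L[ℂ] E := (r : ℂ) • R with hJ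
  set m := ‖(r : ℂ) - Complex.I * s‖ with hm
  have hmr : r ≤ m := by
    have := Complex.re_le_norm ((r : ℂ) - Complex.I * s)
    simpa using this
  have hm0 : 0 < m := hr.trans_le hmr
  have hJc : CommutesWith J G := (commutesWith_of_isBoundedInverse hR).smul _
  rw [isBoundedInverse_resolventOp_iff] at hR
  induction n with
  | zero => simp
  | succ n ih =>
    obtain ⟨h, he⟩ := hJc.pow n V
    have h1 := hR.2 ⟨_, h⟩
    rw [he] at h1
    have h2 : ((r : ℂ) - Complex.I * s) • J ((J ^ n) V)
        = (r : ℂ) • (J ^ n) V - J ((J ^ n) ((Complex.I * s) • (V : E) - G V)) := by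
      simp only [hJ, smul_apply, map_sub, map_smul] at h1 ⊢
      nth_rw 2 [← h1]
      module
    have h3 : m * ‖Φ (J ((J ^ n) V))‖
        ≤ r * ‖Φ ((J ^ n) V)‖ + ‖Φ ((Complex.I * s) • (V : E) - G V)‖ := by
      have h4 := congrArg (fun x => ‖Φ x‖) h2
      simp only [map_smul, norm_smul, map_sub Φ] at h4
      rw [h4]
      refine (norm_sub_le _ _).trans ?_
      rw [norm_smul, Complex.norm_real, Real.norm_of_nonneg hr.le]
      gcongr
      rw [← mul_apply_eq_comp, ← pow_succ', hJ]
      exact seminorm_smul_pow_le hD hr (isBoundedInverse_resolventOp_iff.mpr hR) _ _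
    have h5 : ‖Φ (J ((J ^ n) V))‖ ≤ r / m * ‖Φ ((J ^ n) V)‖
        + 1 / m * ‖Φ ((Complex.I * s) • (V : E) - G V)‖ := by
      rw [div_mul_eq_mul_div, div_mul_eq_mul_div, ← add_div, le_div_iff₀ hm0]
      linarith
    rw [pow_succ', mul_apply_eq_comp]
    have h6 : r / m ≤ 1 := (div_le_one hm0).mpr hmr
    have h7 : 1 / m ≤ 1 / r := one_div_le_one_div_of_le hr hmr
    set w := ‖Φ ((Complex.I * s) • (V : E) - G V)‖
    have hw : 0 ≤ w := norm_nonneg _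
    calc ‖Φ (J ((J ^ n) V))‖ ≤ r / m * ‖Φ ((J ^ n) V)‖ + 1 / m * w := h5
      _ ≤ r / m * ((r / m) ^ n * ‖Φ V‖ + n / r * w) + 1 / r * w := by gcongr
      _ = (r / m) ^ (n + 1) * ‖Φ V‖ + (r / m * (n / r * w) + 1 / r * w) := by ring
      _ ≤ (r / m) ^ (n + 1) * ‖Φ V‖ + (1 * (n / r * w) + 1 / r * w) := by gcongr
      _ = (r / m) ^ (n + 1) * ‖Φ V‖ + ((n + 1 : ℕ) : ℝ) / r * w := by push_cast; ring

/-- Since W - JW = -RGW for J = rR, replacing V by JⁿV costs one term of size |GV|/r for each of the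
n factors. -/
theorem seminorm_sub_smul_pow_le (hD : IsDissipative G Φ) {r : ℝ} (hr : 0 < r) {R : E →L[ℂ] E}
    (hR : IsBoundedInverse (resolventOp G r) R) (V : G.domain) (n : ℕ) :
    ‖Φ (V - (((r : ℂ) • R) ^ n) V)‖ ≤ n / r * ‖Φ (G V)‖ := by
  set J : E →L[ℂ] E := (r : ℂ) • R with hJ
  have hJc : CommutesWith J G := (commutesWith_of_isBoundedInverse hR).smul _
  induction n with
  | zero => simp
  | succ n ih =>
    obtain ⟨h, he⟩ := hJc.pow n V
    have h1 := (isBoundedInverse_resolventOp_iff.mp hR).2 ⟨_, h⟩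
    rw [he] at h1
    have h2 : V - (J ^ (n + 1)) V = (V - (J ^ n) V) - R ((J ^ n) (G V)) := by
      rw [pow_succ', mul_apply_eq_comp]
      simp only [hJ, smul_apply, map_sub, map_smul] at h1 ⊢
      nth_rw 2 [← h1]
      abel
    have h3 : ‖Φ (R ((J ^ n) (G V)))‖ ≤ ‖Φ (G V)‖ / r :=
      (hR.norm_seminorm_le hD hr _).trans (by
        gcongr; exact seminorm_smul_pow_le hD hr hR _ _)
    rw [h2, map_sub Φ]
    refine (norm_sub_le _ _).trans ((add_le_add ih h3).trans (le_of_eq ?_))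
    push_cast; ring

/-- The gain of n ≥ β factors absorbs the growth (1 + |s|)^β. For |s| ≤ r the gain is merely bounded
by 1 and 1 + |s| ≤ 2r; for |s| ≥ r the gain is at most (r/|s|)^β. -/
theorem smoothing_rpow_le {β r s : ℝ} (hβ : 0 < β) (hr : 1 ≤ r) {n : ℕ} (hn : β ≤ n) :
    (r / ‖(r : ℂ) - Complex.I * s‖) ^ n * (1 + |s|) ^ β ≤ (2 * r) ^ β := by
  set m := ‖(r : ℂ) - Complex.I * s‖ with hm
  have hr0 : 0 < r := by linarith
  have hmr : r ≤ m := by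
    have := Complex.re_le_norm ((r : ℂ) - Complex.I * s)
    simpa using this
  have hms : |s| ≤ m := by
    have := Complex.abs_im_le_norm ((r : ℂ) - Complex.I * s)
    simpa using this
  have hm0 : 0 < m := hr0.trans_le hmr
  have h6 : r / m ≤ 1 := (div_le_one hm0).mpr hmr
  rcases le_total |s| r with h | h
  · calc (r / m) ^ n * (1 + |s|) ^ β ≤ 1 * (2 * r) ^ β := by
          gcongr
          · exact pow_le_one₀ (by positivity) h6
          · linarith
      _ = _ := one_mul _
  · have hs0 : 0 < |s| := hr0.trans_le h
    calc (r / m) ^ n * (1 + |s|) ^ β ≤ (r / |s|) ^ (n : ℝ) * (2 * |s|) ^ β := by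
          rw [Real.rpow_natCast]
          gcongr
          linarith
      _ ≤ (r / |s|) ^ β * (2 * |s|) ^ β := by
          gcongr ?_ * _
          exact Real.rpow_le_rpow_of_exponent_ge (by positivity) ((div_le_one hs0).mpr h) hn
      _ = (2 * r) ^ β := by
          rw [← Real.mul_rpow (by positivity) (by positivity)]
          congr 1
          field_simp

/-- **Borichev–Tomilov**: a polynomial resolvent bound on the imaginary axis implies polynomial
decay of the solutions. -/
theorem IsDissipative.exists_decay [CompleteSpace E] [CompleteSpace X]
    (hD : IsDissipative G Φ)
    (hR : ∀ r : ℝ, 0 < r → ∃ R : E →L[ℂ] E, IsBoundedInverse (resolventOp G r) R)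
    {α C : ℝ} (hα : 0 < α) (hC : 0 < C)
    (hb : ∀ (s : ℝ) (V : G.domain),
      ‖Φ V‖ ≤ C * (1 + |s|) ^ (1 / α) * ‖Φ ((Complex.I * s) • (V : E) - G V)‖) :
    ∃ M : ℝ, 0 < M ∧ ∀ U : ℝ → E, IsOrbit G U → ∀ (h0 : U 0 ∈ G.domain) (t : ℝ), 0 < t →
      ‖Φ (U t)‖ ≤ M / t ^ α * ‖Φ (G ⟨U 0, h0⟩)‖ := by
  set β := 1 / α with hβ
  have hβ0 : 0 < β := by positivity
  set N := ⌈β⌉₊ with hN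
  have hNβ : β ≤ N := Nat.le_ceil β
  set K := 2 ^ β * C + N with hK
  have hK0 : 0 < K := by positivity
  -- Chosen so that r = δt^α gives 16Kr^β/t = 1/(2·2^α): the factor 2^α pays for passing from t^α to
  -- (t/2)^α, and 1/2 is left for the contraction. The time t₀ is where r reaches 1.
  set δ : ℝ := ((2 : ℝ) ^ α * 32 * K)⁻¹ ^ α with hδ
  have hδ0 : 0 < δ := by positivity
  have hδβ : 16 * K * δ ^ β = 1 / (2 * 2 ^ α) := by
    rw [hδ, ← Real.rpow_mul (by positivity), hβ, mul_one_div_cancel hα.ne', Real.rpow_one]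
    field_simp
    norm_num
  set t₀ : ℝ := (2 : ℝ) ^ α * 32 * K with ht₀
  have ht₀0 : 0 < t₀ := by positivity
  have hδt : δ * t₀ ^ α = 1 := by
    rw [hδ, Real.inv_rpow ht₀0.le]
    exact inv_mul_cancel₀ (by positivity)
  obtain ⟨R₁, hR₁⟩ := hR 1 one_pos
  rw [Complex.ofReal_one] at hR₁
  -- After smoothing by N factors the resolvent bound no longer depends on the frequency; the price
  -- is r^β.
  have hbs : ∀ (r : ℝ), 1 ≤ r → ∀ (R : E →L[ℂ] E), IsBoundedInverse (resolventOp G r) R →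
      ∀ (s : ℝ) (V : G.domain), ‖Φ ((((r : ℂ) • R) ^ N) V)‖
        ≤ K * r ^ β * ‖Φ ((Complex.I * s) • (V : E) - G V)‖ := by
    intro r hr R hRr s V
    have hr0 : 0 < r := by linarith
    refine (seminorm_smul_pow_resolvent_le hD hr0 hRr s V N).trans ?_
    set w := ‖Φ ((Complex.I * s) • (V : E) - G V)‖
    have hw : 0 ≤ w := norm_nonneg _
    have h1 : (r / ‖(r : ℂ) - Complex.I * s‖) ^ N * (C * (1 + |s|) ^ β)
        ≤ C * (2 ^ β * r ^ β) := by
      have := smoothing_rpow_le (s := s) hβ0 hr hNβ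
      rw [Real.mul_rpow (by norm_num) hr0.le] at this
      calc _ = C * ((r / ‖(r : ℂ) - Complex.I * s‖) ^ N * (1 + |s|) ^ β) := by ring
        _ ≤ _ := by gcongr
    have h2 : (N : ℝ) / r ≤ N * r ^ β := by
      have h3 : 1 ≤ r ^ β := Real.one_le_rpow hr hβ0.le
      have h4 : (N : ℝ) / r ≤ N := div_le_self (by positivity) hr
      nlinarith [(Nat.cast_nonneg N : (0 : ℝ) ≤ N)]
    calc _ ≤ (r / ‖(r : ℂ) - Complex.I * s‖) ^ N * (C * (1 + |s|) ^ β * w) + N / r * w := by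
          gcongr; exact hb s V
      _ = ((r / ‖(r : ℂ) - Complex.I * s‖) ^ N * (C * (1 + |s|) ^ β) + N / r) * w := by ring
      _ ≤ (C * (2 ^ β * r ^ β) + N * r ^ β) * w := by gcongr
      _ = K * r ^ β * w := by rw [hK]; ring
  -- The first entry settles times up to t₀, the second closes the halving step: half of M comes
  -- from time t/2 and the other half pays for the smoothing error N/δ.
  set M := max (t₀ ^ α * C) (2 * N / δ) with hM
  have hM1 : t₀ ^ α * C ≤ M := le_max_left _ _
  have hM2 : 2 * N / δ ≤ M := le_max_right _ _
  have hM0 : 0 < M := lt_of_lt_of_le (by positivity) hM1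
  refine ⟨M, hM0, fun U hU h0 => ?_⟩
  set g := ‖Φ (G ⟨U 0, h0⟩)‖ with hg
  have hg0 : 0 ≤ g := norm_nonneg _
  have hsmall : ∀ t, 0 < t → t ≤ t₀ → t ^ α * ‖Φ (U t)‖ ≤ M * g := by
    intro t ht htt
    have h1 : ‖Φ (U t)‖ ≤ ‖Φ (U 0)‖ :=
      hU.antitoneOn hD (Set.mem_Ici.mpr le_rfl) (Set.mem_Ici.mpr ht.le) ht.le
    -- Frequency zero bounds the initial seminorm by that of G U(0).
    have h2 := hb 0 ⟨U 0, h0⟩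
    simp only [Complex.ofReal_zero, mul_zero, zero_smul, zero_sub, map_neg, norm_neg, abs_zero,
      add_zero, Real.one_rpow, mul_one] at h2
    calc t ^ α * ‖Φ (U t)‖ ≤ t₀ ^ α * (C * g) := by
          gcongr; exact h1.trans h2
      _ = t₀ ^ α * C * g := by ring
      _ ≤ M * g := by gcongr
  have hstep : ∀ t, t₀ ≤ t → (t / 2) ^ α * ‖Φ (U (t / 2))‖ ≤ M * g →
      t ^ α * ‖Φ (U t)‖ ≤ M * g := by
    intro t ht hind
    have ht0 : 0 < t := ht₀0.trans_le ht
    set r := δ * t ^ α with hr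
    have hr1 : 1 ≤ r := by rw [← hδt, hr]; gcongr
    have hr0 : 0 < r := by linarith
    obtain ⟨R, hRr⟩ := hR r hr0
    set L : E →L[ℂ] E := ((r : ℂ) • R) ^ N with hL
    have hLc : CommutesWith L G := ((commutesWith_of_isBoundedInverse hRr).smul _).pow N
    -- The orbit is restarted at t/2 and followed on an interval of length t, whose midpoint is time
    -- t of the original orbit.
    have h1 : ‖Φ (L (U t))‖ ≤ 16 * (K * r ^ β) / t * ‖Φ (U (t / 2))‖ := by
      have := (hU.shift (half_pos ht0).le).norm_le_of_resolvent_bound hD hR₁ hLc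
        (K := K * r ^ β) (by positivity) (hbs r hr1 R hRr) ht0
      simpa using this
    have h2 : ‖Φ (U t - L (U t))‖ ≤ N / r * g :=
      ((hU.sub (hU.map hLc)).antitoneOn hD (Set.mem_Ici.mpr le_rfl)
        (Set.mem_Ici.mpr ht0.le) ht0.le).trans (seminorm_sub_smul_pow_le hD hr0 hRr ⟨U 0, h0⟩ N)
    have h3 : ‖Φ (U t)‖ ≤ ‖Φ (L (U t))‖ + ‖Φ (U t - L (U t))‖ := by
      have : Φ (U t) = Φ (L (U t)) + Φ (U t - L (U t)) := by rw [← map_add]; congr 1; abel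
      rw [this]; exact norm_add_le _ _
    have h4 : 16 * (K * r ^ β) / t = 1 / (2 * 2 ^ α) := by
      rw [← hδβ, hr, Real.mul_rpow hδ0.le (by positivity), ← Real.rpow_mul ht0.le, hβ,
        mul_one_div_cancel hα.ne', Real.rpow_one]
      field_simp
    rw [h4] at h1
    have h5 : t ^ α = 2 ^ α * (t / 2) ^ α := by
      rw [← Real.mul_rpow (by norm_num) (by positivity)]
      congr 1; ring
    calc t ^ α * ‖Φ (U t)‖ ≤ t ^ α * (1 / (2 * 2 ^ α) * ‖Φ (U (t / 2))‖ + N / r * g) := by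
          gcongr; linarith
      _ = 1 / 2 * ((t / 2) ^ α * ‖Φ (U (t / 2))‖) + 1 / 2 * (2 * N / δ) * g := by
          rw [mul_add, hr]
          congr 1
          · rw [h5]; field_simp
          · field_simp
      _ ≤ 1 / 2 * (M * g) + 1 / 2 * M * g := by gcongr
      _ = M * g := by ring
  -- Dyadic induction from times up to t₀, with the constant M unchanged at every halving.
  have hall : ∀ (n : ℕ) (t : ℝ), 0 < t → t ≤ 2 ^ n * t₀ → t ^ α * ‖Φ (U t)‖ ≤ M * g := by
    intro n
    induction n with
    | zero => intro t ht h; exact hsmall t ht (by simpa using h)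
    | succ n ih =>
      intro t ht h
      rcases le_total t t₀ with h1 | h1
      · exact hsmall t ht h1
      · exact hstep t h1 (ih _ (by positivity) (by rw [pow_succ] at h; linarith))
  intro t ht
  obtain ⟨n, hn⟩ := pow_unbounded_of_one_lt (t / t₀) one_lt_two
  have := hall n t ht ((div_lt_iff₀ ht₀0).mp hn).le
  rw [div_mul_eq_mul_div, le_div_iff₀ (by positivity)]
  linarith

end Abstract

end DampedWave

open Filter Topology NormedSpace

namespace DampedWave

/-! ### Exponentials of bounded operators and Yosida approximations. -/

section Abstract

theorem norm_exp_clm_le {F : Type*} [NormedAddCommGroup F] [NormedSpace ℂ F] (L : F →L[ℂ] F) : ‖exp L‖ ≤ Real.exp ‖L‖ := by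
  rw [exp_eq_tsum ℂ]
  have h1 : HasSum (fun n : ℕ => ‖L‖ ^ n / (n.factorial : ℝ)) (Real.exp ‖L‖) := by
    rw [Real.exp_eq_exp_ℝ]
    exact expSeries_div_hasSum_exp ‖L‖
  refine tsum_of_norm_bounded h1 fun n => ?_
  rw [norm_smul, norm_inv, RCLike.norm_natCast, inv_mul_eq_div]
  gcongr
  -- The power zero is treated apart because the identity of the zero space has norm 0; only the
  -- bound by 1 is general.
  rcases n.eq_zero_or_pos with rfl | hn
  · rw [pow_zero, pow_zero]; exact ContinuousLinearMap.norm_id_le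
  · exact norm_pow_le' L hn

variable {E X : Type*} [NormedAddCommGroup E] [NormedSpace ℂ E] [CompleteSpace E]
  [NormedAddCommGroup X] [InnerProductSpace ℂ X]
  {G : E →ₗ.[ℂ] E} {Φ : E →L[ℂ] X} {U : ℝ → E}

theorem hasDerivAt_exp_smul_apply (P : E →L[ℂ] E) (x : E) (t : ℝ) :
    HasDerivAt (fun u : ℝ => exp (u • P) x) (exp (t • P) (P x)) t := by
  have h1 : HasDerivAt (fun u : ℝ => exp (u • P)) (exp (t • P) * P) t :=
    hasDerivAt_exp_smul_const P t
  have h2 := ((ContinuousLinearMap.apply ℂ E x).restrictScalars ℝ).hasFDerivAt.comp_hasDerivAt t h1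
  exact h2

/-- Duhamel's formula: s ↦ e^(sP) e^((t-s)Q) x interpolates between the two exponentials, and since
P and Q commute its derivative is e^(sP) e^((t-s)Q) (P - Q)x, of norm at most e^(ct)‖(P - Q)x‖. -/
theorem norm_exp_smul_apply_sub_le {P Q : E →L[ℂ] E} (hPQ : Commute P Q) {c : ℝ} 
    (hP : ∀ t : ℝ, 0 ≤ t → ‖exp (t • P)‖ ≤ Real.exp (c * t))
    (hQ : ∀ t : ℝ, 0 ≤ t → ‖exp (t • Q)‖ ≤ Real.exp (c * t)) {t : ℝ} (ht : 0 ≤ t) (x : E) :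
    ‖exp (t • P) x - exp (t • Q) x‖ ≤ t * Real.exp (c * t) * ‖P x - Q x‖ := by
  have hcomm : ∀ a b : ℝ, Commute (exp (a • P)) (exp (b • Q)) := fun a b =>
    ((hPQ.smul_left a).smul_right b).exp
  have hder : ∀ s : ℝ, HasDerivAt (fun s : ℝ => exp (s • P) (exp ((t - s) • Q) x))
      (exp (s • P) (exp ((t - s) • Q) (P x - Q x))) s := by
    intro s
    have h1 : HasDerivAt (fun u : ℝ => exp (u • P)) (exp (s • P) * P) s :=
      hasDerivAt_exp_smul_const P s
    have h2 : HasDerivAt (fun u : ℝ => exp ((t - u) • Q)) (-(exp ((t - s) • Q) * Q)) s := by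
      have := (hasDerivAt_exp_smul_const (𝕂 := ℝ) Q (t - s)).scomp s
        ((hasDerivAt_id s).const_sub t)
      simpa using! this
    have h3 := h1.mul h2
    have h4 := ((ContinuousLinearMap.apply ℂ E x).restrictScalars ℝ).hasFDerivAt.comp_hasDerivAt s h3
    convert! h4 using 1
    have h5 : Commute P (exp ((t - s) • Q)) := (hPQ.smul_right (t - s)).exp_right
    have h6 : P (exp ((t - s) • Q) x) = exp ((t - s) • Q) (P x) :=
      congrArg (fun L : E →L[ℂ] E => L x) h5.eq
    simp [h6, ← sub_eq_add_neg]
  have := norm_image_sub_le_of_norm_deriv_le_segment' (a := 0) (b := t)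
    (C := Real.exp (c * t) * ‖P x - Q x‖)
    (fun s _ => (hder s).hasDerivWithinAt) (fun s hs => ?_) t (Set.right_mem_Icc.mpr ht)
  · simp only [sub_self, zero_smul, exp_zero, sub_zero] at this
    calc _ ≤ _ := this
      _ = _ := by ring
  · calc ‖exp (s • P) (exp ((t - s) • Q) (P x - Q x))‖
        ≤ Real.exp (c * s) * (Real.exp (c * (t - s)) * ‖P x - Q x‖) := by
          refine (ContinuousLinearMap.le_opNorm _ _).trans ?_
          gcongr
          · exact hP s hs.1
          · refine (ContinuousLinearMap.le_opNorm _ _).trans ?_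
            gcongr
            exact hQ _ (by linarith [hs.2])
      _ = _ := by
          rw [← mul_assoc, ← Real.exp_add]; congr 2; ring

/-- Write r(rR - 1) = r²R - r and take the scalar factor e^(-tr) out. The remaining exponent t(r²/(r
- ω) - r) = trω/(r - ω) is at most 2ωt because r > 2ω makes r/(r - ω) ≤ 2. -/
theorem norm_exp_smul_yosida_le {R : E →L[ℂ] E} {ω r : ℝ} (hω : 0 ≤ ω) (hr : 2 * ω < r)
    (hR : ‖R‖ ≤ 1 / (r - ω)) {t : ℝ} (ht : 0 ≤ t) :
    ‖exp (t • ((r : ℂ) • ((r : ℂ) • R - 1)))‖ ≤ Real.exp (2 * ω * t) := by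
  have hr0 : 0 < r := by linarith
  have h0 : t • ((r : ℂ) • ((r : ℂ) • R - 1))
      = ((t * r ^ 2 : ℝ) : ℂ) • R + ((-(t * r) : ℝ) : ℂ) • (1 : E →L[ℂ] E) := by
    rw [← Complex.coe_smul t]
    push_cast
    module
  have h1 : Commute (((t * r ^ 2 : ℝ) : ℂ) • R) (((-(t * r) : ℝ) : ℂ) • (1 : E →L[ℂ] E)) :=
    (Commute.one_right _).smul_right _
  let +nondep : NormedAlgebra ℚ (E →L[ℂ] E) := .restrictScalars ℚ ℂ _
  rw [h0, exp_add_of_commute h1]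
  have h2 : exp (((-(t * r) : ℝ) : ℂ) • (1 : E →L[ℂ] E))
      = (Complex.exp ((-(t * r) : ℝ) : ℂ)) • (1 : E →L[ℂ] E) := by
    rw [← Algebra.algebraMap_eq_smul_one, ← algebraMap_exp_comm, ← Complex.exp_eq_exp_ℂ, Algebra.algebraMap_eq_smul_one]
  rw [h2, mul_smul_comm, mul_one, norm_smul, Complex.norm_exp, Complex.ofReal_re]
  have h3 : ‖exp (((t * r ^ 2 : ℝ) : ℂ) • R)‖ ≤ Real.exp (t * r ^ 2 * (1 / (r - ω))) := by
    refine (norm_exp_clm_le _).trans (Real.exp_le_exp.mpr ?_)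
    rw [norm_smul, Complex.norm_real, Real.norm_of_nonneg (by positivity)]
    gcongr
  calc _ ≤ Real.exp (-(t * r)) * Real.exp (t * r ^ 2 * (1 / (r - ω))) := by gcongr
    _ = Real.exp (-(t * r) + t * r ^ 2 * (1 / (r - ω))) := (Real.exp_add _ _).symm
    _ ≤ _ := by
      apply Real.exp_le_exp.mpr
      have h4 : 0 < r - ω := by linarith
      have h5 : -(t * r) + t * r ^ 2 * (1 / (r - ω)) = t * (r * ω) / (r - ω) := by
        field_simp; ring
      rw [h5, div_le_iff₀ h4]
      nlinarith [mul_nonneg ht (mul_nonneg hω (by linarith : 0 ≤ r - 2 * ω))]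

end Abstract

/-! ### Existence of orbits under the Hille–Yosida condition. -/

section Abstract

variable {E X : Type*} [NormedAddCommGroup E] [NormedSpace ℂ E] [CompleteSpace E]
  [NormedAddCommGroup X] [InnerProductSpace ℂ X]
  {G : E →ₗ.[ℂ] E} {Φ : E →L[ℂ] X} {U : ℝ → E}

/-- The Hille–Yosida condition for a quasi-contractive semigroup. -/
def HilleYosida (G : E →ₗ.[ℂ] E) : Prop :=
  ∃ ω : ℝ, 0 ≤ ω ∧ ∀ r : ℝ, ω < r →
    ∃ R : E →L[ℂ] E, IsBoundedInverse (resolventOp G r) R ∧ ‖R‖ ≤ 1 / (r - ω)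

/-- The orbits of a sequence of commuting bounded operators converge locally uniformly when the
operators converge at rate `1 / (n + 1)`. -/
theorem exists_tendsto_exp_smul {P : ℕ → E →L[ℂ] E} (hP : ∀ m n, Commute (P m) (P n)) {c : ℝ}
    (hc : 0 ≤ c) (hexp : ∀ n (t : ℝ), 0 ≤ t → ‖exp (t • P n)‖ ≤ Real.exp (c * t)) {x y : E} {K : ℝ}
    (hx : ∀ n, ‖P n x - y‖ ≤ K / (n + 1)) :
    ∃ v : ℝ → E, ContinuousOn v (Set.Ici 0) ∧
      ∀ t, 0 ≤ t → Tendsto (fun n => exp (t • P n) x) atTop (𝓝 (v t)) := by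
  have hKt : Tendsto (fun n : ℕ => K / ((n : ℝ) + 1)) atTop (𝓝 0) := by
    have := tendsto_one_div_add_atTop_nhds_zero_nat.const_mul K
    simpa [div_eq_mul_inv] using this
  have hK0 : ∀ n : ℕ, 0 ≤ K / ((n : ℝ) + 1) := fun n => (norm_nonneg _).trans (hx n)
  have hdiff : ∀ T t : ℝ, 0 ≤ t → t ≤ T → ∀ m n : ℕ,
      ‖exp (t • P m) x - exp (t • P n) x‖
        ≤ T * Real.exp (c * T) * (K / (m + 1) + K / (n + 1)) := by
    intro T t ht hT m n
    refine (norm_exp_smul_apply_sub_le (hP m n) (hexp m) (hexp n) ht x).trans ?_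
    have h1 : ‖P m x - P n x‖ ≤ K / (m + 1) + K / (n + 1) := by
      have : P m x - P n x = (P m x - y) - (P n x - y) := by abel
      rw [this]
      exact (norm_sub_le _ _).trans (add_le_add (hx m) (hx n))
    have h2 : 0 ≤ T := ht.trans hT
    gcongr
  have hlim : ∀ t : ℝ, 0 ≤ t → ∃ l, Tendsto (fun n => exp (t • P n) x) atTop (𝓝 l) := by
    intro t ht
    refine cauchySeq_tendsto_of_complete (Metric.cauchySeq_iff.mpr ?_)
    intro ε hε
    have h1 := (hKt.const_mul (t * Real.exp (c * t))).const_mul 2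
    rw [mul_zero, mul_zero] at h1
    obtain ⟨N, hN⟩ := (h1.eventually (gt_mem_nhds hε)).exists_forall_of_atTop
    refine ⟨N, fun m hm n hn => ?_⟩
    rw [dist_eq_norm]
    refine (hdiff t t ht le_rfl m n).trans_lt ?_
    linarith [hN m hm, hN n hn]
  choose! v hv using hlim
  refine ⟨v, ?_, hv⟩
  have hvn : ∀ T t : ℝ, 0 ≤ t → t ≤ T → ∀ n : ℕ,
      ‖v t - exp (t • P n) x‖ ≤ T * Real.exp (c * T) * (K / (n + 1)) := by
    intro T t ht hT n
    have h1 : Tendsto (fun m => ‖exp (t • P m) x - exp (t • P n) x‖) atTop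
        (𝓝 ‖v t - exp (t • P n) x‖) := ((hv t ht).sub_const _).norm
    have h2 : Tendsto (fun m : ℕ => T * Real.exp (c * T) * (K / (m + 1) + K / (n + 1))) atTop
        (𝓝 (T * Real.exp (c * T) * (0 + K / (n + 1)))) := (hKt.add_const _).const_mul _
    rw [zero_add] at h2
    exact le_of_tendsto_of_tendsto' h1 h2 fun m => hdiff T t ht hT m n
  have hcont : ∀ n, Continuous fun t : ℝ => exp (t • P n) x := fun n =>
    continuous_iff_continuousAt.mpr fun t => (hasDerivAt_exp_smul_apply (P n) x t).continuousAt
  -- The error bound is uniform for times up to t + 1, so the limit inherits continuity from the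
  -- exponentials.
  refine TendstoLocallyUniformlyOn.continuousOn (F := fun n t => exp (t • P n) x) (p := atTop) ?_
    (Frequently.of_forall fun n => (hcont n).continuousOn)
  rw [Metric.tendstoLocallyUniformlyOn_iff]
  intro ε hε t ht
  refine ⟨Set.Ici 0 ∩ Set.Iio (t + 1), inter_mem_nhdsWithin _ (Iio_mem_nhds (by linarith)), ?_⟩
  have h1 := hKt.const_mul ((t + 1) * Real.exp (c * (t + 1)))
  rw [mul_zero] at h1
  filter_upwards [h1.eventually (gt_mem_nhds hε)] with n hn u hu
  rw [dist_eq_norm]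
  exact (hvn (t + 1) u hu.1 hu.2.le n).trans_lt hn

/-- Under the Hille–Yosida condition, smooth initial data have a solution. -/
theorem HilleYosida.exists_isOrbit (hG : HilleYosida G) (x₀ x₁ x₂ : G.domain)
    (h₁ : G x₀ = x₁) (h₂ : G x₁ = x₂) : ∃ U : ℝ → E, IsOrbit G U ∧ U 0 = x₀ := by
  obtain ⟨ω, hω, hR⟩ := hG
  have hr : ∀ n : ℕ, ω < 2 * ω + (n + 1) := fun n => by
    have : (0 : ℝ) ≤ n := Nat.cast_nonneg n
    linarith
  choose R hR hRn using fun n : ℕ => hR _ (hr n)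
  -- The shift by 2ω makes the Yosida exponentials uniformly bounded; it also gives ‖R n‖ ≤ 1/(n +
  -- 1), the rate required for convergence.
  set r : ℕ → ℝ := fun n => 2 * ω + (n + 1) with hrdef
  have hr0 : ∀ n, 0 < r n := fun n => by positivity
  have hRn' : ∀ n, ‖R n‖ ≤ 1 / ((n : ℝ) + 1) := fun n => (hRn n).trans
    (one_div_le_one_div_of_le (by positivity) (by linarith))
  have hRr : ∀ n, ‖(r n : ℂ) • R n‖ ≤ 2 := fun n => by
    rw [norm_smul, Complex.norm_real, Real.norm_of_nonneg (hr0 n).le]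
    calc r n * ‖R n‖ ≤ r n * (1 / (r n - ω)) := mul_le_mul_of_nonneg_left (hRn n) (hr0 n).le
      _ ≤ 2 := by
        rw [mul_one_div, div_le_iff₀ (by linarith [hr n])]
        have : (0 : ℝ) ≤ n := Nat.cast_nonneg n
        simp only [hrdef]; linarith
  have hcR : ∀ m n, Commute (R m) (R n) := fun m n =>
    (commutesWith_of_isBoundedInverse (hR m)).commute (hR n)
  set P : ℕ → E →L[ℂ] E := fun n => (r n : ℂ) • ((r n : ℂ) • R n - 1) with hP
  have hRP : ∀ m n, Commute (R m) (P n) := fun m n =>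
    (((hcR m n).smul_right _).sub_right (Commute.one_right _)).smul_right _
  have hPP : ∀ m n, Commute (P m) (P n) := fun m n =>
    ((((hRP m n).smul_left _).sub_left (Commute.one_left _)).smul_left _)
  have hexp : ∀ n (t : ℝ), 0 ≤ t → ‖exp (t • P n)‖ ≤ Real.exp (2 * ω * t) := fun n t ht =>
    norm_exp_smul_yosida_le hω (by linarith [(Nat.cast_nonneg n : (0:ℝ) ≤ n)])
      (hRn n) ht
  have hJ : ∀ n (x : G.domain), (r n : ℂ) • R n x - x = R n (G x) := fun n x => by
    have := (isBoundedInverse_resolventOp_iff.mp (hR n)).2 x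
    rw [map_sub, map_smul] at this
    nth_rw 2 [← this]; abel
  have hPx : ∀ n (x : G.domain), P n x = (r n : ℂ) • R n (G x) := fun n x => by
    rw [← hJ]; rfl
  -- The error of the Yosida approximation is P n x - Gx = R n (G²x). Applied to x₀ and to x₁ = Gx₀,
  -- this is what requires three applications of G to x₀.
  have hPG : ∀ (x y : G.domain), G x = y → ∀ n : ℕ, ‖P n x - G x‖ ≤ ‖G y‖ / (n + 1) := by
    intro x y hxy n
    rw [hPx, hxy, hJ]
    refine ((R n).le_opNorm _).trans ?_
    rw [div_eq_mul_one_div, mul_comm]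
    gcongr
    exact hRn' n
  obtain ⟨u, -, hu⟩ := exists_tendsto_exp_smul hPP (by positivity) hexp (hPG x₀ x₁ h₁)
  obtain ⟨v, hvc, hv⟩ := exists_tendsto_exp_smul hPP (by positivity) hexp (hPG x₁ x₂ h₂)
  have hPx₀ : ∀ n, P n x₀ = ((r n : ℂ) • R n) x₁ := fun n => by rw [hPx, h₁]; rfl
  have hPt : Tendsto (fun n => P n x₀ - x₁) atTop (𝓝 0) := by
    rw [← h₁]
    refine squeeze_zero_norm (hPG x₀ x₁ h₁) ?_
    have := tendsto_one_div_add_atTop_nhds_zero_nat.const_mul ‖G x₁‖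
    simpa [div_eq_mul_inv] using this
  have hint : ∀ t, 0 ≤ t → u t = x₀ + ∫ s in 0..t, v s := by
    intro t ht
    have h1 : ∀ n, exp (t • P n) x₀ = x₀ + ∫ s in 0..t, exp (s • P n) (P n x₀) := by
      intro n
      have hc : Continuous fun s : ℝ => exp (s • P n) (P n x₀) :=
        continuous_iff_continuousAt.mpr fun s =>
          (hasDerivAt_exp_smul_apply (P n) _ s).continuousAt
      rw [intervalIntegral.integral_eq_sub_of_hasDerivAt
        (fun s _ => hasDerivAt_exp_smul_apply (P n) _ s) (hc.intervalIntegrable _ _)]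
      simp
    have h2 : Tendsto (fun n => ∫ s in 0..t, exp (s • P n) (P n x₀)) atTop
        (𝓝 (∫ s in 0..t, v s)) := by
      refine intervalIntegral.tendsto_integral_filter_of_dominated_convergence
        (fun _ => Real.exp (2 * ω * t) * (2 * ‖(x₁ : E)‖)) ?_ ?_ (by simp) ?_
      · refine Eventually.of_forall fun n => Continuous.aestronglyMeasurable ?_
        exact continuous_iff_continuousAt.mpr fun s =>
          (hasDerivAt_exp_smul_apply (P n) _ s).continuousAt
      · refine Eventually.of_forall fun n => Eventually.of_forall fun s hs => ?_
        rw [Set.uIoc_of_le ht] at hs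
        refine (ContinuousLinearMap.le_opNorm _ _).trans ?_
        gcongr
        · refine (hexp n s hs.1.le).trans (Real.exp_le_exp.mpr ?_)
          have := hs.2
          gcongr
        · rw [hPx₀]
          exact (ContinuousLinearMap.le_opNorm _ _).trans (by gcongr; exact hRr n)
      · refine Eventually.of_forall fun s hs => ?_
        rw [Set.uIoc_of_le ht] at hs
        have h3 : Tendsto (fun n => exp (s • P n) (P n x₀ - x₁)) atTop (𝓝 0) := by
          refine squeeze_zero_norm (a := fun n => Real.exp (2 * ω * s) * ‖P n x₀ - x₁‖)
            (fun n => (ContinuousLinearMap.le_opNorm _ _).trans (by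
              gcongr; exact hexp n s hs.1.le)) ?_
          simpa using hPt.norm.const_mul (Real.exp (2 * ω * s))
        have h4 := h3.add (hv s hs.1.le)
        simpa using h4
    refine tendsto_nhds_unique (hu t ht) ?_
    simp_rw [h1]
    exact h2.const_add _
  -- The relation R(Gx) = rRx - x is passed to the limit in place of G itself. It reads u = R(ru -
  -- v), so u lies in the domain and Gu = v.
  have hdom : ∀ t, 0 ≤ t → ∃ h : u t ∈ G.domain, G ⟨u t, h⟩ = v t := by
    intro t ht
    have hce : ∀ n, Commute (R 0) (exp (t • P n)) := fun n =>
      ((hRP 0 n).smul_right t).exp_right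
    have h1 : ∀ n, R 0 (exp (t • P n) x₁)
        = (r 0 : ℂ) • R 0 (exp (t • P n) x₀) - exp (t • P n) x₀ := by
      intro n
      have h2 : ∀ x, R 0 (exp (t • P n) x) = exp (t • P n) (R 0 x) := fun x =>
        congrArg (fun L : E →L[ℂ] E => L x) (hce n).eq
      rw [h2, h2, ← h₁, ← hJ, map_sub, map_smul]
    have h3 : R 0 (v t) = (r 0 : ℂ) • R 0 (u t) - u t := by
      refine tendsto_nhds_unique (((R 0).continuous.tendsto _).comp (hv t ht)) ?_
      simp only [Function.comp_def, h1]
      exact ((((R 0).continuous.tendsto _).comp (hu t ht)).const_smul _).sub (hu t ht)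
    have h4 : R 0 ((r 0 : ℂ) • u t - v t) = u t := by
      rw [map_sub, map_smul, h3]; abel
    have h5 := (isBoundedInverse_resolventOp_iff.mp (hR 0)).1 ((r 0 : ℂ) • u t - v t)
    rw [h4] at h5
    obtain ⟨h, h6⟩ := h5
    exact ⟨h, sub_right_injective h6⟩
  refine ⟨u, fun t ht => ?_, by simpa using hint 0 le_rfl⟩
  obtain ⟨h, he⟩ := hdom t ht
  refine ⟨h, ?_⟩
  rw [he]
  have hvt : IntervalIntegrable v volume 0 t := by
    apply ContinuousOn.intervalIntegrable
    rw [Set.uIcc_of_le ht]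
    exact hvc.mono Set.Icc_subset_Ici_self
  have hder : HasDerivWithinAt (fun b => ∫ s in 0..b, v s) (v t) (Set.Ici 0) t := by
    -- A continuous extension of v to the whole line, so that the two-sided fundamental theorem of
    -- calculus also covers t = 0.
    set w : ℝ → E := fun s => v (max s 0) with hw
    have hwc : Continuous w :=
      hvc.comp_continuous (by fun_prop) fun s => Set.mem_Ici.mpr (le_max_right _ _)
    have h1 : HasDerivAt (fun b => ∫ s in 0..b, w s) (w t) t :=
      intervalIntegral.integral_hasDerivAt_right (hwc.intervalIntegrable _ _)
        (hwc.stronglyMeasurableAtFilter _ _) hwc.continuousAt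
    have h2 : w t = v t := by simp [hw, ht]
    rw [h2] at h1
    refine h1.hasDerivWithinAt.congr (fun b hb => ?_) ?_
    · exact intervalIntegral.integral_congr fun s hs => by
        rw [Set.uIcc_of_le (Set.mem_Ici.mp hb)] at hs
        simp [hw, hs.1]
    · exact intervalIntegral.integral_congr fun s hs => by
        rw [Set.uIcc_of_le ht] at hs
        simp [hw, hs.1]
  exact (hder.const_add (x₀ : E)).congr (fun b hb => hint b hb) (hint t ht)

end Abstract

/-! ### The Batty–Duyckaerts theorem. -/

section Abstract

variable {E X : Type*} [NormedAddCommGroup E] [NormedSpace ℂ E]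
  [NormedAddCommGroup X] [InnerProductSpace ℂ X]
  {G : E →ₗ.[ℂ] E} {Φ : E →L[ℂ] X} {U : ℝ → E}

/-- The modulated solution `e^{-ist} U(t)` moves at most at speed `‖Φ (is - G) U(0)‖`. -/
theorem IsOrbit.seminorm_sub_modulated_le (hD : IsDissipative G Φ) (hU : IsOrbit G U)
    (h0 : U 0 ∈ G.domain) (s : ℝ) {t : ℝ} (ht : 0 < t) :
    ‖Φ (Complex.exp (-(Complex.I * s * t)) • U t - U 0)‖
      ≤ t * ‖Φ ((Complex.I * s) • U 0 - G ⟨U 0, h0⟩)‖ := by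
  set Z : ℝ → E := fun t => Complex.exp (-(Complex.I * s * t)) • U t with hZ
  have hZ0 : Z 0 = U 0 := by simp [hZ]
  -- Up to a factor of modulus one, the increment of Z over [a, a + h] is the value at time a of the
  -- orbit e^(-ish)U(· + h) - U, whose seminorm does not increase.
  have hstep : ∀ a h : ℝ, 0 ≤ a → 0 ≤ h → ‖Φ (Z (a + h) - Z a)‖ ≤ ‖Φ (Z h - Z 0)‖ := by
    intro a h ha hh
    have horb := ((hU.shift hh).smul (Complex.exp (-(Complex.I * s * h)))).sub hU
    have h1 := horb.antitoneOn hD (Set.mem_Ici.mpr le_rfl) (Set.mem_Ici.mpr ha) ha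
    have h2 : Z (a + h) - Z a = Complex.exp (-(Complex.I * s * a)) •
        (Complex.exp (-(Complex.I * s * h)) • U (a + h) - U a) := by
      simp only [hZ]
      rw [smul_sub, smul_smul, ← Complex.exp_add]
      congr 3
      push_cast; ring
    rw [h2, map_smul, norm_smul]
    have h3 : ‖Complex.exp (-(Complex.I * s * a))‖ = 1 := by
      rw [Complex.norm_exp]; simp
    rw [h3, one_mul]
    simpa [hZ] using h1
  -- The first increment dominates the later ones, so n steps cost at most n times it. With h = t/n
  -- and n → ∞ only the right derivative of Z at 0 is needed.
  have hmul : ∀ (n : ℕ) (h : ℝ), 0 ≤ h → ‖Φ (Z (n * h) - Z 0)‖ ≤ n * ‖Φ (Z h - Z 0)‖ := by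
    intro n h hh
    induction n with
    | zero => simp
    | succ n ih =>
      have h1 := hstep (n * h) h (by positivity) hh
      have h2 : Z ((n + 1 : ℕ) * h) - Z 0 = (Z (n * h + h) - Z (n * h)) + (Z (n * h) - Z 0) := by
        rw [sub_add_sub_cancel]; congr 2; push_cast; ring
      rw [h2, map_add]
      refine (norm_add_le _ _).trans ((add_le_add h1 ih).trans (le_of_eq ?_))
      push_cast; ring
  have hder : HasDerivWithinAt Z (G ⟨U 0, h0⟩ - (Complex.I * s) • U 0) (Set.Ici 0) 0 := by
    obtain ⟨h, hd⟩ := hU 0 le_rfl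
    have h3 : HasDerivAt (fun t : ℝ => -(Complex.I * s * t)) (-(Complex.I * s)) 0 := by
      convert! ((hasDerivAt_id (0 : ℝ)).ofReal_comp.const_mul (Complex.I * s)).neg using 1
      simp
    have h4 := h3.cexp.hasDerivWithinAt (s := Set.Ici 0) |>.smul hd
    convert! h4 using 1
    simp [sub_eq_add_neg]
  rw [← hasDerivWithinAt_Ioi_iff_Ici, hasDerivWithinAt_iff_tendsto_slope' (by simp)] at hder
  have htn : Tendsto (fun n : ℕ => t / ((n : ℝ) + 1)) atTop (𝓝[>] 0) := by
    rw [tendsto_nhdsWithin_iff]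
    refine ⟨?_, Eventually.of_forall fun n => Set.mem_Ioi.mpr (by positivity)⟩
    have := tendsto_one_div_add_atTop_nhds_zero_nat.const_mul t
    simpa [div_eq_mul_inv] using this
  have hlim := (((Φ.continuous.tendsto _).comp (hder.comp htn)).norm).const_mul t
  have heq : ‖Φ (G ⟨U 0, h0⟩ - (Complex.I * s) • U 0)‖
      = ‖Φ ((Complex.I * s) • U 0 - G ⟨U 0, h0⟩)‖ := by
    rw [← norm_neg, ← map_neg, neg_sub]
  rw [heq] at hlim
  refine ge_of_tendsto' hlim fun n => ?_
  have hn : (0 : ℝ) < (n : ℝ) + 1 := by positivity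
  have h1 := hmul (n + 1) (t / ((n : ℝ) + 1)) (by positivity)
  have h2 : ((n + 1 : ℕ) : ℝ) * (t / ((n : ℝ) + 1)) = t := by push_cast; field_simp
  rw [h2, hZ0] at h1
  refine h1.trans (le_of_eq ?_)
  simp only [Function.comp_apply, slope_def_module, sub_zero, hZ0]
  rw [← Complex.coe_smul, map_smul, norm_smul, Complex.norm_real,
    Real.norm_of_nonneg (by positivity)]
  push_cast
  field_simp

theorem HilleYosida.exists_isBoundedInverse (hG : HilleYosida G) :
    ∃ n₀ : ℕ, ∀ n : ℕ, n₀ ≤ n → ∃ R : E →L[ℂ] E,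
      IsBoundedInverse (resolventOp G ((n : ℝ) : ℂ)) R := by
  obtain ⟨ω, -, hR⟩ := hG
  obtain ⟨n₀, hn₀⟩ := exists_nat_gt ω
  refine ⟨n₀, fun n hn => ?_⟩
  obtain ⟨R, h, -⟩ := hR n (hn₀.trans_le (by exact_mod_cast hn))
  exact ⟨R, h⟩

/-- **Batty–Duyckaerts**: polynomial decay of the solutions implies a polynomial bound for the
resolvent on the imaginary axis. -/
theorem HilleYosida.exists_resolvent_bound [CompleteSpace E] (hG : HilleYosida G)
    (hD : IsDissipative G Φ) {α M : ℝ} (hα : 0 < α) (hM : 0 < M)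
    (hdec : ∀ U : ℝ → E, IsOrbit G U → ∀ (h0 : U 0 ∈ G.domain) (t : ℝ), 0 < t →
      ‖Φ (U t)‖ ≤ M / t ^ α * ‖Φ (G ⟨U 0, h0⟩)‖) :
    ∃ C : ℝ, 0 < C ∧ ∀ (s : ℝ) (V : G.domain), 1 ≤ |s| →
      ‖Φ V‖ ≤ C * |s| ^ (1 / α) * ‖Φ ((Complex.I * s) • (V : E) - G V)‖ := by
  set C := 1 + 2 * (2 * M) ^ (1 / α) with hC
  have hC0 : 0 < C := by positivity
  refine ⟨C, hC0, fun s V hs => ?_⟩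
  have hs0 : 0 < |s| := by linarith
  have key : ∀ V : G.domain, (∃ U, IsOrbit G U ∧ U 0 = V) →
      ‖Φ V‖ ≤ C * |s| ^ (1 / α) * ‖Φ ((Complex.I * s) • (V : E) - G V)‖ := by
    rintro V ⟨U, hU, hUV⟩
    have h0 : U 0 ∈ G.domain := by rw [hUV]; exact V.2
    have hV : (⟨U 0, h0⟩ : G.domain) = V := Subtype.ext hUV
    set F := (Complex.I * s) • (V : E) - G V with hF
    -- At this time M/t^α = 1/(2|s|). As |GV| ≤ |s||V| + |F|, decay bounds the seminorm of U(t) by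
    -- half that of V plus a multiple of that of F, and the half is absorbed.
    set t := (2 * M * |s|) ^ (1 / α) with ht
    have ht0 : 0 < t := by positivity
    have h1 := hdec U hU h0 t ht0
    have h2 := hU.seminorm_sub_modulated_le hD h0 s ht0
    rw [hV] at h1 h2
    rw [hUV, ← hF] at h2
    have h3 : ‖Φ (G V)‖ ≤ |s| * ‖Φ V‖ + ‖Φ F‖ := by
      have : G V = (Complex.I * s) • (V : E) - F := by rw [hF]; abel
      rw [this, map_sub, map_smul]
      refine (norm_sub_le _ _).trans ?_
      rw [norm_smul]; simp
    have h4 : t ^ α = 2 * M * |s| := by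
      rw [ht, ← Real.rpow_mul (by positivity), one_div_mul_cancel hα.ne', Real.rpow_one]
    have h5 : ‖Φ V‖ ≤ ‖Φ (U t)‖ + t * ‖Φ F‖ := by
      have h6 : Φ V = Complex.exp (-(Complex.I * s * t)) • Φ (U t)
          - Φ (Complex.exp (-(Complex.I * s * t)) • U t - V) := by
        rw [← map_smul, ← map_sub]; congr 1; abel
      have h7 : ‖Complex.exp (-(Complex.I * s * t))‖ = 1 := by
        rw [Complex.norm_exp]; simp
      rw [h6]
      refine (norm_sub_le _ _).trans ?_
      rw [norm_smul, h7, one_mul]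
      gcongr
    rw [h4] at h1
    have h8 : M / (2 * M * |s|) = 1 / (2 * |s|) := by field_simp
    rw [h8] at h1
    have h9 : 1 / (2 * |s|) * ‖Φ (G V)‖ ≤ 1 / 2 * ‖Φ V‖ + 1 / 2 * ‖Φ F‖ := by
      calc _ ≤ 1 / (2 * |s|) * (|s| * ‖Φ V‖ + ‖Φ F‖) := by gcongr
        _ = 1 / 2 * ‖Φ V‖ + 1 / (2 * |s|) * ‖Φ F‖ := by field_simp
        _ ≤ _ := by
          gcongr
          linarith
    have h10 : ‖Φ V‖ ≤ (1 + 2 * t) * ‖Φ F‖ := by linarith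
    refine h10.trans ?_
    gcongr
    have h11 : 1 ≤ |s| ^ (1 / α) := Real.one_le_rpow hs (by positivity)
    rw [ht, Real.mul_rpow (by positivity) hs0.le, hC]
    linarith
  obtain ⟨n₀, hn₀⟩ := hG.exists_isBoundedInverse
  set F := (Complex.I * s) • (V : E) - G V with hF
  -- Two factors of J = nR bring V into D(G³), where an orbit exists. J² contracts the source, and V
  -- - J²V is at most 2|GV|/n, which vanishes in the limit.
  have happrox : ∀ n : ℕ, n₀ ≤ n → 0 < n →
      ‖Φ V‖ ≤ C * |s| ^ (1 / α) * ‖Φ F‖ + 2 / n * ‖Φ (G V)‖ := by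
    intro n hn hnpos
    obtain ⟨R, hR⟩ := hn₀ n hn
    have hn0 : (0 : ℝ) < n := by exact_mod_cast hnpos
    set J : E →L[ℂ] E := (((n : ℝ) : ℂ)) • R with hJ
    have hJc : CommutesWith J G := (commutesWith_of_isBoundedInverse hR).smul _
    have hJd : ∀ y, J y ∈ G.domain := fun y =>
      G.domain.smul_mem _ ((isBoundedInverse_resolventOp_iff.mp hR).1 y).choose
    obtain ⟨h₀, e₀⟩ := hJc.pow 2 V
    obtain ⟨h₁, e₁⟩ := hJc ⟨J (G V), hJd _⟩
    obtain ⟨h₂, e₂⟩ := hJc V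
    have hx₂ : G ⟨J (J (G V)), h₁⟩ ∈ G.domain := by rw [e₁]; exact hJd _
    have h1 := key ⟨_, h₀⟩ (hG.exists_isOrbit ⟨_, h₀⟩ ⟨J (J (G V)), h₁⟩ ⟨_, hx₂⟩ e₀ rfl)
    rw [e₀] at h1
    have h2 : (Complex.I * s) • (J ^ 2) (V : E) - (J ^ 2) (G V) = (J ^ 2) F := by
      rw [hF, map_sub, map_smul]
    simp only [h2] at h1
    have h3 := seminorm_smul_pow_le hD hn0 hR 2 F
    have h4 := seminorm_sub_smul_pow_le hD hn0 hR V 2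
    have h5 : Φ V = Φ ((J ^ 2) V) + Φ (V - (J ^ 2) V) := by rw [← map_add]; congr 1; abel
    calc ‖Φ V‖ ≤ ‖Φ ((J ^ 2) V)‖ + ‖Φ (V - (J ^ 2) V)‖ := by rw [h5]; exact norm_add_le _ _
      _ ≤ C * |s| ^ (1 / α) * ‖Φ ((J ^ 2) F)‖ + (2 : ℕ) / n * ‖Φ (G V)‖ := add_le_add h1 h4
      _ ≤ C * |s| ^ (1 / α) * ‖Φ F‖ + 2 / n * ‖Φ (G V)‖ := by
        rw [Nat.cast_ofNat]
        exact add_le_add (mul_le_mul_of_nonneg_left h3 (by positivity)) le_rfl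
  have hlim : Tendsto (fun n : ℕ => C * |s| ^ (1 / α) * ‖Φ F‖ + 2 / n * ‖Φ (G V)‖) atTop
      (𝓝 (C * |s| ^ (1 / α) * ‖Φ F‖ + 0 * ‖Φ (G V)‖)) :=
    ((tendsto_const_div_atTop_nhds_zero_nat 2).mul_const _).const_add _
  rw [zero_mul, add_zero] at hlim
  refine ge_of_tendsto hlim ?_
  filter_upwards [eventually_ge_atTop n₀, eventually_gt_atTop 0] with n hn hn'
  exact happrox n hn hn'

end Abstract

/-! ### Self-adjoint unbounded operators. -/

section SelfAdjoint

variable {H : Type*} [NormedAddCommGroup H] [InnerProductSpace ℂ H] [CompleteSpace H]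
  {A : H →ₗ.[ℂ] H}

theorem mem_domain_of_isSelfAdjoint (hA : IsSelfAdjoint A) {y w : H}
    (h : ∀ x : A.domain, inner ℂ w (x : H) = inner ℂ y (A x)) :
    ∃ hy : y ∈ A.domain, A ⟨y, hy⟩ = w := by
  have h1 : y ∈ A.adjoint.domain := A.mem_adjoint_domain_of_exists y ⟨w, h⟩
  have h2 : A.adjoint ⟨y, h1⟩ = w := LinearPMap.adjoint_apply_eq hA.dense_domain ⟨y, h1⟩ h
  have h3 : (y, w) ∈ A.adjoint.graph := (LinearPMap.mem_graph_iff _).mpr ⟨⟨y, h1⟩, rfl, h2⟩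
  rw [LinearPMap.isSelfAdjoint_def.mp hA, LinearPMap.mem_graph_iff] at h3
  obtain ⟨⟨y', hy'⟩, h4, h5⟩ := h3
  subst h4
  exact ⟨hy', h5⟩

theorem inner_apply_eq_of_isSelfAdjoint (hA : IsSelfAdjoint A) (x y : A.domain) :
    inner ℂ (A x) (y : H) = inner ℂ (x : H) (A y) := by
  have h := LinearPMap.adjoint_isFormalAdjoint hA.dense_domain
  rw [LinearPMap.isSelfAdjoint_def.mp hA] at h
  exact h x y

/-- The graph is closed: symmetry against a fixed vector survives the limit, which places the limit
in the domain of the adjoint. -/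
theorem mem_domain_of_tendsto (hA : IsSelfAdjoint A) {x : ℕ → A.domain} {a b : H}
    (ha : Tendsto (fun n => (x n : H)) atTop (𝓝 a)) (hb : Tendsto (fun n => A (x n)) atTop (𝓝 b)) :
    ∃ h : a ∈ A.domain, A ⟨a, h⟩ = b := by
  refine mem_domain_of_isSelfAdjoint hA fun y => ?_
  have h1 : Tendsto (fun n => inner ℂ (A (x n)) (y : H)) atTop (𝓝 (inner ℂ b (y : H))) :=
    hb.inner tendsto_const_nhds
  have h2 : Tendsto (fun n => inner ℂ (x n : H) (A y)) atTop (𝓝 (inner ℂ a (A y))) :=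
    ha.inner tendsto_const_nhds
  simp only [inner_apply_eq_of_isSelfAdjoint hA] at h1
  exact tendsto_nhds_unique h1 h2

/-- A coercive bounded perturbation of a self-adjoint operator is boundedly invertible. -/
theorem exists_inverse_of_coercive (hA : IsSelfAdjoint A) (K : H →L[ℂ] H) {c : ℝ} (hc : 0 < c)
    (h : ∀ u : A.domain, c * ‖(u : H)‖ ^ 2 ≤ (inner ℂ (A u + K u) (u : H)).re) :
    ∃ R : H →L[ℂ] H, (∀ y, ∃ hy : R y ∈ A.domain, A ⟨R y, hy⟩ + K (R y) = y) ∧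
      ∀ x : A.domain, R (A x + K x) = x := by
  set M : A.domain →ₗ[ℂ] H := A.toFun + K.toLinearMap ∘ₗ A.domain.subtype with hM
  have hMx : ∀ x, M x = A x + K x := fun x => rfl
  have hbelow : ∀ x : A.domain, c * ‖(x : H)‖ ≤ ‖M x‖ := by
    intro x
    rcases eq_or_ne (x : H) 0 with h0 | h0
    · rw [h0, norm_zero, mul_zero]; exact norm_nonneg _
    have hpos : 0 < ‖(x : H)‖ := norm_pos_iff.mpr h0
    have h1 : (inner ℂ (M x) (x : H)).re ≤ ‖M x‖ * ‖(x : H)‖ := re_inner_le_norm (𝕜 := ℂ) _ _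
    have h2 := h x
    rw [← hMx] at h2
    refine le_of_mul_le_mul_right ?_ hpos
    linarith
  have hinj : Function.Injective M := by
    rw [← LinearMap.ker_eq_bot, LinearMap.ker_eq_bot']
    intro x hx
    have h1 := hbelow x
    rw [hx, norm_zero] at h1
    exact Subtype.ext (norm_le_zero_iff.mp (by nlinarith [norm_nonneg (x : H)]))
  have hclosed : IsClosed (M.range : Set H) := by
    refine IsSeqClosed.isClosed fun y l hy hl => ?_
    choose x hx using hy
    have hxc : CauchySeq fun n => (x n : H) := by
      rw [Metric.cauchySeq_iff]
      intro ε hε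
      obtain ⟨N, hN⟩ := Metric.cauchySeq_iff.mp hl.cauchySeq (c * ε) (by positivity)
      refine ⟨N, fun m hm n hn => ?_⟩
      have h1 := hN m hm n hn
      have h2 := hbelow (x m - x n)
      rw [map_sub, hx, hx, ← dist_eq_norm] at h2
      rw [dist_eq_norm]
      exact lt_of_mul_lt_mul_left (h2.trans_lt h1) hc.le
    obtain ⟨a, ha⟩ := cauchySeq_tendsto_of_complete hxc
    have hAx : Tendsto (fun n => A (x n)) atTop (𝓝 (l - K a)) := by
      have h3 := hl.sub ((K.continuous.tendsto _).comp ha)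
      refine h3.congr fun n => ?_
      rw [← hx, hMx]; simp
    obtain ⟨h4, h5⟩ := mem_domain_of_tendsto hA ha hAx
    exact ⟨⟨a, h4⟩, by rw [hMx, h5]; simp⟩
  -- A vector y orthogonal to the range lies in D(A* ) = D(A) with Ay = -K*y. Then (Ay + Ky, y) has
  -- zero real part and coercivity forces y = 0.
  have hperp : M.rangeᗮ = ⊥ := by
    rw [Submodule.eq_bot_iff]
    intro y hy
    rw [Submodule.mem_orthogonal'] at hy
    obtain ⟨h1, h2⟩ := mem_domain_of_isSelfAdjoint hA (y := y) (w := -(K.adjoint y)) fun x => by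
      have h3 := hy (M x) ⟨x, rfl⟩
      rw [hMx, inner_add_right] at h3
      rw [inner_neg_left, ContinuousLinearMap.adjoint_inner_left]
      exact (eq_neg_of_add_eq_zero_left h3).symm
    have h3 := h ⟨y, h1⟩
    rw [h2] at h3
    have h4 : (inner ℂ (-(K.adjoint y) + K y) y).re = 0 := by
      rw [inner_add_left, inner_neg_left, ContinuousLinearMap.adjoint_inner_left, Complex.add_re,
        Complex.neg_re]
      have : (inner ℂ y (K y)).re = (inner ℂ (K y) y).re := inner_re_symm (𝕜 := ℂ) _ _
      rw [this]; ring
    have h5 : c * ‖y‖ ^ 2 ≤ 0 := by rw [← h4]; exact h3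
    have h6 : ‖y‖ ^ 2 ≤ 0 := by nlinarith [sq_nonneg ‖y‖]
    exact norm_eq_zero.mp (pow_eq_zero_iff two_ne_zero |>.mp (le_antisymm h6 (sq_nonneg _)))
  have hsurj : Function.Surjective M := by
    rw [← LinearMap.range_eq_top, ← Submodule.topologicalClosure_eq_top_iff.mpr hperp,
      hclosed.submodule_topologicalClosure_eq]
  set e := LinearEquiv.ofBijective M ⟨hinj, hsurj⟩ with he
  have hMe : ∀ y, M (e.symm y) = y := fun y => e.apply_symm_apply y
  refine ⟨LinearMap.mkContinuous (A.domain.subtype ∘ₗ e.symm.toLinearMap) c⁻¹ fun y => ?_,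
    fun y => ⟨(e.symm y).2, hMe y⟩, fun x => ?_⟩
  · have h1 := hbelow (e.symm y)
    rw [hMe] at h1
    rw [inv_mul_eq_div, le_div_iff₀ hc, mul_comm]
    exact h1
  · exact congrArg Subtype.val (e.symm_apply_apply x)

end SelfAdjoint

/-! ### The square root and the compact embedding of its domain. -/

section SquareRoot

variable {H : Type*} [NormedAddCommGroup H] [InnerProductSpace ℂ H] {A S : H →ₗ.[ℂ] H}

/-- `T` is the inverse of `A + 1`. -/
def IsInverseAddOne (A : H →ₗ.[ℂ] H) (T : H →L[ℂ] H) : Prop :=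
  (∀ y, ∃ h : T y ∈ A.domain, A ⟨T y, h⟩ + T y = y) ∧ ∀ x : A.domain, T (A x + x) = x

/-- Applying R(z - A) = 1 to Ty gives the resolvent identity T = R((z + 1)T - 1), so T factors
through the compact R. -/
theorem IsInverseAddOne.isCompactOperator {T : H →L[ℂ] H} (hT : IsInverseAddOne A T)
    (hA : HasCompactResolvent A) : IsCompactOperator T := by
  obtain ⟨z, R, hR, hRc⟩ := hA
  rw [isBoundedInverse_resolventOp_iff] at hR
  have h : (T : H → H) = R ∘ ((z + 1) • T - 1 : H →L[ℂ] H) := by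
    ext y
    obtain ⟨h1, h2⟩ := hT.1 y
    have h3 : R (z • T y - A ⟨T y, h1⟩) = T y := hR.2 ⟨T y, h1⟩
    rw [Function.comp_apply]
    nth_rw 1 [← h3]
    congr 1
    rw [eq_sub_of_add_eq h2]
    change z • T y - (y - T y) = (z + 1) • T y - y
    module
  rw [h]
  exact hRc.comp_clm _

variable [CompleteSpace H]

theorem exists_isInverseAddOne (hA : IsSelfAdjoint A) (hA0 : IsNonneg A) :
    ∃ T, IsInverseAddOne A T :=
  exists_inverse_of_coercive hA (1 : H →L[ℂ] H) one_pos fun u => by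
    have h1 : (inner ℂ (u : H) (u : H)).re = ‖(u : H)‖ ^ 2 := inner_self_eq_norm_sq (𝕜 := ℂ) _
    rw [inner_add_left, Complex.add_re, one_apply_eq_self, h1, one_mul]
    linarith [hA0 u]

theorem IsInverseAddOne.isPositive {T : H →L[ℂ] H} (hT : IsInverseAddOne A T)
    (hA : IsSelfAdjoint A) (hA0 : IsNonneg A) : T.IsPositive := by
  rw [ContinuousLinearMap.isPositive_def]
  refine ⟨fun x y => ?_, fun x => ?_⟩
  · obtain ⟨hx, ex⟩ := hT.1 x
    obtain ⟨hy, ey⟩ := hT.1 y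
    change inner ℂ (T x) y = inner ℂ x (T y)
    nth_rw 1 [← ey]
    nth_rw 2 [← ex]
    rw [inner_add_left, inner_add_right]
    congr 1
    exact (inner_apply_eq_of_isSelfAdjoint hA ⟨T x, hx⟩ ⟨T y, hy⟩).symm
  · obtain ⟨hx, ex⟩ := hT.1 x
    have h1 : (inner ℂ (T x) (T x)).re = ‖T x‖ ^ 2 := inner_self_eq_norm_sq (𝕜 := ℂ) _
    have h2 : (inner ℂ (T x) x).re
        = (inner ℂ (A ⟨T x, hx⟩) (T x)).re + ‖T x‖ ^ 2 := by
      nth_rw 2 [← ex]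
      rw [inner_add_right, Complex.add_re, h1]
      congr 1
      exact inner_re_symm (𝕜 := ℂ) _ _
    change 0 ≤ (inner ℂ (T x) x).re
    rw [h2]
    have := hA0 ⟨T x, hx⟩
    positivity

/-- Since (1 - T)x = ATx and x = ATx + Tx, the form ((1 - T)x, x) has real part ‖ATx‖² plus that of
(ATx, Tx). -/
theorem IsInverseAddOne.isPositive_one_sub {T : H →L[ℂ] H} (hT : IsInverseAddOne A T)
    (hA : IsSelfAdjoint A) (hA0 : IsNonneg A) : (1 - T).IsPositive := by
  rw [ContinuousLinearMap.isPositive_def]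
  refine ⟨(ContinuousLinearMap.isPositive_one.isSymmetric).sub
    (hT.isPositive hA hA0).isSymmetric, fun x => ?_⟩
  obtain ⟨hx, ex⟩ := hT.1 x
  have h1 : (inner ℂ (A ⟨T x, hx⟩) (A ⟨T x, hx⟩)).re = ‖A ⟨T x, hx⟩‖ ^ 2 :=
    inner_self_eq_norm_sq (𝕜 := ℂ) _
  have h2 : (1 - T) x = A ⟨T x, hx⟩ := by
    change x - T x = _
    nth_rw 1 [← ex]; abel
  have h3 : (inner ℂ ((1 - T) x) x).re
      = ‖A ⟨T x, hx⟩‖ ^ 2 + (inner ℂ (A ⟨T x, hx⟩) (T x)).re := by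
    rw [h2, ← h1, ← Complex.add_re, ← inner_add_right, ex]
  change 0 ≤ (inner ℂ ((1 - T) x) x).re
  rw [h3]
  have := hA0 ⟨T x, hx⟩
  positivity

/-- A nonnegative self-adjoint operator has a nonnegative self-adjoint square root. -/
theorem exists_isSqrt (hA : IsSelfAdjoint A) (hA0 : IsNonneg A) : ∃ S, IsSqrt S A := by
  obtain ⟨T, hT⟩ := exists_isInverseAddOne hA hA0
  have hT0 : 0 ≤ T := T.nonneg_iff_isPositive.mpr (hT.isPositive hA hA0)
  have hT1 : 0 ≤ 1 - T := (1 - T).nonneg_iff_isPositive.mpr (hT.isPositive_one_sub hA hA0)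
  -- As A = (1 - T)T⁻¹, the root is built from bounded operators as S = WQ⁻¹, with W the root of 1 -
  -- T and Q that of T. Its graph is the set of pairs (Qa, Wa).
  set Q := CFC.sqrt T with hQ
  set W := CFC.sqrt (1 - T) with hW
  have hQ0 : 0 ≤ Q := CFC.sqrt_nonneg _
  have hW0 : 0 ≤ W := CFC.sqrt_nonneg _
  have hQsym : ∀ x y, inner ℂ (Q x) y = inner ℂ x (Q y) :=
    (Q.nonneg_iff_isPositive.mp hQ0).isSymmetric
  have hWsym : ∀ x y, inner ℂ (W x) y = inner ℂ x (W y) :=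
    (W.nonneg_iff_isPositive.mp hW0).isSymmetric
  have hcomm : Commute Q W := by
    have h1 : Commute T (1 - T) := (Commute.one_right T).sub_right (Commute.refl T)
    exact ((h1.cfcₙ_nnreal NNReal.sqrt).symm.cfcₙ_nnreal NNReal.sqrt).symm
  have hQQ : ∀ x, Q (Q x) = T x := fun x =>
    congrArg (fun L : H →L[ℂ] H => L x) (CFC.sqrt_mul_sqrt_self T hT0)
  have hWW : ∀ x, W (W x) = x - T x := fun x =>
    congrArg (fun L : H →L[ℂ] H => L x) (CFC.sqrt_mul_sqrt_self (1 - T) hT1)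
  have hQW : ∀ x, Q (W x) = W (Q x) := fun x =>
    congrArg (fun L : H →L[ℂ] H => L x) hcomm.eq
  have hQinj' : ∀ x, Q x = 0 → x = 0 := by
    intro x hx
    have h1 : T x = 0 := by rw [← hQQ, hx, map_zero]
    obtain ⟨h2, h3⟩ := hT.1 x
    have h4 : (⟨T x, h2⟩ : A.domain) = 0 := Subtype.ext h1
    rw [h4, h1, LinearPMap.map_zero, add_zero] at h3
    exact h3.symm
  have hQinj : Function.Injective Q.toLinearMap :=
    (injective_iff_map_eq_zero Q.toLinearMap).mpr hQinj'
  let S : H →ₗ.[ℂ] H :=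
    { domain := Q.toLinearMap.range
      toFun := W.toLinearMap ∘ₗ (LinearEquiv.ofInjective Q.toLinearMap hQinj).symm.toLinearMap }
  have hS : ∀ (a : H) (h : Q a ∈ S.domain), S ⟨Q a, h⟩ = W a := fun a h =>
    congrArg W ((LinearEquiv.ofInjective Q.toLinearMap hQinj).symm_apply_apply a)
  have hgraph : ∀ x z, (x, z) ∈ S.graph ↔ ∃ a, Q a = x ∧ W a = z := by
    intro x z
    rw [LinearPMap.mem_graph_iff]
    constructor
    · rintro ⟨⟨x', a, rfl⟩, rfl, rfl⟩
      exact ⟨a, rfl, (hS a _).symm⟩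
    · rintro ⟨a, rfl, rfl⟩
      exact ⟨⟨Q a, a, rfl⟩, rfl, hS a _⟩
  have hdense : Dense (S.domain : Set H) := by
    rw [Submodule.dense_iff_topologicalClosure_eq_top,
      Submodule.topologicalClosure_eq_top_iff, Submodule.eq_bot_iff]
    intro y hy
    rw [Submodule.mem_orthogonal'] at hy
    refine hQinj' y (ext_inner_right ℂ fun x => ?_)
    rw [hQsym, inner_zero_left]
    exact hy _ ⟨x, rfl⟩
  refine ⟨S, ?_, ?_, ?_⟩
  · rw [LinearPMap.isSelfAdjoint_def]
    refine LinearPMap.eq_of_eq_graph ?_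
    rw [LinearPMap.adjoint_graph_eq_graph_adjoint hdense]
    ext ⟨x, z⟩
    rw [Submodule.mem_adjoint_iff, hgraph]
    constructor
    · intro h
      have h1 : W x = Q z := by
        refine ext_inner_left ℂ fun c => ?_
        rw [← hWsym, ← hQsym]
        exact sub_eq_zero.mp (h (Q c) (W c) ((hgraph _ _).mpr ⟨c, rfl, rfl⟩))
      -- Membership in the adjoint graph says Wx = Qz. Then a = Qx + Wz satisfies Qa = x and Wa = z
      -- because Q² + W² = 1.
      refine ⟨Q x + W z, ?_, ?_⟩
      · rw [map_add, hQQ, hQW, ← h1, hWW]; abel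
      · rw [map_add, ← hQW, h1, hQQ, hWW]; abel
    · rintro ⟨b, rfl, rfl⟩ c d hcd
      obtain ⟨a, rfl, rfl⟩ := (hgraph _ _).mp hcd
      rw [hWsym, hQsym, hQW, sub_self]
  · rintro ⟨x, a, rfl⟩
    have h1 : 0 ≤ Q * W := hcomm.mul_nonneg hQ0 hW0
    have h2 := ((Q * W).nonneg_iff_isPositive.mp h1).re_inner_nonneg_left a
    have h3 : Q a ∈ S.domain := ⟨a, rfl⟩
    have h4 : S ⟨Q a, h3⟩ = W a := hS a h3
    change 0 ≤ (inner ℂ (S ⟨Q a, h3⟩) (Q a)).re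
    rw [h4, ← hQsym]
    exact h2
  · intro x z
    simp only [hgraph]
    have hAg : (x, z) ∈ A.graph ↔ T (x + z) = x := by
      rw [LinearPMap.mem_graph_iff]
      constructor
      · rintro ⟨x, rfl, rfl⟩
        rw [add_comm]; exact hT.2 x
      · intro h
        have h1 := hT.1 (x + z)
        rw [h] at h1
        obtain ⟨h2, h3⟩ := h1
        exact ⟨⟨x, h2⟩, rfl, by rw [add_comm x z] at h3; exact add_right_cancel h3⟩
    rw [hAg]
    constructor
    · intro h
      -- Since x = T(x + z) = Q²(x + z), the parameter of x in the graph of S is Q(x + z) and the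
      -- intermediate vector is Sx = WQ(x + z).
      refine ⟨W (Q (x + z)), ⟨Q (x + z), by rw [hQQ, h], rfl⟩, ⟨W (x + z), hQW _, ?_⟩⟩
      rw [hWW, h]; abel
    · rintro ⟨y, ⟨a, rfl, rfl⟩, ⟨b, hb, rfl⟩⟩
      rw [← hQQ, map_add, hQW b, hb, hWW, hQQ]
      congr 1; abel

theorem isSqrt_sqrtOp (hA : IsSelfAdjoint A) (hA0 : IsNonneg A) : IsSqrt (sqrtOp A) A := by
  have h := exists_isSqrt hA hA0
  rw [sqrtOp, dif_pos h]
  exact h.choose_spec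

theorem IsSqrt.apply_apply (hS : IsSqrt S A) (u : A.domain) :
    ∃ (h₁ : (u : H) ∈ S.domain) (h₂ : S ⟨u, h₁⟩ ∈ S.domain), S ⟨_, h₂⟩ = A u := by
  obtain ⟨y, h1, h2⟩ := (hS.2.2 u (A u)).mp (A.mem_graph u)
  rw [LinearPMap.mem_graph_iff] at h1 h2
  obtain ⟨⟨u', hu⟩, h3, h4⟩ := h1
  obtain ⟨⟨v, hv⟩, h5, h6⟩ := h2
  obtain ⟨u, hAu⟩ := u
  obtain rfl : u' = u := h3
  obtain rfl : S ⟨u', hu⟩ = y := h4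
  obtain rfl : v = S ⟨u', hu⟩ := h5
  exact ⟨hu, hv, h6⟩

theorem IsSqrt.mem_domain (hS : IsSqrt S A) (u : S.domain) (h : S u ∈ S.domain) :
    ∃ hu : (u : H) ∈ A.domain, A ⟨u, hu⟩ = S ⟨S u, h⟩ := by
  have h1 := (hS.2.2 u (S ⟨S u, h⟩)).mpr ⟨S u, S.mem_graph u, S.mem_graph ⟨S u, h⟩⟩
  rw [LinearPMap.mem_graph_iff] at h1
  obtain ⟨⟨u', hu⟩, h2, h3⟩ := h1
  obtain ⟨u, hu0⟩ := u
  obtain rfl : u' = u := h2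
  exact ⟨hu, h3⟩

/-- `(A u, v) = (S u, S v)`. -/
theorem IsSqrt.inner_apply (hS : IsSqrt S A) (u : A.domain) (hu : (u : H) ∈ S.domain)
    (v : S.domain) : inner ℂ (A u) (v : H) = inner ℂ (S ⟨u, hu⟩) (S v) := by
  obtain ⟨h₁, h₂, h⟩ := hS.apply_apply u
  rw [← h]
  exact inner_apply_eq_of_isSelfAdjoint hS.1 ⟨S ⟨u, h₁⟩, h₂⟩ v

theorem IsSqrt.re_inner_apply_self (hS : IsSqrt S A) (u : A.domain) (hu : (u : H) ∈ S.domain) :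
    (inner ℂ (A u) (u : H)).re = ‖S ⟨u, hu⟩‖ ^ 2 := by
  rw [hS.inner_apply u hu ⟨u, hu⟩]
  exact inner_self_eq_norm_sq (𝕜 := ℂ) _

/-- An interpolation inequality between the weak quantity ‖Tp‖ and ‖Sp‖. Writing p = (A + 1)Tp gives
(p, p) = (STp, Sp) + (Tp, p), while ‖STp‖² = (ATp, Tp) ≤ ‖p‖‖Tp‖. Hence sequences bounded in the
graph norm that converge after applying T already converge in H. -/
theorem IsSqrt.norm_sq_le (hS : IsSqrt S A) {T : H →L[ℂ] H} (hT : IsInverseAddOne A T)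
    (p : S.domain) :
    ‖(p : H)‖ ^ 2 ≤ ‖(p : H)‖ * ‖T p‖ + ‖S p‖ * √(‖(p : H)‖ * ‖T p‖) := by
  obtain ⟨h1, h2⟩ := hT.1 p
  obtain ⟨h3, h4, h5⟩ := hS.apply_apply ⟨T p, h1⟩
  have h6 : ‖S ⟨T p, h3⟩‖ ≤ √(‖(p : H)‖ * ‖T p‖) := by
    apply Real.le_sqrt_of_sq_le
    rw [← hS.re_inner_apply_self ⟨T p, h1⟩ h3, eq_sub_of_add_eq h2, inner_sub_left, Complex.sub_re]
    have h7 : (inner ℂ (T p) (T p)).re = ‖T p‖ ^ 2 := inner_self_eq_norm_sq (𝕜 := ℂ) _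
    have h8 : (inner ℂ (p : H) (T p)).re ≤ ‖(p : H)‖ * ‖T p‖ := re_inner_le_norm (𝕜 := ℂ) _ _
    simp only
    rw [h7]
    nlinarith [sq_nonneg ‖T p‖]
  have h9 : (inner ℂ (p : H) (p : H)).re = ‖(p : H)‖ ^ 2 := inner_self_eq_norm_sq (𝕜 := ℂ) _
  have h10 : inner ℂ (p : H) (p : H)
      = inner ℂ (S ⟨T p, h3⟩) (S p) + inner ℂ (T p) (p : H) := by
    nth_rw 1 [← h2]
    rw [inner_add_left, hS.inner_apply ⟨T p, h1⟩ h3 p]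
  rw [← h9, h10, Complex.add_re]
  have h11 : (inner ℂ (S ⟨T p, h3⟩) (S p)).re ≤ ‖S ⟨T p, h3⟩‖ * ‖S p‖ :=
    re_inner_le_norm (𝕜 := ℂ) _ _
  have h12 : (inner ℂ (T p) (p : H)).re ≤ ‖T p‖ * ‖(p : H)‖ := re_inner_le_norm (𝕜 := ℂ) _ _
  have h13 := mul_le_mul_of_nonneg_right h6 (norm_nonneg (S p))
  linarith

/-- The domain of the square root of an operator with compact resolvent embeds compactly. -/
theorem IsSqrt.exists_tendsto_subseq (hS : IsSqrt S A) {T : H →L[ℂ] H}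
    (hT : IsInverseAddOne A T) (hTc : IsCompactOperator T) {p : ℕ → S.domain} {C : ℝ}
    (hp : ∀ n, ‖(p n : H)‖ ≤ C) (hSp : ∀ n, ‖S (p n)‖ ≤ C) :
    ∃ φ : ℕ → ℕ, StrictMono φ ∧ ∃ l : H, Tendsto (fun n => (p (φ n) : H)) atTop (𝓝 l) := by
  have hC : 0 ≤ C := (norm_nonneg _).trans (hp 0)
  obtain ⟨K, hK, hKs⟩ := hTc.image_closedBall_subset_compact (𝕜₁ := ℂ) (f := T.toLinearMap) C
  have hmem : ∀ n, T (p n) ∈ K := fun n =>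
    hKs ⟨p n, by simpa using hp n, rfl⟩
  obtain ⟨a, -, φ, hφ, ha⟩ := hK.tendsto_subseq hmem
  refine ⟨φ, hφ, cauchySeq_tendsto_of_complete ?_⟩
  have hg : Tendsto (fun x : ℝ => 2 * C * x + 2 * C * √(2 * C * x)) (𝓝 0) (𝓝 0) := by
    have : Continuous fun x : ℝ => 2 * C * x + 2 * C * √(2 * C * x) := by fun_prop
    simpa using this.tendsto 0
  rw [Metric.cauchySeq_iff]
  intro ε hε
  obtain ⟨δ, hδ, hδ2⟩ := Metric.tendsto_nhds_nhds.mp hg (ε ^ 2) (by positivity)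
  obtain ⟨N, hN⟩ := Metric.cauchySeq_iff.mp ha.cauchySeq δ hδ
  refine ⟨N, fun m hm n hn => ?_⟩
  have h1 := hN m hm n hn
  set d := p (φ m) - p (φ n) with hd
  have h2 : ‖T (d : H)‖ < δ := by
    rw [dist_eq_norm] at h1
    rw [hd, Submodule.coe_sub, map_sub]; exact h1
  have h3 := hδ2 (x := ‖T (d : H)‖) (by rw [dist_zero_right, norm_norm]; exact h2)
  rw [dist_zero_right] at h3
  have h4 : ‖(d : H)‖ ≤ 2 * C := by
    rw [hd, Submodule.coe_sub]
    refine (norm_sub_le _ _).trans ?_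
    linarith [hp (φ m), hp (φ n)]
  have h5 : ‖S d‖ ≤ 2 * C := by
    rw [hd, LinearPMap.map_sub]
    refine (norm_sub_le _ _).trans ?_
    linarith [hSp (φ m), hSp (φ n)]
  have h6 := hS.norm_sq_le hT d
  have h7 : ‖(d : H)‖ ^ 2 < ε ^ 2 := by
    refine lt_of_le_of_lt ?_ ((Real.le_norm_self _).trans_lt h3)
    refine h6.trans ?_
    gcongr
  rw [dist_eq_norm]
  exact lt_of_pow_lt_pow_left₀ 2 hε.le h7

end SquareRoot

/-! ### Bounded inverses and their perturbation. -/

section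

/-- An unbounded operator that is onto and bounded below is boundedly invertible. -/
theorem inverseNormLE_of_surjective {E : Type*} [NormedAddCommGroup E] [NormedSpace ℂ E]
    {T : E →ₗ.[ℂ] E} {M : ℝ} (hM : 0 ≤ M) (hs : ∀ y, ∃ x : T.domain, T x = y)
    (hb : ∀ x : T.domain, ‖(x : E)‖ ≤ M * ‖T x‖) : InverseNormLE T M := by
  have hinj : Function.Injective T.toFun := by
    rw [← LinearMap.ker_eq_bot, LinearMap.ker_eq_bot']
    intro x hx
    have h1 := hb x
    have h2 : T x = 0 := hx
    rw [h2, norm_zero, mul_zero] at h1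
    exact Subtype.ext (norm_le_zero_iff.mp h1)
  set e := LinearEquiv.ofBijective T.toFun ⟨hinj, hs⟩ with he
  have hTe : ∀ y, T (e.symm y) = y := fun y => e.apply_symm_apply y
  have hbound : ∀ y, ‖(T.domain.subtype ∘ₗ e.symm.toLinearMap) y‖ ≤ M * ‖y‖ := fun y => by
    have h1 := hb (e.symm y)
    rw [hTe] at h1
    exact h1
  refine ⟨LinearMap.mkContinuous (T.domain.subtype ∘ₗ e.symm.toLinearMap) M hbound,
    ⟨fun y => ⟨(e.symm y).2, hTe y⟩, fun x => ?_⟩, LinearMap.mkContinuous_norm_le _ hM _⟩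
  exact congrArg Subtype.val (e.symm_apply_apply x)

theorem InverseNormLE.norm_le {E : Type*} [NormedAddCommGroup E] [NormedSpace ℂ E]
    {T : E →ₗ.[ℂ] E} {M : ℝ} (h : InverseNormLE T M) (x : T.domain) :
    ‖(x : E)‖ ≤ M * ‖T x‖ := by
  obtain ⟨R, hR, hRM⟩ := h
  have h1 := R.le_opNorm (T x)
  rw [hR.2 x] at h1
  refine h1.trans ?_
  gcongr

theorem InverseNormLE.surjective {E : Type*} [NormedAddCommGroup E] [NormedSpace ℂ E]
    {T : E →ₗ.[ℂ] E} {M : ℝ} (h : InverseNormLE T M) (y : E) : ∃ x : T.domain, T x = y := by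
  obtain ⟨R, hR, -⟩ := h
  obtain ⟨h1, h2⟩ := hR.1 y
  exact ⟨⟨R y, h1⟩, h2⟩

/-- A resolvent bound persists, up to a factor `2`, under small perturbations of the parameter. -/
theorem InverseNormLE.perturb {E : Type*} [NormedAddCommGroup E] [NormedSpace ℂ E]
    [CompleteSpace E] {T : E →ₗ.[ℂ] E} {M : ℝ} {z w : ℂ} (hM : 0 ≤ M)
    (h : InverseNormLE (resolventOp T z) M) (hzw : ‖w - z‖ * M ≤ 1 / 2) :
    InverseNormLE (resolventOp T w) (2 * M) := by
  have hop : ∀ (ζ : ℂ) (x : T.domain), resolventOp T ζ x = ζ • (x : E) - T x := fun ζ x =>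
    (sub_eq_add_neg _ _).symm
  refine inverseNormLE_of_surjective (by positivity) (fun y => ?_) fun (x : T.domain) => ?_
  · obtain ⟨R, hR, hRM⟩ := h
    -- Neumann series: (w - T)Rv = (1 - (z - w)R)v, and the right-hand factor is invertible.
    have h1 : ‖(z - w) • R‖ < 1 := by
      rw [norm_smul, norm_sub_rev]
      calc _ ≤ ‖w - z‖ * M := by gcongr
        _ < 1 := by linarith
    obtain ⟨u, hu⟩ := isUnit_one_sub_of_norm_lt_one h1
    set v := (↑u⁻¹ : E →L[ℂ] E) y with hv
    have h2 : (1 - (z - w) • R) v = y := by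
      rw [← hu, hv]
      exact congrArg (fun L : E →L[ℂ] E => L y) u.mul_inv
    obtain ⟨h3, h4⟩ := (isBoundedInverse_resolventOp_iff.mp hR).1 v
    refine ⟨⟨R v, h3⟩, ?_⟩
    rw [← h2]
    change resolventOp T w (⟨R v, h3⟩ : T.domain) = v - (z - w) • R v
    rw [hop]
    nth_rw 3 [← h4]
    module
  · have h1 := h.norm_le x
    rw [hop] at h1
    rw [hop]
    have h2 : z • (x : E) - T x = (w • (x : E) - T x) - (w - z) • (x : E) := by module
    rw [h2] at h1
    have h3 : ‖(w • (x : E) - T x) - (w - z) • (x : E)‖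
        ≤ ‖w • (x : E) - T x‖ + ‖w - z‖ * ‖(x : E)‖ := by
      rw [← norm_smul]; exact norm_sub_le _ _
    have h4 := mul_le_mul_of_nonneg_left h3 hM
    have h5 := mul_le_mul_of_nonneg_right hzw (norm_nonneg (x : E))
    nlinarith

end

/-! ### The energy space and its seminorm. -/

section EnergySpace

variable {H Y : Type*} [NormedAddCommGroup H] [InnerProductSpace ℂ H]
  [NormedAddCommGroup Y] [InnerProductSpace ℂ Y]

theorem GraphDomain.norm_sq (S : H →ₗ.[ℂ] H) (u : GraphDomain S) :
    ‖u‖ ^ 2 = ‖(toDomain S u : H)‖ ^ 2 + ‖S (toDomain S u)‖ ^ 2 := by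
  rw [← inner_self_eq_norm_sq (𝕜 := ℂ) u, ← inner_self_eq_norm_sq (𝕜 := ℂ) (toDomain S u : H),
    ← inner_self_eq_norm_sq (𝕜 := ℂ) (S (toDomain S u)), ← map_add]
  rfl

theorem GraphDomain.norm_coe_le (S : H →ₗ.[ℂ] H) (u : GraphDomain S) :
    ‖(toDomain S u : H)‖ ≤ ‖u‖ := by
  refine (sq_le_sq₀ (norm_nonneg _) (norm_nonneg _)).mp ?_
  rw [GraphDomain.norm_sq]
  nlinarith [sq_nonneg ‖S (toDomain S u)‖]

theorem GraphDomain.norm_apply_le (S : H →ₗ.[ℂ] H) (u : GraphDomain S) :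
    ‖S (toDomain S u)‖ ≤ ‖u‖ := by
  refine (sq_le_sq₀ (norm_nonneg _) (norm_nonneg _)).mp ?_
  rw [GraphDomain.norm_sq]
  nlinarith [sq_nonneg ‖(toDomain S u : H)‖]

variable [CompleteSpace H] [CompleteSpace Y] {A : H →ₗ.[ℂ] H} {B : Y →L[ℂ] H}

theorem GraphDomain.completeSpace {S : H →ₗ.[ℂ] H} (hS : IsSelfAdjoint S) :
    CompleteSpace (GraphDomain S) := by
  refine Metric.complete_of_cauchySeq_tendsto fun u hu => ?_
  have h1 : CauchySeq fun n => (toDomain S (u n) : H) := by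
    rw [Metric.cauchySeq_iff] at hu ⊢
    intro ε hε
    obtain ⟨N, hN⟩ := hu ε hε
    refine ⟨N, fun m hm n hn => lt_of_le_of_lt ?_ (hN m hm n hn)⟩
    rw [dist_eq_norm, dist_eq_norm, ← Submodule.coe_sub, ← map_sub]
    exact norm_coe_le S _
  have h2 : CauchySeq fun n => S (toDomain S (u n)) := by
    rw [Metric.cauchySeq_iff] at hu ⊢
    intro ε hε
    obtain ⟨N, hN⟩ := hu ε hε
    refine ⟨N, fun m hm n hn => lt_of_le_of_lt ?_ (hN m hm n hn)⟩
    rw [dist_eq_norm, dist_eq_norm, ← LinearPMap.map_sub, ← map_sub]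
    exact norm_apply_le S _
  obtain ⟨a, ha⟩ := cauchySeq_tendsto_of_complete h1
  obtain ⟨b, hb⟩ := cauchySeq_tendsto_of_complete h2
  obtain ⟨h, rfl⟩ := mem_domain_of_tendsto hS ha hb
  refine ⟨(toDomain S).symm ⟨a, h⟩, ?_⟩
  rw [tendsto_iff_norm_sub_tendsto_zero]
  have h3 : Tendsto (fun n => ‖u n - (toDomain S).symm ⟨a, h⟩‖ ^ 2) atTop (𝓝 0) := by
    simp only [norm_sq, map_sub, LinearEquiv.apply_symm_apply, Submodule.coe_sub,
      LinearPMap.map_sub]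
    have h4 := (tendsto_iff_norm_sub_tendsto_zero.mp ha).pow 2
    have h5 := (tendsto_iff_norm_sub_tendsto_zero.mp hb).pow 2
    simpa using h4.add h5
  have h4 := h3.sqrt
  simpa [Real.sqrt_sq] using h4

theorem completeSpace_energySpace (hS : IsSqrt (sqrtOp A) A) : CompleteSpace (EnergySpace A) := by
  have := GraphDomain.completeSpace hS.1
  infer_instance

theorem norm_energySpace_sq (U : EnergySpace A) :
    ‖U‖ ^ 2 = ‖(position A U : H)‖ ^ 2 + ‖sqrtOp A (position A U)‖ ^ 2 + ‖velocity A U‖ ^ 2 := by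
  rw [WithLp.prod_norm_sq_eq_of_L2, GraphDomain.norm_sq]
  rfl

/-- The map `(u₀, u₁) ↦ (A^{1/2} u₀, u₁)`, whose norm is the energy seminorm. -/
noncomputable def energyMap (A : H →ₗ.[ℂ] H) : EnergySpace A →L[ℂ] WithLp 2 (H × H) :=
  LinearMap.mkContinuous
    ((WithLp.linearEquiv 2 ℂ (H × H)).symm.toLinearMap ∘ₗ
      LinearMap.prod ((sqrtOp A).toFun ∘ₗ position A) (velocity A)) 1 fun U => by
    rw [one_mul]
    refine (sq_le_sq₀ (norm_nonneg _) (norm_nonneg _)).mp ?_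
    rw [norm_energySpace_sq, WithLp.prod_norm_sq_eq_of_L2]
    change ‖sqrtOp A (position A U)‖ ^ 2 + ‖velocity A U‖ ^ 2 ≤ _
    nlinarith [sq_nonneg ‖(position A U : H)‖]

theorem norm_energyMap_le (U : EnergySpace A) : ‖energyMap A U‖ ≤ ‖U‖ := by
  have := (energyMap A).le_of_opNorm_le (LinearMap.mkContinuous_norm_le _ zero_le_one _) U
  rwa [one_mul] at this

theorem norm_energyMap_sq (U : EnergySpace A) :
    ‖energyMap A U‖ ^ 2 = ‖sqrtOp A (position A U)‖ ^ 2 + ‖velocity A U‖ ^ 2 := by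
  rw [WithLp.prod_norm_sq_eq_of_L2]
  rfl

theorem sqrt_seminormSq (U : EnergySpace A) : √(seminormSq A U) = ‖energyMap A U‖ := by
  rw [seminormSq, ← norm_energyMap_sq, Real.sqrt_sq (norm_nonneg _)]

theorem sqrt_energy (U : EnergySpace A) : √(energy A U) = √(1 / 2) * ‖energyMap A U‖ := by
  rw [energy, ← norm_energyMap_sq, Real.sqrt_mul (by norm_num), Real.sqrt_sq (norm_nonneg _)]

theorem norm_velocity_le (U : EnergySpace A) : ‖velocity A U‖ ≤ ‖energyMap A U‖ := by
  refine (sq_le_sq₀ (norm_nonneg _) (norm_nonneg _)).mp ?_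
  rw [norm_energyMap_sq]
  nlinarith [sq_nonneg ‖sqrtOp A (position A U)‖]

theorem norm_sqrtOp_position_le (U : EnergySpace A) :
    ‖sqrtOp A (position A U)‖ ≤ ‖energyMap A U‖ := by
  refine (sq_le_sq₀ (norm_nonneg _) (norm_nonneg _)).mp ?_
  rw [norm_energyMap_sq]
  nlinarith [sq_nonneg ‖velocity A U‖]

theorem norm_position_le (U : EnergySpace A) : ‖(position A U : H)‖ ≤ ‖U‖ := by
  refine (sq_le_sq₀ (norm_nonneg _) (norm_nonneg _)).mp ?_
  rw [norm_energySpace_sq]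
  nlinarith [sq_nonneg ‖velocity A U‖, sq_nonneg ‖sqrtOp A (position A U)‖]

theorem norm_energySpace_le (U : EnergySpace A) :
    ‖U‖ ≤ ‖(position A U : H)‖ + ‖energyMap A U‖ := by
  refine (sq_le_sq₀ (norm_nonneg _) (by positivity)).mp ?_
  have h := norm_energyMap_sq U
  rw [norm_energySpace_sq, add_assoc, ← h]
  nlinarith [mul_nonneg (norm_nonneg (position A U : H)) (norm_nonneg (energyMap A U))]

end EnergySpace

/-! ### The damped wave operator: dissipativity and generation. -/

section WaveOperator

variable {H Y : Type*} [NormedAddCommGroup H] [InnerProductSpace ℂ H] [CompleteSpace H]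
  [NormedAddCommGroup Y] [InnerProductSpace ℂ Y] [CompleteSpace Y]
  {A : H →ₗ.[ℂ] H} {B : Y →L[ℂ] H}

theorem waveSymbol_apply (z : ℂ) (u : A.domain) :
    waveSymbol A B z u = A u + (z ^ 2 • (u : H) + z • B (B.adjoint u)) :=
  add_comm _ _

theorem inner_damping (x y : H) :
    inner ℂ (B (B.adjoint x)) y = inner ℂ (B.adjoint x) (B.adjoint y) :=
  (ContinuousLinearMap.adjoint_inner_right B _ _).symm

theorem inner_damping_right (x y : H) :
    inner ℂ x (B (B.adjoint y)) = inner ℂ (B.adjoint x) (B.adjoint y) :=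
  (ContinuousLinearMap.adjoint_inner_left B _ _).symm

/-- The element `(u₀, u₁)` of the domain of the damped wave operator. -/
theorem exists_mem_waveDomain (hS : IsSqrt (sqrtOp A) A) (u : A.domain) (v : (sqrtOp A).domain) :
    ∃ U : (waveOp A B).domain, (position A U : H) = u ∧ velocity A U = v := by
  obtain ⟨h, -, -⟩ := hS.apply_apply u
  exact ⟨⟨WithLp.toLp 2 ((GraphDomain.toDomain (sqrtOp A)).symm ⟨u, h⟩, (v : H)), u.2, v.2⟩,
    rfl, rfl⟩

/-- The resolvent equation `(z - 𝒜) U = F` in components. -/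
theorem position_resolvent (z : ℂ) (U : (waveOp A B).domain) :
    (position A (z • (U : EnergySpace A) - waveOp A B U) : H)
      = z • (position A U : H) - velocity A U := by
  rw [map_sub, map_smul]
  rfl

theorem velocity_resolvent (z : ℂ) (U : (waveOp A B).domain) :
    velocity A (z • (U : EnergySpace A) - waveOp A B U)
      = A ⟨position A U, U.2.1⟩ + z • velocity A U + B (B.adjoint (velocity A U)) := by
  rw [map_sub, map_smul]
  change z • velocity A (U : EnergySpace A) -
    (- A ⟨position A U, U.2.1⟩ - B (B.adjoint (velocity A U))) = _
  abel

theorem sqrtOp_position_resolvent (z : ℂ) (U : (waveOp A B).domain) :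
    sqrtOp A (position A (z • (U : EnergySpace A) - waveOp A B U))
      = z • sqrtOp A (position A U) - sqrtOp A ⟨velocity A U, U.2.2⟩ := by
  rw [map_sub, map_smul, LinearPMap.map_sub, LinearPMap.map_smul]
  rfl

theorem energySpace_ext {U V : EnergySpace A} (h : (position A U : H) = position A V)
    (h' : velocity A U = velocity A V) : U = V := by
  have h1 : U.fst = V.fst := (GraphDomain.toDomain (sqrtOp A)).injective (Subtype.ext h)
  exact (WithLp.linearEquiv 2 ℂ (GraphDomain (sqrtOp A) × H)).injective (Prod.ext h1 h')

/-- The identity (Au, v) = (A^{1/2}u, A^{1/2}v) makes the real parts of the two undamped terms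
cancel, so only the damping dissipates energy. -/
theorem re_inner_waveOp (hS : IsSqrt (sqrtOp A) A) (U : (waveOp A B).domain) :
    (inner ℂ (energyMap A (waveOp A B U)) (energyMap A U)).re
      = -‖B.adjoint (velocity A U)‖ ^ 2 := by
  have h1 : inner ℂ (energyMap A (waveOp A B U)) (energyMap A U)
      = inner ℂ (sqrtOp A ⟨velocity A U, U.2.2⟩) (sqrtOp A (position A U))
        + inner ℂ (- A ⟨position A U, U.2.1⟩ - B (B.adjoint (velocity A U))) (velocity A U) :=
    WithLp.prod_inner_apply _ _
  have h2 : (inner ℂ (B.adjoint (velocity A U)) (B.adjoint (velocity A U))).re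
      = ‖B.adjoint (velocity A U)‖ ^ 2 := inner_self_eq_norm_sq (𝕜 := ℂ) _
  have h3 := hS.inner_apply ⟨position A U, U.2.1⟩ (position A U).2 ⟨velocity A U, U.2.2⟩
  have h4 : (inner ℂ (sqrtOp A ⟨velocity A U, U.2.2⟩) (sqrtOp A (position A U))).re
      = (inner ℂ (sqrtOp A (position A U)) (sqrtOp A ⟨velocity A U, U.2.2⟩)).re :=
    inner_re_symm (𝕜 := ℂ) _ _
  have h5 := congrArg Complex.re h3
  rw [h1, inner_sub_left, inner_neg_left, inner_damping, Complex.add_re, Complex.sub_re,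
    Complex.neg_re, h2, h4]
  simp only [Subtype.coe_eta] at h5
  rw [h5]
  ring

theorem isDissipative_waveOp (hS : IsSqrt (sqrtOp A) A) :
    IsDissipative (waveOp A B) (energyMap A) := fun U => by
  rw [re_inner_waveOp hS]
  nlinarith [sq_nonneg ‖B.adjoint (velocity A U)‖]

/-- `z - 𝒜` is onto as soon as `P(z)` is. -/
theorem surjective_resolventOp_waveOp (hS : IsSqrt (sqrtOp A) A) {z : ℂ}
    (hz : ∀ y, ∃ u : A.domain, waveSymbol A B z u = y) (F : EnergySpace A) :
    ∃ U : (waveOp A B).domain, z • (U : EnergySpace A) - waveOp A B U = F := by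
  obtain ⟨u, hu⟩ := hz (velocity A F + z • (position A F : H) + B (B.adjoint (position A F)))
  obtain ⟨hu', -, -⟩ := hS.apply_apply u
  obtain ⟨U, hU0, hU1⟩ := exists_mem_waveDomain (B := B) hS u
    (z • ⟨u, hu'⟩ - position A F)
  refine ⟨U, energySpace_ext ?_ ?_⟩
  · rw [position_resolvent, hU0, hU1, Submodule.coe_sub, Submodule.coe_smul]
    abel
  · have h1 : (⟨position A U, U.2.1⟩ : A.domain) = u := Subtype.ext hU0
    rw [velocity_resolvent, h1, hU1, Submodule.coe_sub, Submodule.coe_smul]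
    rw [waveSymbol_apply] at hu
    rw [eq_sub_of_add_eq hu]
    simp only [map_sub, map_smul]
    module

/-- The energy norm is controlled by the energy seminorm in the resolvent equation. -/
theorem norm_le_of_resolvent {z : ℂ} (hz : z ≠ 0) (U : (waveOp A B).domain) :
    ‖(U : EnergySpace A)‖ ≤ ‖energyMap A U‖ + (‖energyMap A U‖ +
      ‖z • (U : EnergySpace A) - waveOp A B U‖) / ‖z‖ := by
  have hz0 : 0 < ‖z‖ := norm_pos_iff.mpr hz
  have h1 := position_resolvent z U
  have h2 : ‖z‖ * ‖(position A U : H)‖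
      ≤ ‖energyMap A U‖ + ‖z • (U : EnergySpace A) - waveOp A B U‖ := by
    rw [← norm_smul, ← add_sub_cancel (velocity A (U : EnergySpace A)) (z • (position A U : H)),
      ← h1]
    exact (norm_add_le _ _).trans (add_le_add (norm_velocity_le _) (norm_position_le _))
  have h3 : ‖(position A U : H)‖ ≤ (‖energyMap A U‖ +
      ‖z • (U : EnergySpace A) - waveOp A B U‖) / ‖z‖ := by
    rw [le_div_iff₀ hz0]; linarith
  linarith [norm_energySpace_le (U : EnergySpace A)]

/-- For r > 0 the terms A and rBB* are nonnegative, so P(r) is coercive with constant r². -/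
theorem surjective_waveSymbol_of_pos (hA : IsSelfAdjoint A) (hA0 : IsNonneg A) {r : ℝ}
    (hr : 0 < r) (y : H) : ∃ u : A.domain, waveSymbol A B r u = y := by
  obtain ⟨R, hR, -⟩ := exists_inverse_of_coercive hA
    ((r : ℂ) ^ 2 • ContinuousLinearMap.id ℂ H + (r : ℂ) • (B ∘L B.adjoint))
    (c := r ^ 2) (by positivity) fun u => by
      have h1 : (inner ℂ (u : H) (u : H)).re = ‖(u : H)‖ ^ 2 := inner_self_eq_norm_sq (𝕜 := ℂ) _
      have h2 : (inner ℂ (B.adjoint (u : H)) (B.adjoint (u : H))).re = ‖B.adjoint (u : H)‖ ^ 2 :=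
        inner_self_eq_norm_sq (𝕜 := ℂ) _
      have h3 : (inner ℂ (A u + ((r : ℂ) ^ 2 • (u : H) + (r : ℂ) • B (B.adjoint (u : H))))
          (u : H)).re = (inner ℂ (A u) (u : H)).re + r ^ 2 * ‖(u : H)‖ ^ 2
            + r * ‖B.adjoint (u : H)‖ ^ 2 := by
        rw [inner_add_left, inner_add_left, inner_smul_left, inner_smul_left, inner_damping,
          ← Complex.ofReal_pow, Complex.conj_ofReal, Complex.conj_ofReal, Complex.add_re,
          Complex.add_re, Complex.re_ofReal_mul, Complex.re_ofReal_mul, h1, h2]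
        ring
      have h4 := hA0 u
      change _ ≤ (inner ℂ (A u + ((r : ℂ) ^ 2 • (u : H) + (r : ℂ) • B (B.adjoint (u : H))))
        (u : H)).re
      rw [h3]
      have : 0 ≤ r * ‖B.adjoint (u : H)‖ ^ 2 := by positivity
      linarith
  obtain ⟨h, h'⟩ := hR y
  exact ⟨⟨R y, h⟩, (waveSymbol_apply _ _).trans h'⟩

theorem resolventOp_apply {E : Type*} [AddCommGroup E] [Module ℂ E] (T : E →ₗ.[ℂ] E) (z : ℂ)
    (x : T.domain) : resolventOp T z x = z • (x : E) - T x :=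
  (sub_eq_add_neg _ _).symm

/-- Every r > 0 is covered, whereas `hilleYosida_waveOp` reaches only r > 1. The bound goes through
the seminorm and recovers the full norm afterwards; its size is irrelevant. -/
theorem exists_isBoundedInverse_waveOp (hA : IsSelfAdjoint A) (hA0 : IsNonneg A)
    (hS : IsSqrt (sqrtOp A) A) {r : ℝ} (hr : 0 < r) :
    ∃ R, IsBoundedInverse (resolventOp (waveOp A B) r) R := by
  have h : InverseNormLE (resolventOp (waveOp A B) r) (1 / r + (1 / r + 1) / r) := by
    refine inverseNormLE_of_surjective (by positivity) (fun F => ?_)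
      fun (U : (waveOp A B).domain) => ?_
    · obtain ⟨U, hU⟩ := surjective_resolventOp_waveOp hS
        (surjective_waveSymbol_of_pos (B := B) hA hA0 hr) F
      exact ⟨U, (resolventOp_apply _ _ _).trans hU⟩
    · have h1 := (isDissipative_waveOp (B := B) hS).mul_norm_le (r := r) U
      have h2 := norm_le_of_resolvent (z := (r : ℂ)) (by exact_mod_cast hr.ne') U
      rw [resolventOp_apply]
      rw [Complex.norm_real, Real.norm_of_nonneg hr.le] at h2
      set F := (r : ℂ) • (U : EnergySpace A) - waveOp A B U
      have h3 := h1.trans (norm_energyMap_le F)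
      have h4 : ‖energyMap A U‖ ≤ 1 / r * ‖F‖ := by
        rw [one_div, inv_mul_eq_div, le_div_iff₀ hr]; linarith
      calc _ ≤ 1 / r * ‖F‖ + (1 / r * ‖F‖ + ‖F‖) / r := h2.trans (by gcongr)
        _ = _ := by ring
  obtain ⟨R, hR, -⟩ := h
  exact ⟨R, hR⟩

/-- In the full norm dissipativity fails only by the term Re(u₁, u₀), which is at most ‖U‖². Hence
growth bound 1. -/
theorem hilleYosida_waveOp (hA : IsSelfAdjoint A) (hA0 : IsNonneg A)
    (hS : IsSqrt (sqrtOp A) A) : HilleYosida (waveOp A B) := by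
  refine ⟨1, zero_le_one, fun r hr => ?_⟩
  refine inverseNormLE_of_surjective (by rw [one_div, inv_nonneg]; linarith) (fun F => ?_)
    fun (U : (waveOp A B).domain) => ?_
  · obtain ⟨U, hU⟩ := surjective_resolventOp_waveOp hS
      (surjective_waveSymbol_of_pos (B := B) hA hA0 (by linarith : 0 < r)) F
    exact ⟨U, (resolventOp_apply _ _ _).trans hU⟩
  · rw [resolventOp_apply, one_div, inv_mul_eq_div, le_div_iff₀ (by linarith)]
    set F := (r : ℂ) • (U : EnergySpace A) - waveOp A B U with hF
    rcases eq_or_ne (‖(U : EnergySpace A)‖) 0 with h0 | h0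
    · rw [h0, zero_mul]; exact norm_nonneg _
    have hpos : 0 < ‖(U : EnergySpace A)‖ := lt_of_le_of_ne (norm_nonneg _) (Ne.symm h0)
    refine le_of_mul_le_mul_right ?_ hpos
    have h1 : inner ℂ F (U : EnergySpace A)
        = inner ℂ (position A F : H) (position A U : H)
          + inner ℂ (energyMap A F) (energyMap A U) := by
      have h2 : inner ℂ F (U : EnergySpace A)
          = (inner ℂ (position A F : H) (position A U : H)
            + inner ℂ (sqrtOp A (position A F)) (sqrtOp A (position A U)))
            + inner ℂ (velocity A F) (velocity A U) := WithLp.prod_inner_apply _ _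
      have h3 : inner ℂ (energyMap A F) (energyMap A U)
          = inner ℂ (sqrtOp A (position A F)) (sqrtOp A (position A U))
            + inner ℂ (velocity A F) (velocity A U) := WithLp.prod_inner_apply _ _
      rw [h2, h3]; ring
    have h4 : (inner ℂ F (U : EnergySpace A)).re ≤ ‖F‖ * ‖(U : EnergySpace A)‖ :=
      re_inner_le_norm (𝕜 := ℂ) F (U : EnergySpace A)
    have h5 : (inner ℂ (position A F : H) (position A U : H)).re
        = r * ‖(position A U : H)‖ ^ 2 - (inner ℂ (velocity A U) (position A U : H)).re := by
      have h6 : (inner ℂ (position A U : H) (position A U : H)).re = ‖(position A U : H)‖ ^ 2 :=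
        inner_self_eq_norm_sq (𝕜 := ℂ) _
      rw [hF, position_resolvent, inner_sub_left, inner_smul_left, Complex.conj_ofReal,
        Complex.sub_re, Complex.re_ofReal_mul, h6]
    have h7 : (inner ℂ (energyMap A F) (energyMap A U)).re
        = r * ‖energyMap A U‖ ^ 2 - (inner ℂ (energyMap A (waveOp A B U)) (energyMap A U)).re := by
      have h6 : (inner ℂ (energyMap A U) (energyMap A U)).re = ‖energyMap A U‖ ^ 2 :=
        inner_self_eq_norm_sq (𝕜 := ℂ) (energyMap A (U : EnergySpace A))
      rw [hF, map_sub, map_smul, inner_sub_left, inner_smul_left, Complex.conj_ofReal,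
        Complex.sub_re, Complex.re_ofReal_mul, h6]
    have h8 : (inner ℂ (velocity A U) (position A U : H)).re
        ≤ ‖velocity A U‖ * ‖(position A U : H)‖ := re_inner_le_norm (𝕜 := ℂ) _ _
    have h9 := isDissipative_waveOp (B := B) hS U
    have h10 : ‖(U : EnergySpace A)‖ ^ 2 = ‖(position A U : H)‖ ^ 2 + ‖energyMap A U‖ ^ 2 := by
      rw [norm_energySpace_sq, norm_energyMap_sq]; ring
    have h11 := norm_velocity_le (U : EnergySpace A)
    have h12 : ‖velocity A U‖ * ‖(position A U : H)‖ ≤ ‖(U : EnergySpace A)‖ ^ 2 := by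
      rw [h10]
      nlinarith [sq_nonneg (‖energyMap A U‖ - ‖(position A U : H)‖),
        mul_le_mul_of_nonneg_right h11 (norm_nonneg (position A U : H)),
        sq_nonneg ‖energyMap A U‖, sq_nonneg ‖(position A U : H)‖]
    rw [h1, Complex.add_re, h5, h7] at h4
    nlinarith

end WaveOperator

/-! ### The operator P(is) and its link with the resolvent. -/

section WaveOperator

variable {H Y : Type*} [NormedAddCommGroup H] [InnerProductSpace ℂ H] [CompleteSpace H]
  [NormedAddCommGroup Y] [InnerProductSpace ℂ Y] [CompleteSpace Y]
  {A : H →ₗ.[ℂ] H} {B : Y →L[ℂ] H}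

/-- `B*` does not vanish on the eigenvectors of `A`. -/
def UniqueContinuation (A : H →ₗ.[ℂ] H) (B : Y →L[ℂ] H) : Prop :=
  ∀ (μ : ℂ) (φ : A.domain), (φ : H) ≠ 0 → A φ = μ • (φ : H) → B.adjoint (φ : H) ≠ 0

theorem inner_waveSymbol_I_mul (s : ℝ) (u : A.domain) :
    inner ℂ (waveSymbol A B (Complex.I * s) u) (u : H)
      = inner ℂ (A u) (u : H) - (s ^ 2 * ‖(u : H)‖ ^ 2 : ℝ)
        - Complex.I * (s * ‖B.adjoint (u : H)‖ ^ 2 : ℝ) := by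
  have h1 : inner ℂ (u : H) (u : H) = ((‖(u : H)‖ ^ 2 : ℝ) : ℂ) := by
    rw [inner_self_eq_norm_sq_to_K]; simp
  have h2 : inner ℂ (B.adjoint (u : H)) (B.adjoint (u : H))
      = ((‖B.adjoint (u : H)‖ ^ 2 : ℝ) : ℂ) := by
    rw [inner_self_eq_norm_sq_to_K]; simp
  rw [waveSymbol_apply, inner_add_left, inner_add_left, inner_smul_left, inner_smul_left,
    inner_damping, h1, h2, mul_pow, Complex.I_sq]
  simp only [map_mul, map_neg, map_one, map_pow, Complex.conj_I, Complex.conj_ofReal]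
  push_cast
  ring

theorem im_inner_waveSymbol (hA : IsSelfAdjoint A) (s : ℝ) (u : A.domain) :
    (inner ℂ (waveSymbol A B (Complex.I * s) u) (u : H)).im
      = -(s * ‖B.adjoint (u : H)‖ ^ 2) := by
  have h1 : (inner ℂ (A u) (u : H)).im = 0 := by
    rw [← Complex.conj_eq_iff_im, inner_conj_symm]
    exact (inner_apply_eq_of_isSelfAdjoint hA u u).symm
  rw [inner_waveSymbol_I_mul, Complex.sub_im, Complex.sub_im, h1, Complex.ofReal_im,
    Complex.I_mul_im, Complex.ofReal_re]
  ring

/-- A and s² contribute only to the real part of (P(is)u, u), so its imaginary part isolates the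
damping. -/
theorem abs_mul_norm_adjoint_sq_le (hA : IsSelfAdjoint A) (s : ℝ) (u : A.domain) :
    |s| * ‖B.adjoint (u : H)‖ ^ 2 ≤ ‖waveSymbol A B (Complex.I * s) u‖ * ‖(u : H)‖ := by
  have h1 := Complex.abs_im_le_norm (inner ℂ (waveSymbol A B (Complex.I * s) u) (u : H))
  rw [im_inner_waveSymbol hA, abs_neg, abs_mul, abs_of_nonneg (sq_nonneg ‖_‖)] at h1
  exact h1.trans (norm_inner_le_norm _ _)

theorem norm_sqrtOp_sq_le (hS : IsSqrt (sqrtOp A) A) (s : ℝ) (u : A.domain)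
    (hu : (u : H) ∈ (sqrtOp A).domain) :
    ‖sqrtOp A ⟨u, hu⟩‖ ^ 2
      ≤ ‖waveSymbol A B (Complex.I * s) u‖ * ‖(u : H)‖ + s ^ 2 * ‖(u : H)‖ ^ 2 := by
  have h1 := Complex.re_le_norm (inner ℂ (waveSymbol A B (Complex.I * s) u) (u : H))
  have h2 := h1.trans (norm_inner_le_norm _ _)
  rw [inner_waveSymbol_I_mul, Complex.sub_re, Complex.sub_re, Complex.ofReal_re,
    Complex.I_mul_re, Complex.ofReal_im, hS.re_inner_apply_self u hu] at h2
  linarith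

/-- By the Fredholm alternative, `P(is)` is onto for every real `s ≠ 0`. -/
theorem surjective_waveSymbol (hA : IsSelfAdjoint A) (hA0 : IsNonneg A)
    (hAc : HasCompactResolvent A) (hB : UniqueContinuation A B) {s : ℝ} (hs : s ≠ 0) (y : H) :
    ∃ u : A.domain, waveSymbol A B (Complex.I * s) u = y := by
  obtain ⟨T, hT⟩ := exists_isInverseAddOne hA hA0
  set z : ℂ := Complex.I * s with hz
  -- Chosen so that P(z)T = 1 + KT, a compact perturbation of the identity; P(z) is onto unless -1
  -- is an eigenvalue of KT.
  set K : H →L[ℂ] H := (z ^ 2 - 1) • ContinuousLinearMap.id ℂ H + z • (B ∘L B.adjoint) with hK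
  have hKx : ∀ x, K x = (z ^ 2 - 1) • x + z • B (B.adjoint x) := fun x => rfl
  have hc : IsCompactOperator (K * T) := (hT.isCompactOperator hAc).clm_comp K
  have hP : ∀ x, ∃ u : A.domain, (u : H) = T x ∧ waveSymbol A B z u = x + (K * T) x := by
    intro x
    obtain ⟨h1, h2⟩ := hT.1 x
    refine ⟨⟨T x, h1⟩, rfl, ?_⟩
    rw [waveSymbol_apply, mul_apply_eq_comp, hKx]
    have h3 : A ⟨T x, h1⟩ = x - T x := eq_sub_of_add_eq h2
    rw [h3]
    module
  rcases hc.hasEigenvalue_or_mem_resolventSet (μ := (-1 : ℂ)) (by norm_num) with h | h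
  · exfalso
    obtain ⟨x, hx⟩ := h.exists_hasEigenvector
    have hx1 : (K * T) x = (-1 : ℂ) • x := hx.apply_eq_smul
    obtain ⟨u, hu, hPu⟩ := hP x
    rw [hx1, neg_one_smul, add_neg_cancel] at hPu
    have h1 := im_inner_waveSymbol (B := B) hA s u
    rw [← hz, hPu, inner_zero_left, Complex.zero_im] at h1
    have h2 : B.adjoint (u : H) = 0 := by
      have h3 : ‖B.adjoint (u : H)‖ ^ 2 = 0 := by
        rcases mul_eq_zero.mp (neg_eq_zero.mp h1.symm) with h | h
        · exact absurd h hs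
        · exact h
      exact norm_eq_zero.mp (pow_eq_zero_iff two_ne_zero |>.mp h3)
    -- A kernel vector of P(is) sees no damping, hence satisfies Au = s²u and is excluded by
    -- hypothesis unless it is zero.
    rw [waveSymbol_apply, h2, map_zero, smul_zero, add_zero] at hPu
    by_cases hu0 : (u : H) = 0
    · apply hx.2
      have h4 : T x = 0 := by rw [← hu, hu0]
      have h5 : x = -((K * T) x) := by rw [hx1]; simp
      rw [h5, mul_apply_eq_comp, h4, map_zero, neg_zero]
    · refine hB (-z ^ 2) u hu0 ?_ h2
      rw [neg_smul]
      exact eq_neg_of_add_eq_zero_left hPu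
  · obtain ⟨v, hv⟩ := spectrum.mem_resolventSet_iff.mp h
    obtain ⟨u, -, hu⟩ := hP (-((↑v⁻¹ : H →L[ℂ] H) y))
    refine ⟨u, hu.trans ?_⟩
    have h1 : (↑v : H →L[ℂ] H) ((↑v⁻¹ : H →L[ℂ] H) y) = y :=
      congrArg (fun L : H →L[ℂ] H => L y) v.mul_inv
    rw [hv] at h1
    generalize (↑v⁻¹ : H →L[ℂ] H) y = x at h1
    have h2 : (-1 : ℂ) • x - (K * T) x = y := h1
    rw [← h2, map_neg, neg_one_smul, sub_eq_add_neg]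

/-- The resolvent estimate in the energy seminorm that follows from a bound on `P(-is)⁻¹`. -/
theorem seminorm_le_of_waveSymbol (hS : IsSqrt (sqrtOp A) A) {s k : ℝ} (hs : 1 ≤ |s|)
    (hk : 0 ≤ k) (hQ : InverseNormLE (waveSymbol A B (Complex.I * (-s : ℝ))) k)
    (U : (waveOp A B).domain) :
    ‖energyMap A U‖ ≤ (6 + 2 * ‖B ∘L B.adjoint‖) * (2 * (k * |s| + 1)) *
      ‖energyMap A ((Complex.I * s) • (U : EnergySpace A) - waveOp A B U)‖ := by
  set z : ℂ := Complex.I * s with hz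
  have hzn : ‖z‖ = |s| := by rw [hz, norm_mul]; simp
  set F := z • (U : EnergySpace A) - waveOp A B U with hF
  set f := ‖energyMap A F‖ with hf
  set q := velocity A (U : EnergySpace A) with hq
  set p := sqrtOp A (position A (U : EnergySpace A)) with hp
  set b := velocity A F with hb
  set a := sqrtOp A (position A F) with ha
  have hbf : ‖b‖ ≤ f := norm_velocity_le F
  have haf : ‖a‖ ≤ f := norm_sqrtOp_position_le F
  have hf0 : 0 ≤ f := norm_nonneg _
  have hq1 : q ∈ (sqrtOp A).domain := U.2.2
  have hu : ((position A (U : EnergySpace A) : H)) ∈ A.domain := U.2.1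
  set Au := A ⟨_, hu⟩ with hAu
  have eb : b = Au + z • q + B (B.adjoint q) := velocity_resolvent z U
  have ea : a = z • p - sqrtOp A ⟨q, hq1⟩ := sqrtOp_position_resolvent z U
  set m := k * |s| with hm
  have hm0 : 0 ≤ m := by positivity
  have hkm : k ≤ m := le_mul_of_one_le_right hk hs
  have hqle : ‖q‖ ≤ 2 * (m + 1) * f := by
    rcases eq_or_ne (‖q‖) 0 with h0 | h0
    · rw [h0]; positivity
    have hq0 : 0 < ‖q‖ := lt_of_le_of_ne (norm_nonneg _) (Ne.symm h0)
    -- Duality: P(-is) is the formal adjoint of P(is), so pairing the equations with w expresses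
    -- ‖q‖² through the components a and b alone. Solving instead for the position would bring in
    -- the H-norm of the position of F, which the seminorm does not control.
    obtain ⟨w, hw⟩ := hQ.surjective q
    have hwk := hQ.norm_le w
    rw [hw] at hwk
    change A.domain at w
    obtain ⟨hwS, -, -⟩ := hS.apply_apply w
    have hSw : ‖sqrtOp A ⟨w, hwS⟩‖ ≤ (m + 1) * ‖q‖ := by
      refine (sq_le_sq₀ (norm_nonneg _) (by positivity)).mp ?_
      have h1 := norm_sqrtOp_sq_le (B := B) hS (-s) w hwS
      rw [hw] at h1
      refine h1.trans ?_
      have h2 : (-s) ^ 2 * ‖(w : H)‖ ^ 2 ≤ (m * ‖q‖) ^ 2 := by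
        rw [neg_sq, ← sq_abs s, ← mul_pow]
        refine pow_le_pow_left₀ (by positivity) ?_ 2
        calc |s| * ‖(w : H)‖ ≤ |s| * (k * ‖q‖) := by gcongr
          _ = m * ‖q‖ := by rw [hm]; ring
      have h3 : ‖q‖ * ‖(w : H)‖ ≤ m * ‖q‖ ^ 2 := by
        calc ‖q‖ * ‖(w : H)‖ ≤ ‖q‖ * (m * ‖q‖) := by
              gcongr; exact hwk.trans (by gcongr)
          _ = _ := by ring
      nlinarith [sq_nonneg ‖q‖, mul_nonneg hm0 (sq_nonneg ‖q‖)]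
    have hzc : (starRingEnd ℂ) z = -z := by
      rw [hz, map_mul, Complex.conj_I, Complex.conj_ofReal]; ring
    have hid : inner ℂ q q = (starRingEnd ℂ) z * inner ℂ b (w : H)
        - inner ℂ a (sqrtOp A ⟨w, hwS⟩) := by
      have h1 : inner ℂ q q = inner ℂ q (A w) + (z ^ 2 * inner ℂ q (w : H)
          - z * inner ℂ (B.adjoint q) (B.adjoint (w : H))) := by
        nth_rw 2 [← hw]
        rw [waveSymbol_apply, inner_add_right, inner_add_right, inner_smul_right,
          inner_smul_right, inner_damping_right, hz]
        push_cast
        ring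
      have h2 : inner ℂ q (A w) = inner ℂ (sqrtOp A ⟨q, hq1⟩) (sqrtOp A ⟨w, hwS⟩) := by
        rw [← inner_conj_symm, hS.inner_apply w hwS ⟨q, hq1⟩, inner_conj_symm]
      have h3 : sqrtOp A ⟨q, hq1⟩ = z • p - a := by rw [ea]; abel
      have h4 : inner ℂ p (sqrtOp A ⟨w, hwS⟩) = inner ℂ Au (w : H) :=
        (hS.inner_apply ⟨_, hu⟩ (position A (U : EnergySpace A)).2 ⟨w, hwS⟩).symm
      rw [h1, h2, h3, inner_sub_left, inner_smul_left, h4, eb, inner_add_left, inner_add_left,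
        inner_smul_left, inner_damping, hzc]
      ring
    have h5 : ‖q‖ ^ 2 ≤ |s| * (‖b‖ * ‖(w : H)‖) + ‖a‖ * ‖sqrtOp A ⟨w, hwS⟩‖ := by
      have h6 : ‖q‖ ^ 2 = ‖inner ℂ q q‖ := by
        rw [inner_self_eq_norm_sq_to_K]; simp
      rw [h6, hid]
      refine (norm_sub_le _ _).trans (add_le_add ?_ (norm_inner_le_norm _ _))
      rw [norm_mul, RCLike.norm_conj, hzn]
      gcongr
      exact norm_inner_le_norm _ _
    have h7 : ‖q‖ * ‖q‖ ≤ (2 * (m + 1) * f) * ‖q‖ := by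
      calc ‖q‖ * ‖q‖ = ‖q‖ ^ 2 := by ring
        _ ≤ |s| * (f * (k * ‖q‖)) + f * ((m + 1) * ‖q‖) := h5.trans (by gcongr)
        _ = (m + (m + 1)) * f * ‖q‖ := by rw [hm]; ring
        _ ≤ (2 * (m + 1)) * f * ‖q‖ := by gcongr; linarith
    exact le_of_mul_le_mul_right h7 hq0
  set g := 2 * (m + 1) * f with hg
  have hfg : f ≤ g := by rw [hg]; nlinarith
  set β := ‖B ∘L B.adjoint‖ with hβ
  have hβ0 : 0 ≤ β := norm_nonneg _
  have hple : ‖p‖ ^ 2 ≤ f * ‖p‖ + (2 + β) * g ^ 2 := by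
    -- With q bounded, pairing the first equation with p and replacing (A^{1/2}q, p) by (q, Au₀)
    -- turns ‖p‖² into quantities already estimated; the second equation supplies Au₀.
    have hid : z * inner ℂ p p = - inner ℂ a p - inner ℂ q (b - z • q - B (B.adjoint q)) := by
      have h1 : inner ℂ q Au = inner ℂ (sqrtOp A ⟨q, hq1⟩) p := by
        rw [← inner_conj_symm,
          hS.inner_apply ⟨_, hu⟩ (position A (U : EnergySpace A)).2 ⟨q, hq1⟩, inner_conj_symm]
      have h2 : b - z • q - B (B.adjoint q) = Au := by rw [eb]; abel
      have hzc : (starRingEnd ℂ) z = -z := by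
        rw [hz, map_mul, Complex.conj_I, Complex.conj_ofReal]; ring
      have h3 : inner ℂ a p = -z * inner ℂ p p - inner ℂ (sqrtOp A ⟨q, hq1⟩) p := by
        rw [ea, inner_sub_left, inner_smul_left, hzc]
      rw [h2, h1, h3]
      ring
    have h1 : |s| * ‖p‖ ^ 2 ≤ ‖a‖ * ‖p‖ + ‖q‖ * (‖b‖ + |s| * ‖q‖ + β * ‖q‖) := by
      have h2 : |s| * ‖p‖ ^ 2 = ‖z * inner ℂ p p‖ := by
        rw [norm_mul, hzn, inner_self_eq_norm_sq_to_K]; simp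
      rw [h2, hid]
      refine (norm_sub_le _ _).trans (add_le_add ?_ ?_)
      · rw [norm_neg]; exact norm_inner_le_norm _ _
      · refine (norm_inner_le_norm _ _).trans ?_
        gcongr
        refine (norm_sub_le _ _).trans (add_le_add ((norm_sub_le _ _).trans ?_) ?_)
        · rw [norm_smul, hzn]
        · exact (B ∘L B.adjoint).le_opNorm q
    have hs0 : 0 < |s| := by linarith
    have h3 : |s| * ‖p‖ ^ 2 ≤ |s| * (f * ‖p‖ + (2 + β) * g ^ 2) := by
      have h4 : ‖a‖ * ‖p‖ ≤ |s| * (f * ‖p‖) := by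
        calc ‖a‖ * ‖p‖ ≤ 1 * (f * ‖p‖) := by rw [one_mul]; gcongr
          _ ≤ _ := by gcongr
      have h5 : ‖q‖ * (‖b‖ + |s| * ‖q‖ + β * ‖q‖) ≤ |s| * ((2 + β) * g ^ 2) := by
        calc ‖q‖ * (‖b‖ + |s| * ‖q‖ + β * ‖q‖) ≤ g * (|s| * g + |s| * g + |s| * β * g) := by
              gcongr
              · calc ‖b‖ ≤ 1 * g := by rw [one_mul]; exact hbf.trans hfg
                  _ ≤ |s| * g := by gcongr
              · exact le_mul_of_one_le_left hβ0 hs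
          _ = _ := by ring
      linarith
    exact le_of_mul_le_mul_left h3 hs0
  refine (sq_le_sq₀ (norm_nonneg _) (by positivity)).mp ?_
  have h1 : ‖energyMap A (U : EnergySpace A)‖ ^ 2 = ‖p‖ ^ 2 + ‖q‖ ^ 2 := norm_energyMap_sq _
  have h2 : (6 + 2 * β) * (2 * (m + 1)) * f = (6 + 2 * β) * g := by rw [hg]; ring
  rw [h1, h2]
  have h3 : ‖q‖ ^ 2 ≤ g ^ 2 := pow_le_pow_left₀ (norm_nonneg _) hqle 2
  have h4 : f ^ 2 ≤ g ^ 2 := pow_le_pow_left₀ hf0 hfg 2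
  -- Half of ‖p‖² absorbs f‖p‖. Adding ‖q‖² and using f ≤ g gives 1 + 2(2 + β) + 1 = 6 + 2β.
  have h5 : ‖p‖ ^ 2 ≤ f ^ 2 + 2 * (2 + β) * g ^ 2 := by
    nlinarith [sq_nonneg (‖p‖ - f)]
  calc ‖p‖ ^ 2 + ‖q‖ ^ 2 ≤ (6 + 2 * β) * g ^ 2 := by linarith
    _ ≤ (6 + 2 * β) ^ 2 * g ^ 2 := by
      gcongr
      nlinarith
    _ = _ := by ring

end WaveOperator

/-! ### Bounded frequencies. -/

section WaveOperator

variable {H Y : Type*} [NormedAddCommGroup H] [InnerProductSpace ℂ H] [CompleteSpace H]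
  [NormedAddCommGroup Y] [InnerProductSpace ℂ Y] [CompleteSpace Y]
  {A S : H →ₗ.[ℂ] H} {B : Y →L[ℂ] H}

/-- A wave with real frequency is zero, when `p` is orthogonal to the kernel of `S = A^{1/2}`. -/
theorem eq_zero_of_stationary (hS : IsSqrt S A) (hB : UniqueContinuation A B) {s : ℝ}
    {p q : S.domain} (hq : S q = (Complex.I * s) • (p : H))
    (hp : S p = -((Complex.I * s) • (q : H) + B (B.adjoint (q : H))))
    (hker : ∀ k : S.domain, S k = 0 → inner ℂ (p : H) (k : H) = 0) :
    (p : H) = 0 ∧ (q : H) = 0 := by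
  have hI : ∀ x : H, inner ℂ x x = ((‖x‖ ^ 2 : ℝ) : ℂ) := fun x => by
    rw [inner_self_eq_norm_sq_to_K]; simp
  have hIY : ∀ x : Y, inner ℂ x x = ((‖x‖ ^ 2 : ℝ) : ℂ) := fun x => by
    rw [inner_self_eq_norm_sq_to_K]; simp
  have h1 := congrArg Complex.re (inner_apply_eq_of_isSelfAdjoint hS.1 p q)
  rw [hp, hq, inner_neg_left, inner_add_left, inner_smul_left, inner_smul_right,
    inner_damping, hI, hI, hIY, map_mul, Complex.conj_I, Complex.conj_ofReal] at h1
  simp only [Complex.neg_re, Complex.add_re, Complex.mul_re, Complex.mul_im, Complex.neg_im,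
    Complex.I_re, Complex.I_im, Complex.ofReal_re, Complex.ofReal_im] at h1
  -- In (Sp, q) = (p, Sq) the right side is is‖p‖², purely imaginary, while the left has real part
  -- -‖B*q‖².
  have h0 : B.adjoint (q : H) = 0 := by
    have : ‖B.adjoint (q : H)‖ ^ 2 = 0 := by linarith
    exact norm_eq_zero.mp (pow_eq_zero_iff two_ne_zero |>.mp this)
  rw [h0, map_zero, add_zero] at hp
  -- Otherwise Sq = isp lies in the domain of S, and q is an eigenvector of A for s² on which B*
  -- vanishes; s = 0 is included.
  have hq0 : (q : H) = 0 := by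
    by_contra hne
    have h2 : S q ∈ S.domain := hq ▸ S.domain.smul_mem _ p.2
    obtain ⟨h3, h4⟩ := hS.mem_domain q h2
    have h5 : (⟨S q, h2⟩ : S.domain) = (Complex.I * s) • p := Subtype.ext hq
    rw [h5, LinearPMap.map_smul, hp] at h4
    refine hB (-(Complex.I * s) ^ 2) ⟨q, h3⟩ hne ?_ h0
    rw [h4]
    module
  refine ⟨?_, hq0⟩
  rw [hq0, smul_zero, neg_zero] at hp
  exact inner_self_eq_zero.mp (hker p hp)

/-- With s bounded, the equations bound p and q in the graph norm of S, so a subsequence converges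
in H and the graph of S being closed makes the limit an exact stationary wave. That limit is zero,
against the normalization. -/
theorem false_of_approximate_stationary (hS : IsSqrt S A) {T : H →L[ℂ] H}
    (hT : IsInverseAddOne A T) (hTc : IsCompactOperator T) (hB : UniqueContinuation A B)
    {s₁ : ℝ} {s : ℕ → ℝ} (hs : ∀ n, |s n| ≤ s₁) {p q : ℕ → S.domain}
    (hpq : ∀ n, ‖(p n : H)‖ ^ 2 + ‖(q n : H)‖ ^ 2 = 1)
    (ha : Tendsto (fun n => (Complex.I * s n) • (p n : H) - S (q n)) atTop (𝓝 0))
    (hb : Tendsto (fun n => (Complex.I * s n) • (q n : H) + S (p n) + B (B.adjoint (q n : H)))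
      atTop (𝓝 0))
    (hker : ∀ n, ∀ k : S.domain, S k = 0 → inner ℂ (p n : H) (k : H) = 0) : False := by
  have hs₁ : 0 ≤ s₁ := (abs_nonneg _).trans (hs 0)
  have hp1 : ∀ n, ‖(p n : H)‖ ≤ 1 := fun n => by
    have := hpq n
    nlinarith [sq_nonneg ‖(q n : H)‖, norm_nonneg (p n : H)]
  have hq1 : ∀ n, ‖(q n : H)‖ ≤ 1 := fun n => by
    have := hpq n
    nlinarith [sq_nonneg ‖(p n : H)‖, norm_nonneg (q n : H)]
  have hz : ∀ n, ‖(Complex.I * s n : ℂ)‖ ≤ s₁ := fun n => by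
    rw [norm_mul, Complex.norm_I, one_mul, Complex.norm_real]; exact hs n
  obtain ⟨a', ha'⟩ := (Metric.isBounded_range_of_tendsto _ ha).exists_norm_le
  obtain ⟨b', hb'⟩ := (Metric.isBounded_range_of_tendsto _ hb).exists_norm_le
  have haC : ∀ n, ‖(Complex.I * s n) • (p n : H) - S (q n)‖ ≤ a' := fun n => ha' _ ⟨n, rfl⟩
  have hbC : ∀ n, ‖(Complex.I * s n) • (q n : H) + S (p n) + B (B.adjoint (q n : H))‖ ≤ b' :=
    fun n => hb' _ ⟨n, rfl⟩
  have ha0 : 0 ≤ a' := (norm_nonneg _).trans (haC 0)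
  have hb0 : 0 ≤ b' := (norm_nonneg _).trans (hbC 0)
  set β := ‖B ∘L B.adjoint‖ with hβ
  have hβ0 : 0 ≤ β := norm_nonneg _
  have hSq : ∀ n, ‖S (q n)‖ ≤ 1 + s₁ + a' + b' + β := fun n => by
    have h1 : S (q n) = (Complex.I * s n) • (p n : H)
        - ((Complex.I * s n) • (p n : H) - S (q n)) := by abel
    have h2 : ‖(Complex.I * s n) • (p n : H)‖ ≤ s₁ * 1 := by
      rw [norm_smul]; exact mul_le_mul (hz n) (hp1 n) (norm_nonneg _) hs₁
    rw [h1]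
    refine (norm_sub_le _ _).trans ?_
    linarith [haC n]
  have hSp : ∀ n, ‖S (p n)‖ ≤ 1 + s₁ + a' + b' + β := fun n => by
    have h1 : S (p n) = ((Complex.I * s n) • (q n : H) + S (p n) + B (B.adjoint (q n : H)))
        - (Complex.I * s n) • (q n : H) - (B ∘L B.adjoint) (q n : H) := by
      rw [ContinuousLinearMap.comp_apply]; abel
    have h2 : ‖(Complex.I * s n) • (q n : H)‖ ≤ s₁ * 1 := by
      rw [norm_smul]; exact mul_le_mul (hz n) (hq1 n) (norm_nonneg _) hs₁
    have h3 : ‖(B ∘L B.adjoint) (q n : H)‖ ≤ β * 1 :=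
      ((B ∘L B.adjoint).le_opNorm _).trans (by gcongr; exact hq1 n)
    rw [h1]
    refine (norm_sub_le _ _).trans ((add_le_add_left (norm_sub_le _ _) _).trans ?_)
    linarith [hbC n]
  have hle : ∀ x : ℝ, x ≤ 1 → x ≤ 1 + s₁ + a' + b' + β := fun x hx => by linarith
  obtain ⟨σ, -, φ₀, hφ₀, hσ⟩ := (isCompact_Icc (a := -s₁) (b := s₁)).tendsto_subseq
    (x := s) fun n => abs_le.mp (hs n)
  obtain ⟨φ₁, hφ₁, p₀, hp₀⟩ := hS.exists_tendsto_subseq hT hTc (p := fun n => p (φ₀ n))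
    (fun n => hle _ (hp1 _)) fun n => hSp _
  obtain ⟨φ₂, hφ₂, q₀, hq₀⟩ := hS.exists_tendsto_subseq hT hTc (p := fun n => q (φ₀ (φ₁ n)))
    (fun n => hle _ (hq1 _)) fun n => hSq _
  set φ : ℕ → ℕ := fun n => φ₀ (φ₁ (φ₂ n)) with hφ
  have hφt : Tendsto φ atTop atTop :=
    hφ₀.tendsto_atTop.comp (hφ₁.tendsto_atTop.comp hφ₂.tendsto_atTop)
  have hσ' : Tendsto (fun n => (Complex.I * s (φ n) : ℂ)) atTop (𝓝 (Complex.I * σ)) :=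
    ((Complex.continuous_ofReal.tendsto σ).comp
      (hσ.comp (hφ₁.tendsto_atTop.comp hφ₂.tendsto_atTop))).const_mul _
  have hp' : Tendsto (fun n => (p (φ n) : H)) atTop (𝓝 p₀) := hp₀.comp hφ₂.tendsto_atTop
  have hq' : Tendsto (fun n => (q (φ n) : H)) atTop (𝓝 q₀) := hq₀
  have hSq' : Tendsto (fun n => S (q (φ n))) atTop (𝓝 ((Complex.I * σ) • p₀)) := by
    have h1 := (hσ'.smul hp').sub (ha.comp hφt)
    rw [sub_zero] at h1
    exact h1.congr fun n => sub_sub_cancel _ _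
  have hSp' : Tendsto (fun n => S (p (φ n))) atTop
      (𝓝 (-((Complex.I * σ) • q₀ + B (B.adjoint q₀)))) := by
    have h1 := (hb.comp hφt).sub ((hσ'.smul hq').add
      (((B ∘L B.adjoint).continuous.tendsto q₀).comp hq'))
    rw [zero_sub] at h1
    refine h1.congr fun n => ?_
    simp only [Function.comp_apply, ContinuousLinearMap.comp_apply]
    abel
  obtain ⟨hpd, hpe⟩ := mem_domain_of_tendsto hS.1 hp' hSp'
  obtain ⟨hqd, hqe⟩ := mem_domain_of_tendsto hS.1 hq' hSq'
  obtain ⟨h1, h2⟩ := eq_zero_of_stationary (p := ⟨p₀, hpd⟩) (q := ⟨q₀, hqd⟩) hS hB hqe hpe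
    fun k hk => tendsto_nhds_unique (hp'.inner tendsto_const_nhds)
      (tendsto_const_nhds.congr fun n => (hker _ k hk).symm)
  simp only at h1 h2
  have h3 := (hp'.norm.pow 2).add (hq'.norm.pow 2)
  rw [h1, h2] at h3
  have h4 := tendsto_nhds_unique h3 (tendsto_const_nhds.congr fun n => (hpq (φ n)).symm)
  norm_num at h4

/-- In the variables p = A^{1/2}u₀ and q = u₁ the seminorm becomes a norm, and p is automatically
orthogonal to ker A^{1/2}. This is why s = 0 is allowed even when A has a kernel. -/
theorem exists_seminorm_le_of_abs_le (hA : IsSelfAdjoint A) (hA0 : IsNonneg A)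
    (hAc : HasCompactResolvent A) (hS : IsSqrt (sqrtOp A) A) (hB : UniqueContinuation A B)
    (s₁ : ℝ) : ∃ C : ℝ, 0 < C ∧ ∀ s : ℝ, |s| ≤ s₁ → ∀ U : (waveOp A B).domain,
      ‖energyMap A U‖
        ≤ C * ‖energyMap A ((Complex.I * s) • (U : EnergySpace A) - waveOp A B U)‖ := by
  by_contra! hcon
  obtain ⟨T, hT⟩ := exists_isInverseAddOne hA hA0
  choose s hs V hV using fun n : ℕ => hcon (n + 1) n.cast_add_one_pos
  have hpos : ∀ n, 0 < ‖energyMap A (V n)‖ := fun n =>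
    lt_of_le_of_lt (by positivity) (hV n)
  set c : ℕ → ℂ := fun n => ((‖energyMap A (V n)‖⁻¹ : ℝ) : ℂ) with hc
  have hcn : ∀ n, ‖c n‖ = ‖energyMap A (V n)‖⁻¹ := fun n => by
    rw [hc, Complex.norm_real, norm_inv, norm_norm]
  set U : ℕ → (waveOp A B).domain := fun n => c n • V n with hU
  set F : ℕ → EnergySpace A := fun n =>
    (Complex.I * s n) • (U n : EnergySpace A) - waveOp A B (U n) with hF
  have hU1 : ∀ n, ‖energyMap A (U n)‖ = 1 := fun n => by
    rw [hU, Submodule.coe_smul, map_smul, norm_smul, hcn, inv_mul_cancel₀ (hpos n).ne']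
  have hFV : ∀ n, F n = c n • ((Complex.I * s n) • (V n : EnergySpace A) - waveOp A B (V n)) :=
    fun n => by
      simp only [hF, hU, Submodule.coe_smul, LinearPMap.map_smul]
      rw [smul_sub, smul_comm]
  have hFn : ∀ n : ℕ, ‖energyMap A (F n)‖ ≤ 1 / ((n : ℝ) + 1) := fun n => by
    rw [hFV, map_smul, norm_smul, hcn, inv_mul_eq_div, div_le_div_iff₀ (hpos n)
      n.cast_add_one_pos, mul_comm, one_mul]
    exact (hV n).le
  have hlim : Tendsto (fun n => ‖energyMap A (F n)‖) atTop (𝓝 0) :=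
    squeeze_zero (fun n => norm_nonneg _) hFn tendsto_one_div_add_atTop_nhds_zero_nat
  choose h₁ h₂ h₃ using fun n => hS.apply_apply ⟨position A (U n : EnergySpace A), (U n).2.1⟩
  refine false_of_approximate_stationary hS hT (hT.isCompactOperator hAc) hB hs
    (p := fun n => ⟨sqrtOp A (position A (U n : EnergySpace A)), h₂ n⟩)
    (q := fun n => ⟨velocity A (U n : EnergySpace A), (U n).2.2⟩) (fun n => ?_) ?_ ?_
    fun n k hk => ?_
  · have h4 := norm_energyMap_sq (U n : EnergySpace A)
    rw [hU1, one_pow] at h4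
    exact h4.symm
  · refine squeeze_zero_norm (fun n => ?_) hlim
    have h4 := norm_sqrtOp_position_le (F n)
    rwa [hF, sqrtOp_position_resolvent] at h4
  · refine squeeze_zero_norm (fun n => ?_) hlim
    have h4 := norm_velocity_le (F n)
    rw [hF, velocity_resolvent] at h4
    rwa [h₃ n, add_comm (_ • _) (A _)]
  · change inner ℂ (sqrtOp A (position A (U n : EnergySpace A))) (k : H) = 0
    rw [inner_apply_eq_of_isSelfAdjoint hS.1, hk, inner_zero_right]

end WaveOperator

/-! ### The implications between the five assertions. -/

section Equivalence

variable {H Y : Type*} [NormedAddCommGroup H] [InnerProductSpace ℂ H] [CompleteSpace H]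
  [NormedAddCommGroup Y] [InnerProductSpace ℂ Y] [CompleteSpace Y]
  {A : H →ₗ.[ℂ] H} {B : Y →L[ℂ] H} {α : ℝ}

/-- The resolvent bound on the imaginary axis, in the energy seminorm. -/
def SeminormResolventBound (A : H →ₗ.[ℂ] H) (B : Y →L[ℂ] H) (α : ℝ) : Prop :=
  ∃ C s₀ : ℝ, 0 < C ∧ 0 < s₀ ∧ ∀ s : ℝ, s₀ ≤ |s| → ∀ U : (waveOp A B).domain,
    ‖energyMap A U‖ ≤ C * |s| ^ (1 / α) *
      ‖energyMap A ((Complex.I * s) • (U : EnergySpace A) - waveOp A B U)‖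

theorem SeminormResolventBound.of_isStableAtRate (hA : IsSelfAdjoint A) (hA0 : IsNonneg A)
    (hα : 0 < α) (h : IsStableAtRate A B fun t => 1 / t ^ α) : SeminormResolventBound A B α := by
  have hS := isSqrt_sqrtOp hA hA0
  have := completeSpace_energySpace hS
  obtain ⟨C, hC, hst⟩ := h
  have h2 : 0 < √(1 / 2 : ℝ) := Real.sqrt_pos.mpr (by norm_num)
  -- Dividing by √(1/2) removes the factor 1/2 in the energy.
  obtain ⟨C', hC', hb⟩ := (hilleYosida_waveOp (B := B) hA hA0 hS).exists_resolvent_bound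
    (isDissipative_waveOp hS) hα (M := C / √(1 / 2)) (by positivity) fun U hU h0 t ht => by
      have h1 := hst ⟨U 0, h0⟩ U hU rfl t ht
      rw [sqrt_energy, sqrt_seminormSq] at h1
      rw [div_div, mul_comm (√(1 / 2)), ← div_div, div_mul_eq_mul_div, le_div_iff₀ h2, mul_comm]
      simpa only [mul_one_div] using h1
  exact ⟨C', 1, hC', one_pos, fun s hs U => hb s U hs⟩

/-- High frequencies are given and bounded ones come from compactness; together they feed the
Borichev–Tomilov theorem. -/
theorem SeminormResolventBound.isStableAtRate (hA : IsSelfAdjoint A) (hA0 : IsNonneg A)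
    (hAc : HasCompactResolvent A) (hB : UniqueContinuation A B) (hα : 0 < α)
    (h : SeminormResolventBound A B α) : IsStableAtRate A B fun t => 1 / t ^ α := by
  have hS := isSqrt_sqrtOp hA hA0
  have := completeSpace_energySpace hS
  obtain ⟨C, s₀, hC, hs₀, hb⟩ := h
  obtain ⟨C₀, hC₀, hlow⟩ := exists_seminorm_le_of_abs_le hA hA0 hAc hS hB s₀
  obtain ⟨M, hM, hdec⟩ := (isDissipative_waveOp (B := B) hS).exists_decay
    (fun r hr => exists_isBoundedInverse_waveOp hA hA0 hS hr) hα (C := C + C₀) (by positivity)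
    fun s V => by
      rcases le_total s₀ |s| with hs | hs
      · refine (hb s hs V).trans ?_
        gcongr <;> linarith [abs_nonneg s]
      · refine (hlow s hs V).trans ?_
        gcongr
        calc C₀ ≤ (C + C₀) * 1 := by linarith
          _ ≤ _ := by
            gcongr
            exact Real.one_le_rpow (by linarith [abs_nonneg s]) (by positivity)
  refine ⟨M, hM, fun U₀ U hU h0 t ht => ?_⟩
  have hmem : U 0 ∈ (waveOp A B).domain := h0 ▸ U₀.2
  have h1 := hdec U hU hmem t ht
  have h2 : (⟨U 0, hmem⟩ : (waveOp A B).domain) = U₀ := Subtype.ext h0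
  rw [h2] at h1
  rw [sqrt_energy, sqrt_seminormSq, mul_one_div]
  refine le_trans ?_ h1
  refine mul_le_of_le_one_left (norm_nonneg _) (Real.sqrt_le_one.mpr (by norm_num))

theorem SeminormResolventBound.of_waveSymbol (hA : IsSelfAdjoint A) (hA0 : IsNonneg A)
    (hα : 0 < α)
    (h : ∃ C s₀ : ℝ, 0 < C ∧ 0 < s₀ ∧ ∀ s : ℝ, s₀ ≤ |s| →
      InverseNormLE (waveSymbol A B (Complex.I * s)) (C * |s| ^ (1 / α - 1))) :
    SeminormResolventBound A B α := by
  obtain ⟨C, s₀, hC, hs₀, hb⟩ := h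
  refine ⟨(6 + 2 * ‖B ∘L B.adjoint‖) * (2 * (C + 1)), max s₀ 1, by positivity, by positivity,
    fun s hs U => ?_⟩
  have hs1 : 1 ≤ |s| := (le_max_right _ _).trans hs
  have hs0 : 0 < |s| := by linarith
  -- The duality argument uses the inverse at -s; the hypothesis depends on |s| only.
  have hQ := hb (-s) (by rw [abs_neg]; exact (le_max_left _ _).trans hs)
  rw [abs_neg] at hQ
  refine (seminorm_le_of_waveSymbol (isSqrt_sqrtOp hA hA0) hs1 (by positivity) hQ U).trans ?_
  have h1 : C * |s| ^ (1 / α - 1) * |s| = C * |s| ^ (1 / α) := by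
    rw [mul_assoc, ← Real.rpow_add_one hs0.ne', sub_add_cancel]
  have h2 : 1 ≤ |s| ^ (1 / α) := Real.one_le_rpow hs1 (by positivity)
  rw [h1, mul_assoc _ (2 * (C + 1)), mul_assoc 2 (C + 1)]
  gcongr
  linarith

theorem SeminormResolventBound.inverseNormLE (hA : IsSelfAdjoint A) (hA0 : IsNonneg A)
    (hAc : HasCompactResolvent A) (hB : UniqueContinuation A B) (hα : 0 < α)
    (h : SeminormResolventBound A B α) :
    ∃ C s₀ : ℝ, 0 < C ∧ 0 < s₀ ∧ ∀ s : ℝ, s₀ ≤ |s| →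
      InverseNormLE (resolventOp (waveOp A B) (Complex.I * s)) (C * |s| ^ (1 / α)) := by
  have hS := isSqrt_sqrtOp hA hA0
  obtain ⟨C, s₀, hC, hs₀, hb⟩ := h
  refine ⟨2 * C + 1, max s₀ 1, by positivity, by positivity, fun s hs => ?_⟩
  have hs1 : 1 ≤ |s| := (le_max_right _ _).trans hs
  have hs0 : s ≠ 0 := abs_pos.mp (by linarith)
  have h1 : 1 ≤ |s| ^ (1 / α) := Real.one_le_rpow hs1 (by positivity)
  refine inverseNormLE_of_surjective (by positivity) (fun F => ?_)
    fun (U : (waveOp A B).domain) => ?_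
  · obtain ⟨U, hU⟩ := surjective_resolventOp_waveOp hS
      (surjective_waveSymbol hA hA0 hAc hB hs0) F
    exact ⟨U, (resolventOp_apply _ _ _).trans hU⟩
  · have h2 := hb s ((le_max_left _ _).trans hs) U
    have hz : ‖(Complex.I * s : ℂ)‖ = |s| := by simp
    have h3 := norm_le_of_resolvent (z := Complex.I * s) (norm_pos_iff.mp (by rw [hz]; linarith)) U
    rw [hz] at h3
    rw [resolventOp_apply]
    set F := (Complex.I * s) • (U : EnergySpace A) - waveOp A B U
    have h4 : ‖energyMap A U‖ ≤ C * |s| ^ (1 / α) * ‖F‖ :=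
      h2.trans (by gcongr; exact norm_energyMap_le F)
    have h5 : (‖energyMap A U‖ + ‖F‖) / |s| ≤ ‖energyMap A U‖ + ‖F‖ :=
      div_le_self (by positivity) hs1
    have h6 : 1 * ‖F‖ ≤ |s| ^ (1 / α) * ‖F‖ := by gcongr
    linarith

/-- The vector U = (u, isu) satisfies (is - 𝒜)U = (0, P(is)u), and its velocity has norm |s|‖u‖,
which is where the factor 1/|s| comes from. -/
theorem inverseNormLE_waveSymbol (hA : IsSelfAdjoint A) (hA0 : IsNonneg A)
    (hAc : HasCompactResolvent A) (hB : UniqueContinuation A B)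
    {s : ℝ} (hs : s ≠ 0) {M : ℝ} (hM : 0 ≤ M)
    (h : InverseNormLE (resolventOp (waveOp A B) (Complex.I * s)) M) :
    InverseNormLE (waveSymbol A B (Complex.I * s)) (M / |s|) := by
  have hS := isSqrt_sqrtOp hA hA0
  refine inverseNormLE_of_surjective (by positivity) (surjective_waveSymbol hA hA0 hAc hB hs)
    fun (u : A.domain) => ?_
  obtain ⟨hu, -, -⟩ := hS.apply_apply u
  obtain ⟨U, hU0, hU1⟩ := exists_mem_waveDomain (B := B) hS u
    ((Complex.I * s) • ⟨(u : H), hu⟩)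
  have h1 := h.norm_le U
  rw [resolventOp_apply] at h1
  set F := (Complex.I * s) • (U : EnergySpace A) - waveOp A B U with hF
  have hpos : (position A F : H) = 0 := by
    rw [hF, position_resolvent, hU0, hU1, Submodule.coe_smul, sub_self]
  have hvel : velocity A F = waveSymbol A B (Complex.I * s) u := by
    have h2 : (⟨position A U, U.2.1⟩ : A.domain) = u := Subtype.ext hU0
    rw [hF, velocity_resolvent, h2, hU1, waveSymbol_apply, Submodule.coe_smul]
    simp only [map_smul]
    module
  have hFn : ‖F‖ = ‖waveSymbol A B (Complex.I * s) u‖ := by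
    have h2 : position A F = 0 := Subtype.ext hpos
    have h3 := norm_energySpace_sq F
    rw [h2, LinearPMap.map_zero, hvel] at h3
    simp only [ZeroMemClass.coe_zero, norm_zero, ne_eq, OfNat.ofNat_ne_zero, not_false_eq_true,
      zero_pow, zero_add] at h3
    exact (sq_eq_sq₀ (norm_nonneg _) (norm_nonneg _)).mp h3
  have h4 : |s| * ‖(u : H)‖ ≤ ‖(U : EnergySpace A)‖ := by
    have h5 : ‖velocity A (U : EnergySpace A)‖ = |s| * ‖(u : H)‖ := by
      rw [hU1, Submodule.coe_smul, norm_smul]; simp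
    rw [← h5]
    exact (norm_velocity_le _).trans (norm_energyMap_le _)
  have hs0 : 0 < |s| := abs_pos.mpr hs
  rw [div_mul_eq_mul_div, le_div_iff₀ hs0, ← hFn]
  linarith

theorem resolvent_bound_near_axis (hS : IsSqrt (sqrtOp A) A)
    (h : ∃ C s₀ : ℝ, 0 < C ∧ 0 < s₀ ∧ ∀ s : ℝ, s₀ ≤ |s| →
      InverseNormLE (resolventOp (waveOp A B) (Complex.I * s)) (C * |s| ^ (1 / α))) :
    ∃ C s₀ : ℝ, 0 < C ∧ 0 < s₀ ∧ ∀ z : ℂ, s₀ ≤ |z.im| →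
      |z.re| ≤ 1 / (C * |z.im| ^ (1 / α)) →
      InverseNormLE (resolventOp (waveOp A B) z) (C * |z.im| ^ (1 / α)) := by
  have := completeSpace_energySpace hS
  obtain ⟨C, s₀, hC, hs₀, hb⟩ := h
  -- The constant 2C serves twice: it narrows the strip so that the Neumann series has ratio at most
  -- 1/2, and it absorbs the resulting factor 2.
  refine ⟨2 * C, s₀, by positivity, hs₀, fun z hz hre => ?_⟩
  have hz0 : 0 < |z.im| := by linarith
  have h1 : z - Complex.I * z.im = z.re := by
    rw [sub_eq_iff_eq_add, mul_comm]; exact (Complex.re_add_im z).symm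
  rw [mul_assoc]
  refine (hb z.im hz).perturb (by positivity) ?_
  rw [h1, Complex.norm_real, Real.norm_eq_abs]
  rw [le_div_iff₀ (by positivity)] at hre
  linarith

theorem observability_of_waveSymbol
    (h : ∃ C s₀ : ℝ, 0 < C ∧ 0 < s₀ ∧ ∀ s : ℝ, s₀ ≤ |s| →
      InverseNormLE (waveSymbol A B (Complex.I * s)) (C * |s| ^ (1 / α - 1))) :
    ∃ C s₀ : ℝ, 0 < C ∧ 0 < s₀ ∧ ∀ s : ℝ, s₀ ≤ |s| → ∀ u : A.domain,
      ‖(u : H)‖ ^ 2 ≤ C * (|s| ^ (2 / α - 2) * ‖waveSymbol A B (Complex.I * s) u‖ ^ 2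
        + |s| ^ (1 / α) * ‖B.adjoint (u : H)‖ ^ 2) := by
  obtain ⟨C, s₀, hC, hs₀, hb⟩ := h
  refine ⟨C ^ 2, s₀, by positivity, hs₀, fun s hs u => ?_⟩
  have hs0 : 0 < |s| := by linarith
  have h1 := pow_le_pow_left₀ (norm_nonneg _) ((hb s hs).norm_le u) 2
  have h2 : (|s| ^ (1 / α - 1)) ^ 2 = |s| ^ (2 / α - 2) := by
    rw [← Real.rpow_mul_natCast hs0.le]; congr 1; push_cast; ring
  rw [mul_pow, mul_pow, h2, mul_assoc] at h1
  refine h1.trans ?_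
  gcongr
  exact le_add_of_nonneg_right (by positivity)

theorem waveSymbol_of_observability (hA : IsSelfAdjoint A) (hA0 : IsNonneg A)
    (hAc : HasCompactResolvent A) (hB : UniqueContinuation A B)
    (h : ∃ C s₀ : ℝ, 0 < C ∧ 0 < s₀ ∧ ∀ s : ℝ, s₀ ≤ |s| → ∀ u : A.domain,
      ‖(u : H)‖ ^ 2 ≤ C * (|s| ^ (2 / α - 2) * ‖waveSymbol A B (Complex.I * s) u‖ ^ 2
        + |s| ^ (1 / α) * ‖B.adjoint (u : H)‖ ^ 2)) :
    ∃ C s₀ : ℝ, 0 < C ∧ 0 < s₀ ∧ ∀ s : ℝ, s₀ ≤ |s| →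
      InverseNormLE (waveSymbol A B (Complex.I * s)) (C * |s| ^ (1 / α - 1)) := by
  obtain ⟨C, s₀, hC, hs₀, hb⟩ := h
  -- With x = ‖u‖ and Y = |s|^(1/α-1)‖P(is)u‖, the damping term is at most Yx, so x² ≤ C(Y² + Yx).
  -- If x > (C + 1)Y, the right side would be at most x²(C² + 2C)/(C + 1)² < x².
  refine ⟨C + 1, s₀, by positivity, hs₀, fun s hs => ?_⟩
  have hs0 : 0 < |s| := by linarith
  refine inverseNormLE_of_surjective (by positivity)
    (surjective_waveSymbol hA hA0 hAc hB (abs_pos.mp hs0)) fun (u : A.domain) => ?_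
  have h1 := hb s hs u
  have h2 : |s| ^ (2 / α - 2) = (|s| ^ (1 / α - 1)) ^ 2 := by
    rw [← Real.rpow_mul_natCast hs0.le]; congr 1; push_cast; ring
  have h3 : |s| ^ (1 / α) = |s| ^ (1 / α - 1) * |s| := by
    rw [← Real.rpow_add_one hs0.ne', sub_add_cancel]
  have h4 := abs_mul_norm_adjoint_sq_le (B := B) hA s u
  rw [h2, h3, ← mul_pow, mul_assoc (|s| ^ (1 / α - 1))] at h1
  have ha : 0 ≤ |s| ^ (1 / α - 1) := by positivity
  set a := |s| ^ (1 / α - 1)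
  set x := ‖(u : H)‖ with hx
  set y := ‖waveSymbol A B (Complex.I * s) u‖
  have hx0 : 0 ≤ x := norm_nonneg _
  have hy0 : 0 ≤ a * y := mul_nonneg ha (norm_nonneg _)
  have h5 : x ^ 2 ≤ C * ((a * y) ^ 2 + a * y * x) := by
    refine h1.trans ?_
    rw [mul_assoc a y]
    gcongr
  rw [mul_assoc]
  by_contra! hlt
  have h6 : 0 < x := lt_of_le_of_lt (by positivity) hlt
  have h7 : a * y ≤ x := by nlinarith
  nlinarith [mul_le_mul_of_nonneg_left h7 hy0, mul_pos h6 (sub_pos.mpr hlt)]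

end Equivalence

end DampedWave

theorem mainTheorem3 {H Y : Type*}
    [NormedAddCommGroup H] [InnerProductSpace ℂ H] [CompleteSpace H]
    [NormedAddCommGroup Y] [InnerProductSpace ℂ Y] [CompleteSpace Y]
    (A : H →ₗ.[ℂ] H) (hA_sa : IsSelfAdjoint A) (hA_nonneg : DampedWave.IsNonneg A)
    (hA_compact : DampedWave.HasCompactResolvent A)
    (B : Y →L[ℂ] H)
    (hB : ∀ (μ : ℂ) (φ : A.domain), (φ : H) ≠ 0 → A φ = μ • (φ : H) →
      B.adjoint (φ : H) ≠ 0)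
    (α : ℝ) (hα : 0 < α) :
    List.TFAE [
      DampedWave.IsStableAtRate A B (fun t => 1 / t ^ α),
      ∃ C s₀ : ℝ, 0 < C ∧ 0 < s₀ ∧ ∀ s : ℝ, s₀ ≤ |s| →
        DampedWave.InverseNormLE
          (DampedWave.resolventOp (DampedWave.waveOp A B) (Complex.I * s))
          (C * |s| ^ (1 / α)),
      ∃ C s₀ : ℝ, 0 < C ∧ 0 < s₀ ∧ ∀ z : ℂ, s₀ ≤ |z.im| →
        |z.re| ≤ 1 / (C * |z.im| ^ (1 / α)) →
        DampedWave.InverseNormLE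
          (DampedWave.resolventOp (DampedWave.waveOp A B) z)
          (C * |z.im| ^ (1 / α)),
      ∃ C s₀ : ℝ, 0 < C ∧ 0 < s₀ ∧ ∀ s : ℝ, s₀ ≤ |s| →
        DampedWave.InverseNormLE
          (DampedWave.waveSymbol A B (Complex.I * s))
          (C * |s| ^ (1 / α - 1)),
      ∃ C s₀ : ℝ, 0 < C ∧ 0 < s₀ ∧ ∀ s : ℝ, s₀ ≤ |s| → ∀ u : A.domain,
        ‖(u : H)‖ ^ 2 ≤
          C * (|s| ^ (2 / α - 2) * ‖DampedWave.waveSymbol A B (Complex.I * s) u‖ ^ 2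
            + |s| ^ (1 / α) * ‖B.adjoint (u : H)‖ ^ 2)] := by
  have hB' : DampedWave.UniqueContinuation A B := hB
  tfae_have 1 → 2 := fun h =>
    (DampedWave.SeminormResolventBound.of_isStableAtRate hA_sa hA_nonneg hα h).inverseNormLE
      hA_sa hA_nonneg hA_compact hB' hα
  tfae_have 2 → 3 :=
    DampedWave.resolvent_bound_near_axis (DampedWave.isSqrt_sqrtOp hA_sa hA_nonneg)
  -- The imaginary axis is the case Re z = 0 of the strip.
  tfae_have 3 → 2 := fun ⟨C, s₀, hC, hs₀, h⟩ => ⟨C, s₀, hC, hs₀, fun s hs => by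
    have h1 := h (Complex.I * s) (by simpa using hs)
      (by simp only [Complex.mul_re, Complex.I_re, Complex.I_im, Complex.ofReal_im]; simp
          positivity)
    simpa using h1⟩
  tfae_have 2 → 4 := fun ⟨C, s₀, hC, hs₀, h⟩ => ⟨C, s₀, hC, hs₀, fun s hs => by
    have hs0 : 0 < |s| := hs₀.trans_le hs
    have h1 := DampedWave.inverseNormLE_waveSymbol hA_sa hA_nonneg hA_compact hB'
      (abs_pos.mp hs0) (by positivity) (h s hs)
    rwa [mul_div_assoc, ← Real.rpow_sub_one hs0.ne'] at h1⟩
  tfae_have 4 → 1 := fun h =>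
    (DampedWave.SeminormResolventBound.of_waveSymbol hA_sa hA_nonneg hα h).isStableAtRate
      hA_sa hA_nonneg hA_compact hB' hα
  tfae_have 4 → 5 := DampedWave.observability_of_waveSymbol
  tfae_have 5 → 4 :=
    DampedWave.waveSymbol_of_observability hA_sa hA_nonneg hA_compact hB'
  tfae_finish
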